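/- Let $k$ be a field of characteristic zero and let $B$ be a (not necessarily unital) bialgebra over $k$: an associative $k$-algebra, possibly without unit, which is also a coassociative coalgebra with coproduct $\delta_B$ and counit $\varepsilon_B$, both multiplicative. Write $T(B)^+=\bigoplus_{n\ge 1}T^n(B)$, and $(x_1,\dots,x_n)$ for $x_1\otimes\cdots\otimes x_n\in T^n(B)$. In $T(T(B)^+)$ the product is written by juxtaposition. For $a=(x_1,\dots,x_n)$ and a composition $\sigma=(r_1,\dots,r_\ell)$ of $n$ put $$a|\sigma=(x_1,\dots,x_{r_1})(x_{r_1+1},\dots,x_{r_1+r_2})\cdots(x_{n-r_\ell+1},\dots,x_n)\in T(T(B)^+),$$ $$a/\sigma=(x_1\cdots x_{r_1},\;x_{r_1+1}\cdots x_{r_1+r_2},\;\dots,\;x_{n-r_\ell+1}\cdots x_n)\in T^{\ell}(B).$$ Let $\delta(a)=\sum a_{(1)}\otimes a_{(2)}$ be the algebra map $T(B)\to T(B)\otimes T(B)$ extending $\delta_B$. Let $\Delta:T(T(B)^+)\to T(T(B)^+)\otimes T(T(B)^+)$ be the algebra map with $\Delta a=\sum_{\sigma} a_{(1)}|\sigma\otimes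 a_{(2)}/\sigma$ for $a\in T^n(B)$, $n\ge1$ (sum over all compositions $\sigma$ of $n$), and let $\varepsilon:T(T(B)^+)\to k$ be the algebra map with $\varepsilon((x))=\varepsilon_B(x)$ and $\varepsilon((x_1,\dots,x_n))=0$ for $n>1$. If $B=\bigoplus_{d\ge0}B_d$ is a graded bialgebra (any $B$ is one, with all elements in degree $0$), define the degree on $T(T(B)^+)$ by $\deg(x_1,\dots,x_n)=|x_1|+\cdots+|x_n|+n-1$ for homogeneous $x_i$ and $\deg(a_1\cdots a_m)=\deg a_1+\cdots+\deg a_m$. **(Noncommutative case.)** $(T(T(B)^+),\Delta,\varepsilon)$ is a bialgebra. Let $J$ be the two-sided ideal of $T(T(B)^+)$ generated by the elements $(x)-\varepsilon_B(x)1$, $x\in B$. Then $J$ is a biideal (an ideal and a coideal), and the quotient bialgebra $T(T(B)^+)/J$ is a Hopf algebra. Moreover, for every grading of the bialgebra $B$ by $\mathbb N$, the induced degree makes $T(T(B)^+)/J$ a connected graded bialgebra (graded by $\mathbb N$, with degree-$0$ part $k\cdot 1$). **(Commutative case.)** Assume in addition that $B$ is commutative. Let $S(T(B)^+)$ carry the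 algebra maps $\Delta$ and $\varepsilon$ induced by those of $T(T(B)^+)$ through the canonical projection $T(T(B)^+)\to S(T(B)^+)$. Identify $S(B)^+$ with the image of $T(B)^+$ under the symmetrizing map $\alpha(x_1,\dots,x_n)=\{x_1,\dots,x_n\}:=\sum_{\pi\in\Sigma_n}(x_{\pi(1)},\dots,x_{\pi(n)})$, and $S(S(B)^+)$ with the subalgebra of $S(T(B)^+)$ generated by $S(B)^+$. Then $\Delta$ and $\varepsilon$ restrict to $S(S(B)^+)$ and make it a bialgebra. Let $J'$ be the ideal of $S(S(B)^+)$ generated by the elements $\{x\}-\varepsilon_B(x)1$, $x\in B$. Then $J'$ is a biideal, and the quotient bialgebra $S(S(B)^+)/J'$ is a (commutative) Hopf algebra. Moreover, for every grading of the bialgebra $B$ by $\mathbb N$, the degree induced from $S(T(B)^+)$ makes $S(S(B)^+)/J'$ a connected graded bialgebra. -/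

import Mathlib

open scoped TensorProduct DirectSum

/-- A not necessarily unital bialgebra `B` over `k`: an associative `k`-algebra, possibly without
unit, which is a coassociative counital coalgebra whose coproduct and counit are multiplicative. -/
class NonUnitalBialgebra (k B : Type*) [Field k] [NonUnitalRing B] [Module k B]
    [IsScalarTower k B B] [SMulCommClass k B B] extends Coalgebra k B where
  counit_mul : ∀ x y : B, counit (x * y) = counit x * counit y
  comul_mul : ∀ x y : B, comul (x * y) = comul x * comul y

namespace Pinter

noncomputable section

/-! ### Bialgebras, Hopf algebras and gradings -/

section General

variable {k A : Type*} [Field k] [Ring A]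

/-- The algebra maps `Δ` and `ε` turn the algebra `A` into a bialgebra. -/
structure IsBialgebra [Algebra k A] (Δ : A →ₐ[k] A ⊗[k] A) (ε : A →ₐ[k] k) : Prop where
  coassoc : (Algebra.TensorProduct.assoc k k k A A A).toAlgHom.comp
      ((Algebra.TensorProduct.map Δ (.id k A)).comp Δ)
    = (Algebra.TensorProduct.map (.id k A) Δ).comp Δ
  counit_left : (Algebra.TensorProduct.map ε (.id k A)).comp Δ
    = (Algebra.TensorProduct.lid k A).symm
  counit_right : (Algebra.TensorProduct.map (.id k A) ε).comp Δ
    = (Algebra.TensorProduct.rid k k A).symm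

/-- The bialgebra with the given algebra structure, coproduct `Δ` and counit `ε`. -/
abbrev IsBialgebra.toBialgebra [Algebra k A] {Δ : A →ₐ[k] A ⊗[k] A} {ε : A →ₐ[k] k}
    (h : IsBialgebra Δ ε) : Bialgebra k A :=
  Bialgebra.ofAlgHom Δ ε h.coassoc h.counit_left h.counit_right

variable (k A) in
/-- The bialgebra `A` is a Hopf algebra, i.e. it has an antipode. -/
def IsHopf [b : Bialgebra k A] : Prop :=
  ∃ H : HopfAlgebra k A, H.toBialgebra = b

/-- The submodules `𝒢 n` make the coalgebra `C` a graded coalgebra (graded by `ℕ`). -/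
structure IsGradedCoalgebra {C : Type*} [AddCommGroup C] [Module k C] [Coalgebra k C]
    (𝒢 : ℕ → Submodule k C) : Prop where
  isInternal : DirectSum.IsInternal 𝒢
  comul_mem : ∀ n, ∀ x ∈ 𝒢 n, (Coalgebra.comul x : C ⊗[k] C) ∈
    ⨆ (p : ℕ × ℕ) (_ : p.1 + p.2 = n),
      LinearMap.range (TensorProduct.map (𝒢 p.1).subtype (𝒢 p.2).subtype)
  counit_eq_zero : ∀ n, n ≠ 0 → ∀ x ∈ 𝒢 n, (Coalgebra.counit x : k) = 0

/-- The submodules `𝒢 n` make `A` a connected graded bialgebra. -/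
structure IsConnectedGradedBialgebra [Bialgebra k A] (𝒢 : ℕ → Submodule k A) : Prop
    extends IsGradedCoalgebra 𝒢 where
  one_mem : (1 : A) ∈ 𝒢 0
  mul_mem : ∀ i j, ∀ x ∈ 𝒢 i, ∀ y ∈ 𝒢 j, x * y ∈ 𝒢 (i + j)
  connected : 𝒢 0 = Submodule.span k {(1 : A)}

end General

/-- The submodules `𝒜 n` make `B` a graded, not necessarily unital, bialgebra. -/
structure IsGradedNonUnitalBialgebra {k B : Type*} [Field k] [NonUnitalRing B] [Module k B]
    [IsScalarTower k B B] [SMulCommClass k B B] [NonUnitalBialgebra k B]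
    (𝒜 : ℕ → Submodule k B) : Prop extends IsGradedCoalgebra 𝒜 where
  mul_mem : ∀ i j, ∀ x ∈ 𝒜 i, ∀ y ∈ 𝒜 j, x * y ∈ 𝒜 (i + j)

/-! ### The algebras `T(B)⁺` and `T(T(B)⁺)` -/

section Algebras

variable (k B : Type*) [Field k] [AddCommGroup B] [Module k B]

/-- `T(B)⁺ = ⨁_{n ≥ 1} Tⁿ(B)`, as a subspace of `T(B)`: the kernel of the projection
`T(B) → T⁰(B) = k`. -/
def TPlus : Submodule k (TensorAlgebra k B) :=
  LinearMap.ker (TensorAlgebra.algebraMapInv (R := k) (M := B)).toLinearMap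

/-- `T(T(B)⁺)`. -/
abbrev TT : Type _ := TensorAlgebra k (TPlus k B)

/-- `S(T(B)⁺)`. -/
abbrev ST : Type _ := SymmetricAlgebra k (TPlus k B)

lemma sub_mem_TPlus (a : TensorAlgebra k B) :
    (LinearMap.id - Algebra.linearMap k (TensorAlgebra k B) ∘ₗ
      (TensorAlgebra.algebraMapInv (R := k) (M := B)).toLinearMap :
        TensorAlgebra k B →ₗ[k] TensorAlgebra k B) a ∈ TPlus k B := by
  rw [TPlus, LinearMap.mem_ker]
  simp [TensorAlgebra.algebraMap_leftInverse B _]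

/-- The projection `T(B) → T(B)⁺` with kernel `T⁰(B) = k`. -/
def projPlus : TensorAlgebra k B →ₗ[k] TPlus k B :=
  LinearMap.codRestrict (TPlus k B)
    (LinearMap.id - Algebra.linearMap k (TensorAlgebra k B) ∘ₗ
      (TensorAlgebra.algebraMapInv (R := k) (M := B)).toLinearMap)
    (sub_mem_TPlus k B)

/-- An element `a` of `T(B)⁺` viewed as a generator of `T(T(B)⁺)`; elements of `T⁰(B)` go to `0`. -/
def gen : TensorAlgebra k B →ₗ[k] TT k B :=
  TensorAlgebra.ι k ∘ₗ projPlus k B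

/-- The projection of `T(B)` onto `Tⁿ(B)`. -/
def component (n : ℕ) : TensorAlgebra k B →ₗ[k] ⨂[k]^n B :=
  DirectSum.component k ℕ (fun n => ⨂[k]^n B) n ∘ₗ
    (TensorAlgebra.toDirectSum (R := k) (M := B)).toLinearMap

/-- The linear map on `T(B) = ⨁ₙ Tⁿ(B)` with given restrictions to the `Tⁿ(B)`. -/
def liftComponents {M : Type*} [AddCommGroup M] [Module k M]
    (f : (n : ℕ) → (⨂[k]^n B) →ₗ[k] M) : TensorAlgebra k B →ₗ[k] M :=
  DirectSum.toModule k ℕ M f ∘ₗ (TensorAlgebra.toDirectSum (R := k) (M := B)).toLinearMap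

lemma liftComponents_tprod {M : Type*} [AddCommGroup M] [Module k M]
    (f : (n : ℕ) → (⨂[k]^n B) →ₗ[k] M) (n : ℕ) (x : Fin n → B) :
    liftComponents k B f (TensorAlgebra.tprod k B n x) = f n (PiTensorProduct.tprod k x) := by
  rw [liftComponents, LinearMap.comp_apply, AlgHom.toLinearMap_apply,
    TensorAlgebra.toDirectSum_tensorPower_tprod]
  exact DirectSum.toModule_lof k n _

end Algebras

/-! ### Restriction `a|σ` and contraction `a/σ` along a composition `σ` -/

lemma block_update {B : Type*} {n : ℕ} (σ : Composition n) (x : Fin n → B) (j : Fin n) (z : B)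
    {M : Type*} (f : (r : ℕ) → (Fin r → B) → M) :
    (fun i => f _ (Function.update x j z ∘ σ.embedding i)) =
      Function.update (fun i => f _ (x ∘ σ.embedding i)) (σ.index j)
        (f _ (Function.update (x ∘ σ.embedding (σ.index j)) (σ.invEmbedding j) z)) := by
  funext i
  by_cases h : i = σ.index j
  · subst h
    rw [Function.update_self]
    have := Function.update_comp_eq_of_injective x (σ.embedding (σ.index j)).injective
      (σ.invEmbedding j) z
    rw [σ.embedding_comp_inv j] at this
    rw [this]
  · rw [Function.update_of_ne h]
    congr 1
    apply Function.update_comp_eq_of_notMem_range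
    rwa [σ.mem_range_embedding_iff']

section Restriction

variable {k B : Type*} [Field k] [AddCommGroup B] [Module k B]

/-- The multilinear map `(x₁, …, xₙ) ↦ (x₁, …, x_{r₁}) (x_{r₁+1}, …, x_{r₁+r₂}) ⋯` with values in
`T(T(B)⁺)`, for a composition `σ = (r₁, …, r_ℓ)` of `n`. -/
def restrictMultilinear {n : ℕ} (σ : Composition n) :
    MultilinearMap k (fun _ : Fin n => B) (TT k B) where
  toFun x := MultilinearMap.mkPiAlgebraFin k σ.length (TT k B)
    (fun i => gen k B (TensorAlgebra.tprod k B _ (x ∘ σ.embedding i)))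
  map_update_add' {inst} x j y z := by
    obtain rfl := Subsingleton.elim inst (instDecidableEqFin n)
    simp only [block_update σ x j _ (fun r w => gen k B (TensorAlgebra.tprod k B r w)),
      MultilinearMap.map_update_add, map_add]
  map_update_smul' {inst} x j c y := by
    obtain rfl := Subsingleton.elim inst (instDecidableEqFin n)
    simp only [block_update σ x j _ (fun r w => gen k B (TensorAlgebra.tprod k B r w)),
      MultilinearMap.map_update_smul, map_smul]

/-- The restriction `a ↦ a|σ`, extended by `0` to the `Tᵐ(B)` with `m ≠ |σ|`. -/
def restrict {n : ℕ} (σ : Composition n) : TensorAlgebra k B →ₗ[k] TT k B :=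
  PiTensorProduct.lift (restrictMultilinear σ) ∘ₗ component k B n

end Restriction

section Contraction

variable (k B : Type*) [Field k] [NonUnitalRing B] [Module k B]
  [IsScalarTower k B B] [SMulCommClass k B B]

/-- The product `μ : T(B)⁺ → B`, `(x₁, …, xₙ) ↦ x₁ ⋯ xₙ`, computed in the unitization
`k × B` of `B`. -/
def mu : TPlus k B →ₗ[k] B :=
  Unitization.sndHom k k B ∘ₗ
    (TensorAlgebra.lift k (Unitization.inrHom k k B)).toLinearMap ∘ₗ (TPlus k B).subtype

/-- The algebra map `T(μ) : T(T(B)⁺) → T(B)`. -/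
def tensorMu : TT k B →ₐ[k] TensorAlgebra k B :=
  TensorAlgebra.lift k (TensorAlgebra.ι k ∘ₗ mu k B)

/-- The contraction `a ↦ a/σ = T(μ)(a|σ)`, viewed as an element of `T(B)⁺ ⊆ T(T(B)⁺)`. -/
def contract {n : ℕ} (σ : Composition n) : TensorAlgebra k B →ₗ[k] TT k B :=
  gen k B ∘ₗ (tensorMu k B).toLinearMap ∘ₗ restrict σ

end Contraction

/-! ### The renormalization coproduct and counit -/

section Renormalization

variable (k B : Type*) [Field k] [NonUnitalRing B] [Module k B]
  [IsScalarTower k B B] [SMulCommClass k B B] [NonUnitalBialgebra k B]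

/-- The free coproduct `δ` of `T(B)`: the algebra map extending the coproduct of `B`. -/
def freeComul : TensorAlgebra k B →ₐ[k] TensorAlgebra k B ⊗[k] TensorAlgebra k B :=
  TensorAlgebra.lift k
    (TensorProduct.map (TensorAlgebra.ι k) (TensorAlgebra.ι k) ∘ₗ Coalgebra.comul)

/-- `a ↦ ∑_{σ} a₍₁₎|σ ⊗ a₍₂₎/σ` for `a ∈ Tⁿ(B)`, the sum being over all compositions `σ` of `n`
and `δ(a) = ∑ a₍₁₎ ⊗ a₍₂₎`. -/
def comulOnTensor : TensorAlgebra k B →ₗ[k] TT k B ⊗[k] TT k B :=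
  liftComponents k B fun n =>
    (∑ σ : Composition n, TensorProduct.map (restrict σ) (contract k B σ)) ∘ₗ
      (freeComul k B).toLinearMap ∘ₗ TensorPower.toTensorAlgebra

/-- The renormalization coproduct `Δ` of `T(T(B)⁺)`: the algebra map with
`Δ a = ∑_{σ} a₍₁₎|σ ⊗ a₍₂₎/σ` for `a ∈ Tⁿ(B)`, `n ≥ 1`. -/
def renormComul : TT k B →ₐ[k] TT k B ⊗[k] TT k B :=
  TensorAlgebra.lift k (comulOnTensor k B ∘ₗ (TPlus k B).subtype)

/-- The linear form on `T(B)⁺` with `(x) ↦ ε_B(x)` and `(x₁, …, xₙ) ↦ 0` for `n > 1`. -/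
def counitOnPlus : TPlus k B →ₗ[k] k :=
  Coalgebra.counit ∘ₗ TensorAlgebra.ιInv ∘ₗ (TPlus k B).subtype

/-- The counit `ε` of `T(T(B)⁺)`. -/
def renormCounit : TT k B →ₐ[k] k :=
  TensorAlgebra.lift k (counitOnPlus k B)

/-- The two-sided ideal `J` of `T(T(B)⁺)` generated by the elements `(x) - ε_B(x) 1`, `x ∈ B`. -/
def pinterIdeal : Ideal (TT k B) :=
  (TwoSidedIdeal.span (Set.range fun x : B =>
    gen k B (TensorAlgebra.ι k x) - algebraMap k (TT k B) (Coalgebra.counit x))).asIdeal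

instance : (pinterIdeal k B).IsTwoSided :=
  inferInstanceAs (TwoSidedIdeal.asIdeal _).IsTwoSided

/-! ### The commutative algebra `S(S(B)⁺)` -/

/-- The canonical projection `T(T(B)⁺) → S(T(B)⁺)`. -/
def toST : TT k B →ₐ[k] ST k B :=
  TensorAlgebra.lift k (SymmetricAlgebra.ι k (TPlus k B))

/-- The coproduct of `S(T(B)⁺)` induced by the renormalization coproduct of `T(T(B)⁺)`. -/
def comulST : ST k B →ₐ[k] ST k B ⊗[k] ST k B :=
  SymmetricAlgebra.lift
    ((Algebra.TensorProduct.map (toST k B) (toST k B)).toLinearMap ∘ₗ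
      comulOnTensor k B ∘ₗ (TPlus k B).subtype)

/-- The counit of `S(T(B)⁺)` induced by the counit of `T(T(B)⁺)`. -/
def counitST : ST k B →ₐ[k] k :=
  SymmetricAlgebra.lift (counitOnPlus k B)

end Renormalization

section Symmetric

variable (k B : Type*) [Field k] [AddCommGroup B] [Module k B]

/-- The symmetrizing operator `α : T(B) → T(B)`,
`(x₁, …, xₙ) ↦ ∑_{σ ∈ Σₙ} (x_{σ(1)}, …, x_{σ(n)})`. -/
def symmetrize : TensorAlgebra k B →ₗ[k] TensorAlgebra k B :=
  liftComponents k B fun n =>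
    PiTensorProduct.lift (∑ σ : Equiv.Perm (Fin n), (TensorAlgebra.tprod k B n).domDomCongr σ)

/-- `S(B)⁺`, as the subspace `α(T(B)⁺)` of `T(B)⁺`. -/
def SPlus : Submodule k (TPlus k B) :=
  ((TPlus k B).map (symmetrize k B)).comap (TPlus k B).subtype

/-- `S(S(B)⁺)`, as the subalgebra of `S(T(B)⁺)` generated by `S(B)⁺`. -/
def SS : Subalgebra k (ST k B) :=
  Algebra.adjoin k (SymmetricAlgebra.ι k (TPlus k B) '' (SPlus k B : Set (TPlus k B)))

variable {B}

lemma ι_mem_TPlus (x : B) : TensorAlgebra.ι k x ∈ TPlus k B := by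
  simp [TPlus, TensorAlgebra.algebraMapInv]

lemma symmetrize_ι (x : B) : symmetrize k B (TensorAlgebra.ι k x) = TensorAlgebra.ι k x := by
  have h : TensorAlgebra.ι k x = TensorAlgebra.tprod k B 1 (fun _ => x) := by
    simp [TensorAlgebra.tprod_apply]
  rw [h, symmetrize, liftComponents_tprod, PiTensorProduct.lift.tprod, sum_apply]
  simp [MultilinearMap.domDomCongr_apply]

/-- The element `{x} = (x)` of `S(S(B)⁺)`, for `x ∈ B`. -/
def single (x : B) : SS k B :=
  ⟨SymmetricAlgebra.ι k (TPlus k B) ⟨TensorAlgebra.ι k x, ι_mem_TPlus k x⟩,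
    Algebra.subset_adjoin ⟨_, ⟨_, ι_mem_TPlus k x, symmetrize_ι k x⟩, rfl⟩⟩

end Symmetric

/-- The ideal `J'` of `S(S(B)⁺)` generated by the elements `{x} - ε_B(x) 1`, `x ∈ B`. -/
def commPinterIdeal (k B : Type*) [Field k] [AddCommGroup B] [Module k B] [Coalgebra k B] :
    Ideal (SS k B) :=
  Ideal.span (Set.range fun x : B =>
    single k x - algebraMap k (SS k B) (Coalgebra.counit x))

/-! ### The degree -/

section Degree

variable {k B : Type*} [Field k] [AddCommGroup B] [Module k B] (𝒜 : ℕ → Submodule k B)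

/-- The elements of degree `d` of `T(B)⁺`, where
`deg (x₁, …, xₙ) = |x₁| + ⋯ + |xₙ| + n - 1` for homogeneous `xᵢ ∈ B`. -/
def degTPlus (d : ℕ) : Submodule k (TPlus k B) :=
  Submodule.span k {a | ∃ (n : ℕ) (x : Fin (n + 1) → B) (e : Fin (n + 1) → ℕ),
    (∀ i, x i ∈ 𝒜 (e i)) ∧ (∑ i, e i) + n = d ∧
      (a : TensorAlgebra k B) = TensorAlgebra.tprod k B (n + 1) x}

/-- For an algebra `A` generated by the image of `j : T(B)⁺ → A`, the elements of degree `d`,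
where `deg (a₁ ⋯ aₘ) = deg a₁ + ⋯ + deg aₘ` for homogeneous `aᵢ ∈ T(B)⁺`. -/
def degAlg {A : Type*} [Ring A] [Algebra k A] (j : TPlus k B →ₗ[k] A) (d : ℕ) : Submodule k A :=
  Submodule.span k {u | ∃ (m : ℕ) (a : Fin m → TPlus k B) (e : Fin m → ℕ),
    (∀ i, a i ∈ degTPlus 𝒜 (e i)) ∧ ∑ i, e i = d ∧ u = (List.ofFn fun i => j (a i)).prod}

/-- The elements of degree `d` of `T(T(B)⁺)`. -/
def degTT : ℕ → Submodule k (TT k B) := degAlg 𝒜 (TensorAlgebra.ι k)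

/-- The elements of degree `d` of `S(S(B)⁺)`. -/
def degSS (d : ℕ) : Submodule k (SS k B) :=
  (degAlg 𝒜 (SymmetricAlgebra.ι k (TPlus k B)) d).comap (SS k B).val.toLinearMap

/-- The grading of a quotient algebra `A ⧸ I` induced by a grading of `A`. -/
def degQuotient {A : Type*} [Ring A] [Algebra k A] (𝒢 : ℕ → Submodule k A) (I : Ideal A)
    [I.IsTwoSided] (d : ℕ) : Submodule k (A ⧸ I) :=
  (𝒢 d).map (Ideal.Quotient.mkₐ k I).toLinearMap

end Degree

end

end Pinter

namespace Pinter

noncomputable section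

/-! ### Gradings by eigenspaces -/

section Eigen

variable {k M : Type*} [Field k] [CharZero k] [AddCommGroup M] [Module k M]

/-! As a vector space T(T(B)⁺) is generated from 1 by two families of operators: F₀ = `consBlock`
opens a new block (b) on the left, and F₁ = `consLetter` puts a letter b at the front of the first
block. A third family F₂ = `mulLetter` multiplies the first letter of the first block by b. In a
composition the first letter either forms a block of its own or shares the block of the second
letter; hence, with F ⊗ G evaluated at δ(b) and applied to Δ(u), Δ(F₀ b u) = F₀ ⊗ F₀, Δ(F₁ b u) = F₀
⊗ F₁ + F₁ ⊗ F₂, Δ(F₂ b u) = F₂ ⊗ F₂, the last because δ is multiplicative. Both iterated coproducts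
of F₁ are then F₀ ⊗ F₀ ⊗ F₁ + F₀ ⊗ F₁ ⊗ F₂ + F₁ ⊗ F₂ ⊗ F₂, so coassociativity follows from that of B
by induction (`coassoc_of_insert`, `renormComul_coassoc`), and the counit axioms follow from the
same recursion.

In characteristic zero the scalars 2^d are distinct, so a grading is encoded by the operator acting
as 2^d in degree d. All graded statements reduce to the fact that this rescaling is a bialgebra
endomorphism, which is again checked on the recursion (`renormComul_scaleTT`). In the quotient the
letters become scalars, and words of degree 0 have one letter, so the quotient is connected. A
connected graded bialgebra has an antipode given by a geometric series
(`IsConnectedGradedBialgebra.isHopf`); the trivial grading of B suffices for this.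

In the commutative case the essential point is that Δ preserves S(S(B)⁺) (`comulST_pow_mem`). By
polarization it is enough to treat powers (x, …, x). Their coproduct is a sum, over tuples of block
lengths, of products of blocks. Commutativity of B makes every block symmetric, commutativity of
S(T(B)⁺) makes the sum over tuples symmetric, and factorials are invertible. The bialgebra axioms
then pass down to S(T(B)⁺) by surjectivity and on to S(S(B)⁺) by injectivity. -/

lemma iSupIndep_eigenspace_two_pow (f : Module.End k M) :
    iSupIndep fun d : ℕ => f.eigenspace ((2 : k) ^ d) := by
  refine f.eigenspaces_iSupIndep.comp (f := fun d : ℕ => (2 : k) ^ d) fun a b h => ?_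
  have h' : ((2 ^ a : ℕ) : k) = ((2 ^ b : ℕ) : k) := by push_cast; exact h
  exact Nat.pow_right_injective le_rfl (Nat.cast_injective h')

lemma isInternal_of_le_eigenspace (f : Module.End k M) {𝒢 : ℕ → Submodule k M}
    (h𝒢 : ∀ d, 𝒢 d ≤ f.eigenspace (2 ^ d)) (htop : ⨆ d, 𝒢 d = ⊤) :
    DirectSum.IsInternal 𝒢 :=
  DirectSum.isInternal_submodule_of_iSupIndep_of_iSup_eq_top
    ((iSupIndep_eigenspace_two_pow f).mono h𝒢) htop

/-- By the modular law, an eigenvector for 2^d has a component in `𝒢 d` and a remainder in the other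
pieces; independence of the eigenspaces kills the remainder. Membership in `𝒢 d` thereby becomes a
single equation. -/
lemma eq_eigenspace_of_le_eigenspace (f : Module.End k M) {𝒢 : ℕ → Submodule k M}
    (h𝒢 : ∀ d, 𝒢 d ≤ f.eigenspace (2 ^ d)) (htop : ⨆ d, 𝒢 d = ⊤) (d : ℕ) :
    𝒢 d = f.eigenspace (2 ^ d) := by
  refine le_antisymm (h𝒢 d) ?_
  have h1 : 𝒢 d ⊔ ⨆ (j) (_ : j ≠ d), 𝒢 j = ⊤ := by
    rw [eq_top_iff, ← htop]
    refine iSup_le fun j => ?_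
    by_cases h : j = d
    · subst h; exact le_sup_left
    · exact le_sup_of_le_right (le_iSup₂_of_le j h le_rfl)
  have h2 : f.eigenspace (2 ^ d) ⊓ ⨆ (j) (_ : j ≠ d), 𝒢 j = ⊥ :=
    ((iSupIndep_eigenspace_two_pow f d).mono_right
      (iSup₂_mono fun j _ => h𝒢 j)).eq_bot
  calc f.eigenspace (2 ^ d) = (𝒢 d ⊔ ⨆ (j) (_ : j ≠ d), 𝒢 j) ⊓ f.eigenspace (2 ^ d) := by
        rw [h1, top_inf_eq]
    _ = 𝒢 d ⊔ (⨆ (j) (_ : j ≠ d), 𝒢 j) ⊓ f.eigenspace (2 ^ d) := sup_inf_assoc_of_le _ (h𝒢 d)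
    _ ≤ 𝒢 d := by rw [inf_comm, h2, sup_bot_eq]

end Eigen

/-- Together with `iSup_range_map_subtype_eq_top` this identifies the graded pieces of M ⊗ M with
eigenspaces of f ⊗ f in characteristic zero, so homogeneity of a coproduct can be tested by
rescaling. -/
lemma range_map_subtype_le_eigenspace {k M : Type*} [Field k] [AddCommGroup M] [Module k M]
    (f : Module.End k M) {𝒢 : ℕ → Submodule k M} (h𝒢 : ∀ d, 𝒢 d ≤ f.eigenspace (2 ^ d))
    (n : ℕ) :
    ⨆ (p : ℕ × ℕ) (_ : p.1 + p.2 = n),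
      LinearMap.range (TensorProduct.map (𝒢 p.1).subtype (𝒢 p.2).subtype) ≤
    Module.End.eigenspace (TensorProduct.map f f) (2 ^ n) := by
  refine iSup₂_le ?_
  rintro p hp _ ⟨z, rfl⟩
  induction z with
  | zero => simp
  | add a b ha hb => rw [map_add]; exact add_mem ha hb
  | tmul a b =>
    have ha := Module.End.mem_eigenspace_iff.1 (h𝒢 _ a.2)
    have hb := Module.End.mem_eigenspace_iff.1 (h𝒢 _ b.2)
    rw [Module.End.mem_eigenspace_iff]
    simp [ha, hb, TensorProduct.smul_tmul', TensorProduct.tmul_smul, smul_smul, ← pow_add, ← hp,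
      add_comm]

lemma iSup_range_map_subtype_eq_top {k M : Type*} [Field k] [AddCommGroup M] [Module k M]
    {𝒢 : ℕ → Submodule k M} (htop : ⨆ d, 𝒢 d = ⊤) :
    ⨆ n, ⨆ (p : ℕ × ℕ) (_ : p.1 + p.2 = n),
      LinearMap.range (TensorProduct.map (𝒢 p.1).subtype (𝒢 p.2).subtype) = ⊤ := by
  rw [eq_top_iff, ← TensorProduct.span_tmul_eq_top, Submodule.span_le]
  rintro _ ⟨a, b, rfl⟩
  have ha : a ∈ ⨆ d, 𝒢 d := htop ▸ Submodule.mem_top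
  have hb : b ∈ ⨆ d, 𝒢 d := htop ▸ Submodule.mem_top
  rw [SetLike.mem_coe]
  induction ha using Submodule.iSup_induction' with
  | zero => simp
  | add x y _ _ hx hy => rw [TensorProduct.add_tmul]; exact add_mem hx hy
  | mem i x hx =>
    induction hb using Submodule.iSup_induction' with
    | zero => simp
    | add y z _ _ hy hz => rw [TensorProduct.tmul_add]; exact add_mem hy hz
    | mem j y hy =>
      exact Submodule.mem_iSup_of_mem (i + j) (Submodule.mem_iSup_of_mem (i, j)
        (Submodule.mem_iSup_of_mem rfl ⟨(⟨x, hx⟩ : 𝒢 i) ⊗ₜ (⟨y, hy⟩ : 𝒢 j), rfl⟩))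

/-- Each graded axiom is an eigenvalue computation for φ: eigenvalues multiply under products, the
coproduct intertwines φ with φ ⊗ φ, and the counit of x in degree n ≠ 0 satisfies 2^n ε(x) = ε(x)
with 2^n ≠ 1. -/
lemma isConnectedGradedBialgebra_of_le_eigenspace {k A : Type*} [Field k] [CharZero k] [Ring A]
    [Bialgebra k A] (φ : A →ₐ[k] A)
    (hcounit : ∀ a, (Coalgebra.counit (φ a) : k) = Coalgebra.counit a)
    (hcomul : ∀ a, (Coalgebra.comul (φ a) : A ⊗[k] A) =
      TensorProduct.map φ.toLinearMap φ.toLinearMap (Coalgebra.comul a))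
    {𝒢 : ℕ → Submodule k A} (h𝒢 : ∀ d, 𝒢 d ≤ Module.End.eigenspace φ.toLinearMap (2 ^ d))
    (htop : ⨆ d, 𝒢 d = ⊤) (h0 : 𝒢 0 ≤ Submodule.span k {(1 : A)}) :
    IsConnectedGradedBialgebra 𝒢 := by
  have hmem : ∀ d x, x ∈ 𝒢 d ↔ φ x = (2 : k) ^ d • x := fun d x => by
    rw [eq_eigenspace_of_le_eigenspace φ.toLinearMap h𝒢 htop d, Module.End.mem_eigenspace_iff]
    rfl
  have hone : (1 : A) ∈ 𝒢 0 := by simp [hmem]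
  refine ⟨⟨isInternal_of_le_eigenspace φ.toLinearMap h𝒢 htop, fun n x hx => ?_,
    fun n hn x hx => ?_⟩, hone, fun i j x hx y hy => ?_, le_antisymm h0 ?_⟩
  · rw [eq_eigenspace_of_le_eigenspace _ (range_map_subtype_le_eigenspace φ.toLinearMap h𝒢)
      (iSup_range_map_subtype_eq_top htop) n, Module.End.mem_eigenspace_iff, ← hcomul,
      (hmem n x).1 hx, map_smul]
  · have h := hcounit x
    rw [(hmem n x).1 hx, map_smul, smul_eq_mul] at h
    have h' : ((2 : k) ^ n - 1) * Coalgebra.counit x = 0 := by rw [sub_mul, h, one_mul, sub_self]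
    refine (mul_eq_zero.1 h').resolve_left (sub_ne_zero.2 ?_)
    have : (2 : ℕ) ^ n ≠ 1 := by simpa using hn
    exact_mod_cast this
  · rw [hmem] at *
    rw [map_mul, hx, hy, smul_mul_smul_comm, pow_add]
  · rw [Submodule.span_le]; simpa using hone

/-! ### Connected graded bialgebras are Hopf algebras -/

lemma isHopf_of_convolution_inverse {k A : Type*} [Field k] [Ring A] [b : Bialgebra k A]
    (S : A →ₗ[k] A)
    (h1 : WithConv.toConv S * WithConv.toConv (LinearMap.id : A →ₗ[k] A) = 1)
    (h2 : WithConv.toConv (LinearMap.id : A →ₗ[k] A) * WithConv.toConv S = 1) :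
    IsHopf k A := by
  refine ⟨{ b with
    antipode := S
    mul_antipode_rTensor_comul := ?_
    mul_antipode_lTensor_comul := ?_ }, rfl⟩
  · exact congrArg WithConv.ofConv h1
  · exact congrArg WithConv.ofConv h2

/-- The antipode is the convolution inverse of id = 1 - ρ, that is, the series ∑ ρ^m. Since ρ
vanishes in degree 0, ρ^m vanishes in degrees below m and the series is finite on every homogeneous
element. -/
lemma IsConnectedGradedBialgebra.isHopf {k A : Type*} [Field k] [Ring A] [Bialgebra k A]
    {𝒢 : ℕ → Submodule k A} (h : IsConnectedGradedBialgebra 𝒢) : IsHopf k A := by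
  classical
  -- `ρ = η ε - id` is locally nilpotent for the convolution product
  set ρ : WithConv (A →ₗ[k] A) := 1 - WithConv.toConv LinearMap.id with hρ
  have hρ0 : ∀ x ∈ 𝒢 0, ρ x = 0 := by
    intro x hx
    rw [h.connected, Submodule.mem_span_singleton] at hx
    obtain ⟨c, rfl⟩ := hx
    simp [hρ, Algebra.smul_def]
  -- A convolution product evaluated in degree n involves only factors of degrees p + q = n, so each
  -- factor may be altered outside those degrees.
  have hconv : ∀ (f f' g g' : WithConv (A →ₗ[k] A)) (n : ℕ) (x : A), x ∈ 𝒢 n →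
      (∀ p q : ℕ, p + q = n → ∀ a ∈ 𝒢 p, ∀ b ∈ 𝒢 q, f a * g b = f' a * g' b) →
      (f * g) x = (f' * g') x := by
    intro f f' g g' n x hx H
    simp only [LinearMap.convMul_apply]
    have hx' := h.comul_mem n x hx
    generalize (Coalgebra.comul x : A ⊗[k] A) = t at hx'
    induction hx' using Submodule.iSup_induction' with
    | zero => simp
    | add y z _ _ hy hz => rw [map_add, map_add, map_add, map_add, hy, hz]
    | mem p y hy =>
      induction hy using Submodule.iSup_induction' with
      | zero => simp
      | add y z _ _ hy hz => rw [map_add, map_add, map_add, map_add, hy, hz]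
      | mem hp y hy =>
        obtain ⟨z, rfl⟩ := hy
        induction z with
        | zero => simp
        | add y z hy hz => rw [map_add, map_add, map_add, map_add, map_add, hy, hz]
        | tmul a b => simpa using H _ _ hp _ a.2 _ b.2
  have hnil : ∀ m n : ℕ, n < m → ∀ x ∈ 𝒢 n, (ρ ^ m) x = 0 := by
    intro m
    induction m with
    | zero => intro n hn; omega
    | succ m ih =>
      intro n hn x hx
      rw [pow_succ']
      rw [hconv ρ 0 (ρ ^ m) 0 n x hx]
      · simp
      · intro p q hpq a ha b hb
        rcases Nat.eq_zero_or_pos p with rfl | hp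
        · rw [hρ0 a ha]; simp
        · rw [ih q (by omega) b hb]; simp
  -- Partial sums of the geometric series; on degree n all those with N ≥ n agree, and their common
  -- value defines S.
  let T : ℕ → WithConv (A →ₗ[k] A) := fun N => ∑ m ∈ Finset.range (N + 1), ρ ^ m
  have hT : ∀ N n, n ≤ N → ∀ x ∈ 𝒢 n, T N x = T n x := by
    intro N n hn x hx
    induction N, hn using Nat.le_induction with
    | base => rfl
    | succ N hN ih =>
      have : T (N + 1) = T N + ρ ^ (N + 1) := Finset.sum_range_succ _ _
      rw [this]
      change T N x + (ρ ^ (N + 1)) x = _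
      rw [hnil (N + 1) n (by omega) x hx, ih, add_zero]
  let e := LinearEquiv.ofBijective (DirectSum.coeLinearMap 𝒢) h.isInternal
  let S : A →ₗ[k] A :=
    DirectSum.toModule k ℕ A (fun n => (T n).ofConv ∘ₗ (𝒢 n).subtype) ∘ₗ e.symm.toLinearMap
  have hS : ∀ n, ∀ x ∈ 𝒢 n, S x = T n x := by
    intro n x hx
    have : e.symm x = DirectSum.lof k ℕ (fun n => 𝒢 n) n ⟨x, hx⟩ := by
      rw [LinearEquiv.symm_apply_eq]
      exact (DirectSum.coeLinearMap_lof 𝒢 n ⟨x, hx⟩).symm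
    simp only [S, LinearMap.comp_apply, LinearEquiv.coe_coe, this, DirectSum.toModule_lof]
    rfl
  have hid : WithConv.toConv (LinearMap.id : A →ₗ[k] A) = 1 - ρ := by simp [hρ]
  have hpow : ∀ n, ∀ x ∈ 𝒢 n, (1 - ρ ^ (n + 1)) x = (1 : WithConv (A →ₗ[k] A)) x := by
    intro n x hx
    change (1 : WithConv (A →ₗ[k] A)) x - (ρ ^ (n + 1)) x = _
    rw [hnil _ _ n.lt_succ_self x hx, sub_zero]
  have hall : ∀ f g : WithConv (A →ₗ[k] A), (∀ n, ∀ x ∈ 𝒢 n, f x = g x) → f = g := by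
    intro f g H
    apply WithConv.ofConv_injective
    ext x
    have hx : x ∈ ⨆ n, 𝒢 n := by
      rw [h.isInternal.submodule_iSup_eq_top]; trivial
    induction hx using Submodule.iSup_induction' with
    | zero => simp
    | add y z _ _ hy hz => rw [map_add, map_add, hy, hz]
    | mem n y hy => exact H n y hy
  refine isHopf_of_convolution_inverse S (hall _ _ fun n x hx => ?_) (hall _ _ fun n x hx => ?_)
  -- In degree n the convolution unit equals 1 - ρ^(n+1), which is T n times 1 - ρ. On a factor of
  -- degree p ≤ n, S is T p and hence also T n.
  · rw [← hpow n x hx, ← geom_sum_mul_neg ρ (n + 1), ← hid]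
    refine hconv _ _ _ _ n x hx fun p q hpq a ha b _ => ?_
    congr 1
    exact (hS p a ha).trans (hT n p (by omega) a ha).symm
  · rw [← hpow n x hx, ← mul_neg_geom_sum ρ (n + 1), ← hid]
    refine hconv _ _ _ _ n x hx fun p q hpq a _ b hb => ?_
    congr 1
    exact (hS q b hb).trans (hT n q (by omega) b hb).symm

/-! ### Operators on the first letter of a word -/

section HeadMap

variable {k V : Type*} [Field k] [AddCommGroup V] [Module k V]

lemma tensorAlgebra_induction_left {P : TensorAlgebra k V → Prop}
    (one : P 1) (add : ∀ a b, P a → P b → P (a + b)) (smul : ∀ (c : k) a, P a → P (c • a))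
    (ι_mul : ∀ v a, P a → P (TensorAlgebra.ι k v * a)) (a : TensorAlgebra k V) : P a := by
  suffices h : ∀ a b : TensorAlgebra k V, P b → P (a * b) by simpa using h a 1 one
  intro a
  induction a using TensorAlgebra.induction with
  | algebraMap r => intro b hb; rw [← Algebra.smul_def]; exact smul r b hb
  | ι v => exact ι_mul v
  | mul a b ha hb => intro c hc; rw [mul_assoc]; exact ha _ (hb _ hc)
  | add a b ha hb => intro c hc; rw [add_mul]; exact add _ _ (ha _ hc) (hb _ hc)

lemma tensorAlgebra_linearMap_ext {M : Type*} [AddCommGroup M] [Module k M]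
    {f g : TensorAlgebra k V →ₗ[k] M} (one : f 1 = g 1)
    (ι_mul : ∀ v a, f a = g a → f (TensorAlgebra.ι k v * a) = g (TensorAlgebra.ι k v * a)) :
    f = g := by
  ext a
  induction a using tensorAlgebra_induction_left with
  | one => exact one
  | add a b ha hb => rw [map_add, map_add, ha, hb]
  | smul c a ha => rw [map_smul, map_smul, ha]
  | ι_mul v a ha => exact ι_mul v a ha

/-- The algebra map from `T(V)` to upper triangular matrices with diagonal `(ε, id)` and upper
right entry `v₁ v₂ ⋯ vₙ ↦ f(v₁) v₂ ⋯ vₙ`. -/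
def headMatrix (f : V →ₗ[k] TensorAlgebra k V) :
    TensorAlgebra k V →ₐ[k] Matrix (Fin 2) (Fin 2) (TensorAlgebra k V) :=
  TensorAlgebra.lift k
    { toFun := fun v => !![0, f v; 0, TensorAlgebra.ι k v]
      map_add' := fun v w => by ext i j; fin_cases i <;> fin_cases j <;> simp
      map_smul' := fun c v => by ext i j; fin_cases i <;> fin_cases j <;> simp }

lemma headMatrix_ι (f : V →ₗ[k] TensorAlgebra k V) (v : V) :
    headMatrix f (TensorAlgebra.ι k v) = !![0, f v; 0, TensorAlgebra.ι k v] := by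
  simp [headMatrix]

lemma headMatrix_one_one (f : V →ₗ[k] TensorAlgebra k V) (u : TensorAlgebra k V) :
    headMatrix f u 1 1 = u := by
  induction u using tensorAlgebra_induction_left with
  | one => simp
  | add a b ha hb => rw [map_add, Matrix.add_apply, ha, hb]
  | smul c a ha => rw [map_smul, Matrix.smul_apply, ha]
  | ι_mul v a ha => simp [headMatrix_ι, Matrix.mul_apply, ha]

/-- The linear map `v₁ v₂ ⋯ vₙ ↦ f(v₁) v₂ ⋯ vₙ` of `T(V)`, with `1 ↦ 0`. -/
def headMapAux (f : V →ₗ[k] TensorAlgebra k V) : Module.End k (TensorAlgebra k V) where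
  toFun u := headMatrix f u 0 1
  map_add' u v := by rw [map_add]; rfl
  map_smul' c u := by rw [map_smul]; rfl

lemma headMapAux_one (f : V →ₗ[k] TensorAlgebra k V) : headMapAux f 1 = 0 := by
  simp [headMapAux]

/-- The matrix of v has top row (0, f v), so the upper right entry of its product with the matrix of
u is f v times the lower right entry, which is u itself. A map that is not multiplicative is thus
read off an algebra map. -/
lemma headMapAux_ι_mul (f : V →ₗ[k] TensorAlgebra k V) (v : V) (u : TensorAlgebra k V) :
    headMapAux f (TensorAlgebra.ι k v * u) = f v * u := by
  simp [headMapAux, headMatrix_ι, Matrix.mul_apply, headMatrix_one_one]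

/-- The linear map `v₁ v₂ ⋯ vₙ ↦ f(v₁) v₂ ⋯ vₙ` of `T(V)`, with `1 ↦ 0`, as a linear function
of `f`. -/
def headMap : (V →ₗ[k] TensorAlgebra k V) →ₗ[k] Module.End k (TensorAlgebra k V) where
  toFun := headMapAux
  map_add' f g := tensorAlgebra_linearMap_ext (by simp [headMapAux_one])
    fun v a _ => by simp [headMapAux_ι_mul, add_mul]
  map_smul' c f := tensorAlgebra_linearMap_ext (by simp [headMapAux_one])
    fun v a _ => by simp [headMapAux_ι_mul]

@[simp] lemma headMap_one (f : V →ₗ[k] TensorAlgebra k V) : headMap f 1 = 0 := headMapAux_one f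

@[simp] lemma headMap_ι_mul (f : V →ₗ[k] TensorAlgebra k V) (v : V) (u : TensorAlgebra k V) :
    headMap f (TensorAlgebra.ι k v * u) = f v * u := headMapAux_ι_mul f v u

@[simp] lemma headMap_ι (f : V →ₗ[k] TensorAlgebra k V) (v : V) :
    headMap f (TensorAlgebra.ι k v) = f v := by
  simpa using headMap_ι_mul f v 1

end HeadMap

/-! ### The generators of `T(T(B)⁺)` -/

section Gen

variable {k B : Type*} [Field k] [AddCommGroup B] [Module k B]

lemma mem_TPlus_iff {a : TensorAlgebra k B} :
    a ∈ TPlus k B ↔ TensorAlgebra.algebraMapInv (R := k) (M := B) a = 0 := Iff.rfl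

@[simp] lemma algebraMapInv_ι (x : B) :
    TensorAlgebra.algebraMapInv (R := k) (TensorAlgebra.ι k x) = 0 := ι_mem_TPlus k x

lemma ι_mul_mem_TPlus (x : B) (a : TensorAlgebra k B) : TensorAlgebra.ι k x * a ∈ TPlus k B := by
  rw [mem_TPlus_iff, map_mul, algebraMapInv_ι, zero_mul]

lemma projPlus_coe (a : TPlus k B) : projPlus k B a = a := by
  ext
  have := mem_TPlus_iff.1 a.2
  simp [projPlus, this]

lemma projPlus_of_mem {a : TensorAlgebra k B} (ha : a ∈ TPlus k B) :
    projPlus k B a = ⟨a, ha⟩ := projPlus_coe ⟨a, ha⟩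

lemma gen_coe (a : TPlus k B) : gen k B a = TensorAlgebra.ι k a := by
  simp [gen, projPlus_coe]

lemma gen_of_mem {a : TensorAlgebra k B} (ha : a ∈ TPlus k B) :
    gen k B a = TensorAlgebra.ι k ⟨a, ha⟩ := gen_coe ⟨a, ha⟩

@[simp] lemma projPlus_one : projPlus k B 1 = 0 := by
  ext; simp [projPlus]

@[simp] lemma gen_one : gen k B 1 = 0 := by simp [gen]

lemma TPlus_induction {P : TensorAlgebra k B → Prop}
    (ι : ∀ x, P (TensorAlgebra.ι k x)) (add : ∀ a b, P a → P b → P (a + b))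
    (smul : ∀ (c : k) a, P a → P (c • a))
    (ι_mul : ∀ x, ∀ a ∈ TPlus k B, P a → P (TensorAlgebra.ι k x * a))
    {a : TensorAlgebra k B} (ha : a ∈ TPlus k B) : P a := by
  have key : ∀ a : TensorAlgebra k B, P (projPlus k B a) := by
    intro a
    have h0 : P 0 := by simpa using ι 0
    induction a using tensorAlgebra_induction_left with
    | one => simpa using h0
    | add a b ha hb => rw [map_add]; exact add _ _ ha hb
    | smul c a ha => rw [map_smul]; exact smul _ _ ha
    | ι_mul x a ha =>
      rw [projPlus_of_mem (ι_mul_mem_TPlus x a)]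
      -- The empty-word part of the tail contributes only a multiple of the letter x, so the
      -- remaining tail lies in T(B)⁺ and the empty word is never reached.
      have e : TensorAlgebra.ι k x * a = TensorAlgebra.ι k x * projPlus k B a +
          TensorAlgebra.algebraMapInv (R := k) a • TensorAlgebra.ι k x := by
        rw [Algebra.smul_def, Algebra.commutes, ← mul_add]
        simp [projPlus]
      rw [Submodule.coe_mk, e]
      exact add _ _ (ι_mul _ _ (projPlus k B a).2 ha) (smul _ _ (ι x))
  simpa [projPlus_of_mem ha] using key a

/-- Multiplication on the left by a generator `(b)`. -/
def consBlock : B →ₗ[k] Module.End k (TT k B) :=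
  LinearMap.mul k (TT k B) ∘ₗ gen k B ∘ₗ TensorAlgebra.ι k

/-- Insertion of a letter `b` at the beginning of the first block of a product of generators. -/
def consLetter : B →ₗ[k] Module.End k (TT k B) :=
  headMap ∘ₗ (LinearMap.lcomp k (TT k B) (TPlus k B).subtype) ∘ₗ
    (LinearMap.llcomp k _ _ _ (gen k B)) ∘ₗ LinearMap.mul k (TensorAlgebra k B) ∘ₗ
      TensorAlgebra.ι k

lemma consBlock_apply (b : B) (u : TT k B) :
    consBlock b u = gen k B (TensorAlgebra.ι k b) * u := rfl

@[simp] lemma consLetter_one (b : B) : consLetter b (1 : TT k B) = 0 := headMap_one _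

lemma consLetter_gen_mul (b : B) {a : TensorAlgebra k B} (ha : a ∈ TPlus k B) (u : TT k B) :
    consLetter b (gen k B a * u) = gen k B (TensorAlgebra.ι k b * a) * u := by
  rw [gen_of_mem ha]
  exact headMap_ι_mul _ _ _

lemma consLetter_gen (b : B) {a : TensorAlgebra k B} (ha : a ∈ TPlus k B) :
    consLetter b (gen k B a) = gen k B (TensorAlgebra.ι k b * a) := by
  simpa using consLetter_gen_mul b ha 1

/-- Every product of words arises from 1 by opening blocks and lengthening the first one. The
identities for Δ and ε below are proved by this induction. -/
lemma TT_induction {P : TT k B → Prop} (one : P 1) (add : ∀ u v, P u → P v → P (u + v))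
    (smul : ∀ (c : k) u, P u → P (c • u)) (consBlock : ∀ b u, P u → P (consBlock b u))
    (consLetter : ∀ b u, P u → P (consLetter b u)) (u : TT k B) : P u := by
  induction u using tensorAlgebra_induction_left with
  | one => exact one
  | add a b ha hb => exact add _ _ ha hb
  | smul c a ha => exact smul _ _ ha
  | ι_mul v u hu =>
    obtain ⟨a, ha⟩ := v
    rw [← gen_of_mem ha]
    refine TPlus_induction (P := fun a => P (gen k B a * u)) (fun x => consBlock x u hu)
      (fun a b ha hb => ?_) (fun c a ha => ?_) (fun x a ha h => ?_) ha
    · rw [map_add, add_mul]; exact add _ _ ha hb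
    · rw [map_smul, smul_mul_assoc]; exact smul _ _ ha
    · rw [← consLetter_gen_mul x ha]; exact consLetter x _ h

lemma TT_linearMap_ext {M : Type*} [AddCommGroup M] [Module k M] {f g : TT k B →ₗ[k] M}
    (one : f 1 = g 1) (hblock : ∀ b u, f u = g u → f (consBlock b u) = g (consBlock b u))
    (hletter : ∀ b u, f u = g u → f (consLetter b u) = g (consLetter b u)) : f = g := by
  ext u
  induction u using TT_induction with
  | one => exact one
  | add a b ha hb => rw [map_add, map_add, ha, hb]
  | smul c a ha => rw [map_smul, map_smul, ha]
  | consBlock b u hu => exact hblock b u hu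
  | consLetter b u hu => exact hletter b u hu

end Gen

/-! ### Multiplication into the first letter. -/

section MulHead

variable {k B : Type*} [Field k] [NonUnitalRing B] [Module k B]
  [IsScalarTower k B B] [SMulCommClass k B B]

/-- Multiplication of the first letter of a word by `b`. -/
def mulHead : B →ₗ[k] Module.End k (TensorAlgebra k B) :=
  headMap ∘ₗ (LinearMap.llcomp k _ _ _ (TensorAlgebra.ι k)) ∘ₗ LinearMap.mul k B

@[simp] lemma mulHead_one (b : B) : mulHead b (1 : TensorAlgebra k B) = 0 := headMap_one _

@[simp] lemma mulHead_ι_mul (b c : B) (a : TensorAlgebra k B) :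
    mulHead b (TensorAlgebra.ι k c * a) = TensorAlgebra.ι k (b * c) * a := headMap_ι_mul _ _ _

@[simp] lemma mulHead_ι (b c : B) :
    mulHead b (TensorAlgebra.ι k c) = TensorAlgebra.ι k (b * c) := headMap_ι _ _

lemma mulHead_mem_TPlus (b : B) (a : TensorAlgebra k B) : mulHead b a ∈ TPlus k B := by
  induction a using tensorAlgebra_induction_left with
  | one => simp
  | add a b ha hb => rw [map_add]; exact add_mem ha hb
  | smul c a ha => rw [map_smul]; exact Submodule.smul_mem _ _ ha
  | ι_mul c a ha => rw [mulHead_ι_mul]; exact ι_mul_mem_TPlus _ _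

/-- Multiplication by `b` of the first letter of the first block of a product of generators. -/
def mulLetter : B →ₗ[k] Module.End k (TT k B) :=
  headMap ∘ₗ (LinearMap.lcomp k (TT k B) (TPlus k B).subtype) ∘ₗ
    (LinearMap.llcomp k _ _ _ (gen k B)) ∘ₗ mulHead

@[simp] lemma mulLetter_one (b : B) : mulLetter b (1 : TT k B) = 0 := headMap_one _

lemma mulLetter_gen_mul (b : B) (a : TensorAlgebra k B) (u : TT k B) :
    mulLetter b (gen k B a * u) = gen k B (mulHead b a) * u := by
  have h : ∀ a ∈ TPlus k B, mulLetter b (gen k B a * u) = gen k B (mulHead b a) * u := by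
    intro a ha
    rw [gen_of_mem ha]
    exact headMap_ι_mul _ _ _
  induction a using tensorAlgebra_induction_left with
  | one => simp
  | add a b ha hb => simp only [map_add, add_mul, ha, hb]
  | smul c a ha => simp only [map_smul, smul_mul_assoc, ha]
  | ι_mul c a ha => exact h _ (ι_mul_mem_TPlus _ _)

lemma mulLetter_gen (b : B) (a : TensorAlgebra k B) :
    mulLetter b (gen k B a) = gen k B (mulHead b a) := by
  simpa using mulLetter_gen_mul b a 1

lemma mulLetter_consBlock (b c : B) (u : TT k B) :
    mulLetter b (consBlock c u) = consBlock (b * c) u := by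
  rw [consBlock_apply, mulLetter_gen_mul, mulHead_ι, consBlock_apply]

lemma mulLetter_consLetter (b c : B) (u : TT k B) :
    mulLetter b (consLetter c u) = consLetter (b * c) u := by
  induction u using tensorAlgebra_induction_left with
  | one => simp
  | add a b ha hb => simp only [map_add, ha, hb]
  | smul c a ha => simp only [map_smul, ha]
  | ι_mul v u hu =>
    rw [← gen_coe, consLetter_gen_mul _ v.2, consLetter_gen_mul _ v.2, mulLetter_gen_mul,
      mulHead_ι_mul]

lemma mulLetter_mulLetter (b c : B) (u : TT k B) :
    mulLetter b (mulLetter c u) = mulLetter (b * c) u := by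
  suffices h : mulLetter b ∘ₗ mulLetter c = (mulLetter (b * c) : Module.End k (TT k B)) from
    LinearMap.congr_fun h u
  refine TT_linearMap_ext (by simp) (fun d u _ => ?_) (fun d u _ => ?_)
  · simp [mulLetter_consBlock, mul_assoc]
  · simp [mulLetter_consLetter, mul_assoc]

/-! ### The operators and the contraction map -/

/-- The scalar part of a product in the unitization is the coefficient of the empty word. It
vanishes on T(B)⁺, whence μ(x a) = x μ(a) there. -/
lemma fst_lift_inr (a : TensorAlgebra k B) :
    (TensorAlgebra.lift k (Unitization.inrHom k k B) a).fst = TensorAlgebra.algebraMapInv a := by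
  suffices h : (Unitization.fstHom k B).comp (TensorAlgebra.lift k (Unitization.inrHom k k B)) =
      TensorAlgebra.algebraMapInv from DFunLike.congr_fun h a
  ext x
  simp

lemma mu_ι (x : B) (h : TensorAlgebra.ι k x ∈ TPlus k B) :
    mu k B ⟨TensorAlgebra.ι k x, h⟩ = x := by
  simp [mu]

lemma mu_ι_mul (x : B) {a : TensorAlgebra k B} (ha : a ∈ TPlus k B)
    (h : TensorAlgebra.ι k x * a ∈ TPlus k B) :
    mu k B ⟨TensorAlgebra.ι k x * a, h⟩ = x * mu k B ⟨a, ha⟩ := by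
  have h1 := fst_lift_inr a
  rw [mem_TPlus_iff.1 ha] at h1
  simp [mu, h1]

lemma tensorMu_gen_mul {a : TensorAlgebra k B} (ha : a ∈ TPlus k B) (u : TT k B) :
    tensorMu k B (gen k B a * u) = TensorAlgebra.ι k (mu k B ⟨a, ha⟩) * tensorMu k B u := by
  rw [gen_of_mem ha]
  simp [tensorMu]

lemma tensorMu_consBlock (b : B) (u : TT k B) :
    tensorMu k B (consBlock b u) = TensorAlgebra.ι k b * tensorMu k B u := by
  rw [consBlock_apply, tensorMu_gen_mul (ι_mem_TPlus k b), mu_ι]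

/-- Since μ(x a) = x μ(a), lengthening the first block multiplies the first letter after
contraction. This is how multiplication operators enter the recursion for Δ. -/
lemma tensorMu_consLetter (b : B) (u : TT k B) :
    tensorMu k B (consLetter b u) = mulHead b (tensorMu k B u) := by
  induction u using tensorAlgebra_induction_left with
  | one => simp
  | add a b ha hb => simp only [map_add, ha, hb]
  | smul c a ha => simp only [map_smul, ha]
  | ι_mul v u hu =>
    rw [← gen_coe, consLetter_gen_mul _ v.2, tensorMu_gen_mul v.2,
      tensorMu_gen_mul (ι_mul_mem_TPlus b v.1), mu_ι_mul _ v.2, mulHead_ι_mul]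

end MulHead

/-! ### The first block of a composition -/

/-- The composition `(1, r₁, …, r_ℓ)`. -/
def consOne {n : ℕ} (σ : Composition n) : Composition (n + 1) where
  blocks := 1 :: σ.blocks
  blocks_pos := by
    intro i hi
    rcases List.mem_cons.1 hi with rfl | h
    · exact one_pos
    · exact σ.blocks_pos h
  blocks_sum := by rw [List.sum_cons, σ.blocks_sum, add_comm]

lemma exists_blocks_eq_cons {n : ℕ} (σ : Composition (n + 1)) :
    ∃ r bs, σ.blocks = (r + 1) :: bs := by
  rcases h : σ.blocks with _ | ⟨_ | r, bs⟩
  · have := σ.blocks_sum; simp [h] at this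
  · exact absurd (σ.blocks_pos (i := 0) (by simp [h])) (lt_irrefl 0)
  · exact ⟨r, bs, rfl⟩

/-- The composition `(r₁ + 1, r₂, …, r_ℓ)`. -/
def growHead {n : ℕ} (σ : Composition (n + 1)) : Composition (n + 2) where
  blocks := (σ.blocks.headI + 1) :: σ.blocks.tail
  blocks_pos := by
    intro i hi
    rcases List.mem_cons.1 hi with rfl | h
    · exact Nat.succ_pos _
    · exact σ.blocks_pos (List.mem_of_mem_tail h)
  blocks_sum := by
    obtain ⟨r, bs, h⟩ := exists_blocks_eq_cons σ
    have := σ.blocks_sum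
    simp only [h, List.headI_cons, List.tail_cons, List.sum_cons] at this ⊢
    omega

/-- The preimage is read off the first block: it is removed if it equals 1 and decreased by 1
otherwise. The index n + 1 guarantees that there is a first block to enlarge. -/
lemma consOne_growHead_bijective (n : ℕ) :
    Function.Bijective (Sum.elim consOne growHead :
      Composition (n + 1) ⊕ Composition (n + 1) → Composition (n + 2)) := by
  constructor
  · rintro (σ | σ) (τ | τ) h
    · have h' := congrArg Composition.blocks h
      simp only [Sum.elim_inl, consOne, List.cons.injEq, true_and] at h'
      exact congrArg _ (Composition.ext h')
    · obtain ⟨r, bs, hr⟩ := exists_blocks_eq_cons τ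
      have h' := congrArg Composition.blocks h
      simp [consOne, growHead, hr] at h'
    · obtain ⟨r, bs, hr⟩ := exists_blocks_eq_cons σ
      have h' := congrArg Composition.blocks h
      simp [consOne, growHead, hr] at h'
    · obtain ⟨r, bs, hr⟩ := exists_blocks_eq_cons σ
      obtain ⟨s, cs, hs⟩ := exists_blocks_eq_cons τ
      have h' := congrArg Composition.blocks h
      simp only [Sum.elim_inr, growHead, hr, hs, List.headI_cons, List.tail_cons, List.cons.injEq,
        Nat.add_right_cancel_iff] at h'
      exact congrArg _ (Composition.ext (by rw [hr, hs, h'.1, h'.2]))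
  · intro σ
    obtain ⟨r, bs, h⟩ := exists_blocks_eq_cons σ
    have hs := σ.blocks_sum
    have hp : ∀ {i}, i ∈ σ.blocks → 0 < i := σ.blocks_pos
    rcases r with _ | r
    · refine ⟨Sum.inl ⟨bs, fun hi => hp (by simp [h, hi]), ?_⟩, Composition.ext h.symm⟩
      rw [h, List.sum_cons] at hs; omega
    · refine ⟨Sum.inr ⟨(r + 1) :: bs, ?_, ?_⟩, Composition.ext h.symm⟩
      · intro i hi
        rcases List.mem_cons.1 hi with rfl | hi
        · exact Nat.succ_pos _
        · exact hp (by simp [h, hi])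
      · rw [h, List.sum_cons] at hs; rw [List.sum_cons]; omega

lemma sum_composition_succ {M : Type*} [AddCommMonoid M] (n : ℕ) (f : Composition (n + 2) → M) :
    ∑ σ, f σ = ∑ σ : Composition (n + 1), (f (consOne σ) + f (growHead σ)) := by
  rw [← Fintype.sum_bijective _ (consOne_growHead_bijective n) (fun s => f (Sum.elim _ _ s)) f
    fun _ => rfl, Fintype.sum_sum_type, Finset.sum_add_distrib]
  rfl

/-! ### Restriction along a composition in terms of lists -/

section Restrict

variable {k B : Type*} [Field k] [AddCommGroup B] [Module k B]

lemma component_tprod (n : ℕ) (x : Fin n → B) :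
    component k B n (TensorAlgebra.tprod k B n x) = PiTensorProduct.tprod k x := by
  rw [component, LinearMap.comp_apply, AlgHom.toLinearMap_apply,
    TensorAlgebra.toDirectSum_tensorPower_tprod]
  exact DirectSum.component.lof_self k _ _

lemma tprod_cons {n : ℕ} (b : B) (x : Fin n → B) :
    TensorAlgebra.tprod k B (n + 1) (Fin.cons b x) =
      TensorAlgebra.ι k b * TensorAlgebra.tprod k B n x := by
  simp [TensorAlgebra.tprod_apply, List.ofFn_succ]

lemma tprod_mem_TPlus {n : ℕ} (hn : n ≠ 0) (x : Fin n → B) :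
    TensorAlgebra.tprod k B n x ∈ TPlus k B := by
  obtain ⟨m, rfl⟩ := Nat.exists_eq_succ_of_ne_zero hn
  rw [← Fin.cons_self_tail x, tprod_cons]
  exact ι_mul_mem_TPlus _ _

lemma TPlus_eq_span : TPlus k B = Submodule.span k
    {a | ∃ (n : ℕ) (x : Fin (n + 1) → B), TensorAlgebra.tprod k B (n + 1) x = a} := by
  refine le_antisymm (fun a ha => ?_) (Submodule.span_le.2 ?_)
  · refine TPlus_induction (P := fun a => a ∈ Submodule.span k
        {a | ∃ (n : ℕ) (x : Fin (n + 1) → B), TensorAlgebra.tprod k B (n + 1) x = a})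
      (fun x => Submodule.subset_span ⟨0, fun _ => x, by simp [TensorAlgebra.tprod_apply]⟩)
      (fun a b ha hb => add_mem ha hb) (fun c a ha => Submodule.smul_mem _ _ ha)
      (fun x a hmem ha => ?_) ha
    · clear hmem
      induction ha using Submodule.span_induction with
      | zero => simp
      | add a b _ _ ha hb => rw [mul_add]; exact add_mem ha hb
      | smul c a _ ha => rw [mul_smul_comm]; exact Submodule.smul_mem _ _ ha
      | mem a ha =>
        obtain ⟨n, y, rfl⟩ := ha
        exact Submodule.subset_span ⟨n + 1, Fin.cons x y, tprod_cons _ _⟩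
  · rintro _ ⟨n, x, rfl⟩
    exact tprod_mem_TPlus n.succ_ne_zero x

/-- The product of the generators of `T(T(B)⁺)` given by a list of words. -/
def genProd (L : List (List B)) : TT k B :=
  (L.map fun l => gen k B (l.map (TensorAlgebra.ι k)).prod).prod

/-- In terms of lists, opening or lengthening the first block is a computation with `take` and
`drop`. -/
lemma restrict_tprod {n : ℕ} (σ : Composition n) (x : Fin n → B) :
    restrict σ (TensorAlgebra.tprod k B n x) =
      genProd ((List.ofFn x).splitWrtCompositionAux σ.blocks) := by
  change _ = genProd ((List.ofFn x).splitWrtComposition σ)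
  rw [restrict, LinearMap.comp_apply, component_tprod, PiTensorProduct.lift.tprod]
  simp only [restrictMultilinear, MultilinearMap.coe_mk, MultilinearMap.mkPiAlgebraFin_apply,
    genProd]
  congr 1
  refine List.ext_getElem (by simp) fun i h1 h2 => ?_
  simp only [List.getElem_ofFn, List.getElem_map, List.getElem_splitWrtComposition,
    TensorAlgebra.tprod_apply]
  congr 2
  have hi : i < σ.length := by simpa using h1
  have h3 := σ.sizeUpTo_le (i + 1)
  have h4 := σ.sizeUpTo_succ hi
  refine List.ext_getElem ?_ fun j h5 h6 => ?_
  · simp [Composition.blocksFun]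
    omega
  · simp only [List.getElem_ofFn, List.getElem_map, List.getElem_drop, List.getElem_take,
      Function.comp_apply]
    rfl

lemma restrict_consOne {n : ℕ} (σ : Composition n) (b : B) (x : Fin n → B) :
    restrict (consOne σ) (TensorAlgebra.ι k b * TensorAlgebra.tprod k B n x) =
      consBlock b (restrict σ (TensorAlgebra.tprod k B n x)) := by
  rw [← tprod_cons, restrict_tprod, restrict_tprod, consBlock_apply]
  simp [consOne, genProd, List.ofFn_succ, List.splitWrtCompositionAux]

/-- Ensures that a|σ has a first block, so that its contraction has no empty-word part and
`consLetter_gen` applies to it. -/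
lemma exists_restrict_tprod_eq {n : ℕ} (σ : Composition (n + 1)) (x : Fin (n + 1) → B) :
    ∃ a ∈ TPlus k B, ∃ u, restrict σ (TensorAlgebra.tprod k B (n + 1) x) = gen k B a * u := by
  obtain ⟨r, bs, h⟩ := exists_blocks_eq_cons σ
  rw [restrict_tprod, h, List.ofFn_succ, List.splitWrtCompositionAux_cons, List.take_succ_cons,
    List.drop_succ_cons, genProd, List.map_cons, List.prod_cons, List.map_cons, List.prod_cons]
  exact ⟨_, ι_mul_mem_TPlus _ _, _, rfl⟩

lemma restrict_growHead {n : ℕ} (σ : Composition (n + 1)) (b : B) (x : Fin (n + 1) → B) :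
    restrict (growHead σ) (TensorAlgebra.ι k b * TensorAlgebra.tprod k B (n + 1) x) =
      consLetter b (restrict σ (TensorAlgebra.tprod k B (n + 1) x)) := by
  obtain ⟨r, bs, h⟩ := exists_blocks_eq_cons σ
  rw [← tprod_cons, restrict_tprod, restrict_tprod, h, List.ofFn_succ (f := x),
    List.splitWrtCompositionAux_cons, List.take_succ_cons,
    List.drop_succ_cons, genProd, genProd, List.map_cons, List.prod_cons, List.map_cons,
    List.prod_cons, consLetter_gen_mul _ (ι_mul_mem_TPlus _ _)]
  simp [growHead, h, List.ofFn_succ, List.splitWrtCompositionAux]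

end Restrict

section Contract

variable {k B : Type*} [Field k] [NonUnitalRing B] [Module k B]
  [IsScalarTower k B B] [SMulCommClass k B B]

lemma contract_apply {n : ℕ} (σ : Composition n) (a : TensorAlgebra k B) :
    contract k B σ a = gen k B (tensorMu k B (restrict σ a)) := rfl

/-- The contraction is a single word whose letters are the products of the blocks: a new block is a
new letter of it, whereas in `contract_growHead` a longer first block only multiplies its first
letter. -/
lemma contract_consOne {n : ℕ} (σ : Composition (n + 1)) (b : B) (x : Fin (n + 1) → B) :
    contract k B (consOne σ) (TensorAlgebra.ι k b * TensorAlgebra.tprod k B (n + 1) x) =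
      consLetter b (contract k B σ (TensorAlgebra.tprod k B (n + 1) x)) := by
  rw [contract_apply, restrict_consOne, tensorMu_consBlock, contract_apply, consLetter_gen]
  obtain ⟨a, ha, u, h⟩ := exists_restrict_tprod_eq (k := k) σ x
  rw [h, tensorMu_gen_mul ha]
  exact ι_mul_mem_TPlus _ _

lemma contract_growHead {n : ℕ} (σ : Composition (n + 1)) (b : B) (x : Fin (n + 1) → B) :
    contract k B (growHead σ) (TensorAlgebra.ι k b * TensorAlgebra.tprod k B (n + 1) x) =
      mulLetter b (contract k B σ (TensorAlgebra.tprod k B (n + 1) x)) := by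
  rw [contract_apply, restrict_growHead, tensorMu_consLetter, contract_apply, mulLetter_gen]

end Contract

/-! ### The recursion satisfied by the coproduct -/

section Twist

variable {k B C D M N P : Type*} [Field k] [AddCommGroup B] [Module k B]
  [AddCommGroup C] [Module k C] [AddCommGroup D] [Module k D] [AddCommGroup M] [Module k M]
  [AddCommGroup N] [Module k N] [AddCommGroup P] [Module k P]

/-- For `F : B → End M` and `G : C → End N`, the map `b ⊗ c ↦ F b ⊗ G c`. -/
def twist (F : B →ₗ[k] Module.End k M) (G : C →ₗ[k] Module.End k N) :
    B ⊗[k] C →ₗ[k] Module.End k (M ⊗[k] N) :=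
  TensorProduct.homTensorHomMap (.id k) M N M N ∘ₗ TensorProduct.map F G

@[simp] lemma twist_tmul (F : B →ₗ[k] Module.End k M) (G : C →ₗ[k] Module.End k N) (b : B) (c : C) :
    twist F G (b ⊗ₜ c) = TensorProduct.map (F b) (G c) := rfl

lemma twist_add_left (F F' : B →ₗ[k] Module.End k M) (G : C →ₗ[k] Module.End k N) :
    twist (F + F') G = twist F G + twist F' G := by
  rw [twist, TensorProduct.map_add_left, LinearMap.comp_add]; rfl

lemma twist_add_right (F : B →ₗ[k] Module.End k M) (G G' : C →ₗ[k] Module.End k N) :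
    twist F (G + G') = twist F G + twist F G' := by
  rw [twist, TensorProduct.map_add_right, LinearMap.comp_add]; rfl

lemma assoc_twist_twist (F : B →ₗ[k] Module.End k M) (G : C →ₗ[k] Module.End k N)
    (H : D →ₗ[k] Module.End k P) (s : (B ⊗[k] C) ⊗[k] D) (w : (M ⊗[k] N) ⊗[k] P) :
    TensorProduct.assoc k M N P (twist (twist F G) H s w) =
      twist F (twist G H) (TensorProduct.assoc k B C D s) (TensorProduct.assoc k M N P w) := by
  have h : LinearMap.compr₂ (twist (twist F G) H) (TensorProduct.assoc k M N P).toLinearMap =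
      (twist F (twist G H)).compl₁₂ (TensorProduct.assoc k B C D).toLinearMap
        (TensorProduct.assoc k M N P).toLinearMap := by
    ext b c d x y z
    simp
  exact LinearMap.congr_fun (LinearMap.congr_fun h s) w

lemma map_twist {B' C' M' N' : Type*} [AddCommGroup B'] [Module k B'] [AddCommGroup C']
    [Module k C'] [AddCommGroup M'] [Module k M'] [AddCommGroup N'] [Module k N']
    {F : B →ₗ[k] Module.End k M} {G : C →ₗ[k] Module.End k N}
    {F' : B' →ₗ[k] Module.End k M'} {G' : C' →ₗ[k] Module.End k N'}
    (f : B →ₗ[k] B') (g : C →ₗ[k] C') (p : M →ₗ[k] M') (q : N →ₗ[k] N')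
    (hF : ∀ b x, p (F b x) = F' (f b) (p x)) (hG : ∀ c y, q (G c y) = G' (g c) (q y))
    (s : B ⊗[k] C) (w : M ⊗[k] N) :
    TensorProduct.map p q (twist F G s w) =
      twist F' G' (TensorProduct.map f g s) (TensorProduct.map p q w) := by
  have h : LinearMap.compr₂ (twist F G) (TensorProduct.map p q) =
      (twist F' G').compl₁₂ (TensorProduct.map f g) (TensorProduct.map p q) := by
    ext b c x y
    simp [hF, hG]
  exact LinearMap.congr_fun (LinearMap.congr_fun h s) w

/-- Expanding the first tensor factor gives (F₀ ⊗ F₀) ⊗ F₁ + (F₀ ⊗ F₁ + F₁ ⊗ F₂) ⊗ F₂, expanding the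
second gives F₀ ⊗ (F₀ ⊗ F₁ + F₁ ⊗ F₂) + F₁ ⊗ (F₂ ⊗ F₂). The three terms agree, and so do their
arguments by coassociativity at b and u. -/
lemma coassoc_of_insert {F₀ F₁ F₂ : B →ₗ[k] Module.End k M} {δ : B →ₗ[k] B ⊗[k] B}
    {Δ : M →ₗ[k] M ⊗[k] M} (h₀ : ∀ b u, Δ (F₀ b u) = twist F₀ F₀ (δ b) (Δ u))
    (h₁ : ∀ b u, Δ (F₁ b u) = (twist F₀ F₁ + twist F₁ F₂) (δ b) (Δ u))
    (h₂ : ∀ b u, Δ (F₂ b u) = twist F₂ F₂ (δ b) (Δ u)) {b : B}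
    (hb : TensorProduct.assoc k B B B (TensorProduct.map δ .id (δ b)) =
      TensorProduct.map .id δ (δ b)) {u : M}
    (hu : TensorProduct.assoc k M M M (TensorProduct.map Δ .id (Δ u)) =
      TensorProduct.map .id Δ (Δ u)) :
    TensorProduct.assoc k M M M (TensorProduct.map Δ .id (Δ (F₁ b u))) =
      TensorProduct.map .id Δ (Δ (F₁ b u)) := by
  have hid : ∀ (F : B →ₗ[k] Module.End k M) b u, LinearMap.id (R := k) (F b u) =
    F (LinearMap.id (R := k) b) (LinearMap.id (R := k) u) := fun _ _ _ => rfl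
  rw [h₁, LinearMap.add_apply, LinearMap.add_apply, map_add, map_add, map_add,
    map_twist δ .id Δ .id h₀ (hid F₁), map_twist δ .id Δ .id h₁ (hid F₂),
    map_twist .id δ .id Δ (hid F₀) h₁, map_twist .id δ .id Δ (hid F₁) h₂,
    twist_add_left, twist_add_right, LinearMap.add_apply, LinearMap.add_apply,
    LinearMap.add_apply, LinearMap.add_apply, map_add, assoc_twist_twist, assoc_twist_twist,
    assoc_twist_twist, hu, hb, add_assoc]

/-- Each of the two terms contains F₁ exactly once, so exactly one factor c comes out. Rescaling by
the degree uses this with c = 2. -/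
lemma map_insert {F₀ F₁ F₂ : B →ₗ[k] Module.End k M} {p : B →ₗ[k] B} {φ : M →ₗ[k] M} {c : k}
    (h₀ : ∀ b u, φ (F₀ b u) = F₀ (p b) (φ u)) (h₁ : ∀ b u, φ (F₁ b u) = F₁ (c • p b) (φ u))
    (h₂ : ∀ b u, φ (F₂ b u) = F₂ (p b) (φ u)) (s : B ⊗[k] B) (w : M ⊗[k] M) :
    TensorProduct.map φ φ ((twist F₀ F₁ + twist F₁ F₂) s w) =
      (twist F₀ F₁ + twist F₁ F₂) (c • TensorProduct.map p p s) (TensorProduct.map φ φ w) := by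
  have h₁' : ∀ b u, φ (F₁ b u) = F₁ ((c • p) b) (φ u) := h₁
  rw [LinearMap.add_apply, LinearMap.add_apply, LinearMap.add_apply, LinearMap.add_apply, map_add,
    map_twist p (c • p) φ φ h₀ h₁', map_twist (c • p) p φ φ h₁' h₂, TensorProduct.map_smul_right,
    TensorProduct.map_smul_left, LinearMap.smul_apply]

end Twist

section Recursion

variable {k B : Type*} [Field k] [NonUnitalRing B] [Module k B]
  [IsScalarTower k B B] [SMulCommClass k B B]

/-- The operator of `T(T(B)⁺) ⊗ T(T(B)⁺)` describing the insertion of a letter in the coproduct. -/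
def insertOp : B ⊗[k] B →ₗ[k] Module.End k (TT k B ⊗[k] TT k B) :=
  twist consBlock consLetter + twist consLetter mulLetter

lemma insertOp_apply (s : B ⊗[k] B) (w : TT k B ⊗[k] TT k B) :
    insertOp s w = twist consBlock consLetter s w + twist consLetter mulLetter s w := by
  rw [insertOp, LinearMap.add_apply, LinearMap.add_apply]

/-- Compositions with first block 1 give `consBlock` ⊗ `consLetter`, those with a larger first block
give `consLetter` ⊗ `mulLetter`. Both tensor factors must be words of the length that the
compositions divide. -/
lemma sum_restrict_contract_insert {n : ℕ} (s : B ⊗[k] B)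
    {w : TensorAlgebra k B ⊗[k] TensorAlgebra k B}
    (hw : w ∈ Submodule.span k {w | ∃ x y : Fin (n + 1) → B,
      TensorAlgebra.tprod k B (n + 1) x ⊗ₜ TensorAlgebra.tprod k B (n + 1) y = w}) :
    (∑ σ : Composition (n + 2), TensorProduct.map (restrict σ) (contract k B σ))
      (TensorProduct.map (TensorAlgebra.ι k) (TensorAlgebra.ι k) s * w) =
    insertOp s ((∑ σ : Composition (n + 1), TensorProduct.map (restrict σ) (contract k B σ)) w) := by
  induction hw using Submodule.span_induction with
  | zero => simp
  | add a b _ _ ha hb => simp only [mul_add, map_add, ha, hb]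
  | smul c a _ ha => simp only [mul_smul_comm, map_smul, ha]
  | mem w hw =>
    obtain ⟨x, y, rfl⟩ := hw
    induction s with
    | zero => simp
    | add a b ha hb => simp only [add_mul, map_add, LinearMap.add_apply, ha, hb]
    | tmul b c =>
      rw [sum_composition_succ]
      simp only [LinearMap.sum_apply, map_sum]
      refine Finset.sum_congr rfl fun σ _ => ?_
      simp only [TensorProduct.map_tmul, Algebra.TensorProduct.tmul_mul_tmul, LinearMap.add_apply,
        restrict_consOne, contract_consOne, restrict_growHead, contract_growHead, insertOp,
        twist_tmul]

end Recursion

section Coproduct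

variable {k B : Type*} [Field k] [NonUnitalRing B] [Module k B]
  [IsScalarTower k B B] [SMulCommClass k B B] [NonUnitalBialgebra k B]

lemma freeComul_ι (x : B) : freeComul k B (TensorAlgebra.ι k x) =
    TensorProduct.map (TensorAlgebra.ι k) (TensorAlgebra.ι k) (Coalgebra.comul x) := by
  simp [freeComul]

lemma freeComul_tprod_mem {n : ℕ} (x : Fin n → B) :
    freeComul k B (TensorAlgebra.tprod k B n x) ∈ Submodule.span k {w | ∃ x y : Fin n → B,
      TensorAlgebra.tprod k B n x ⊗ₜ[k] TensorAlgebra.tprod k B n y = w} := by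
  induction n with
  | zero =>
    refine Submodule.subset_span ⟨x, x, ?_⟩
    simp [TensorAlgebra.tprod_apply, Algebra.TensorProduct.one_def]
  | succ n ih =>
    rw [← Fin.cons_self_tail x, tprod_cons, map_mul, freeComul_ι]
    have h := ih (Fin.tail x)
    generalize freeComul k B (TensorAlgebra.tprod k B n (Fin.tail x)) = w at h ⊢
    generalize (Coalgebra.comul (x 0) : B ⊗[k] B) = s
    induction h using Submodule.span_induction with
    | zero => simp
    | add a b _ _ ha hb => simp only [mul_add]; exact add_mem ha hb
    | smul c a _ ha => simp only [mul_smul_comm]; exact Submodule.smul_mem _ _ ha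
    | mem w hw =>
      obtain ⟨y, z, rfl⟩ := hw
      induction s with
      | zero => simp
      | add a b ha hb => simp only [map_add, add_mul]; exact add_mem ha hb
      | tmul b c =>
        refine Submodule.subset_span ⟨Fin.cons b y, Fin.cons c z, ?_⟩
        simp

lemma comulOnTensor_tprod {n : ℕ} (x : Fin n → B) :
    comulOnTensor k B (TensorAlgebra.tprod k B n x) =
      (∑ σ : Composition n, TensorProduct.map (restrict σ) (contract k B σ))
        (freeComul k B (TensorAlgebra.tprod k B n x)) := by
  rw [comulOnTensor, liftComponents_tprod]
  simp

lemma comulOnTensor_ι (x : B) : comulOnTensor k B (TensorAlgebra.ι k x) =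
    TensorProduct.map (gen k B ∘ₗ TensorAlgebra.ι k) (gen k B ∘ₗ TensorAlgebra.ι k)
      (Coalgebra.comul x) := by
  have h : ∀ y : B, TensorAlgebra.ι k y = TensorAlgebra.tprod k B 1 (fun _ => y) := fun y => by
    simp [TensorAlgebra.tprod_apply]
  rw [h, comulOnTensor_tprod, ← h, freeComul_ι]
  generalize (Coalgebra.comul x : B ⊗[k] B) = s
  -- The only composition of 1 is (1), along which restriction and contraction both leave a letter
  -- unchanged.
  have hcard : Fintype.card (Composition 1) = 1 := by simp [composition_card]
  have := Fintype.card_le_one_iff_subsingleton.1 hcard.le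
  have hr : ∀ (σ : Composition 1) (y : B),
      restrict σ (TensorAlgebra.ι k y) = gen k B (TensorAlgebra.ι k y) := by
    intro σ y
    obtain rfl : σ = Composition.single 1 one_pos := Subsingleton.elim _ _
    rw [h, restrict_tprod]
    simp [genProd, List.splitWrtCompositionAux, TensorAlgebra.tprod_apply]
  have hc : ∀ (σ : Composition 1) (y : B),
      contract k B σ (TensorAlgebra.ι k y) = gen k B (TensorAlgebra.ι k y) := by
    intro σ y
    have := tensorMu_gen_mul (ι_mem_TPlus k y) 1
    rw [mul_one, map_one, mul_one, mu_ι] at this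
    rw [contract_apply, hr, this]
  induction s with
  | zero => simp
  | add a b ha hb => simp only [map_add, ha, hb]
  | tmul b c => simp [hr, hc, hcard]

lemma comulOnTensor_ι_mul (x : B) {a : TensorAlgebra k B} (ha : a ∈ TPlus k B) :
    comulOnTensor k B (TensorAlgebra.ι k x * a) =
      insertOp (Coalgebra.comul x) (comulOnTensor k B a) := by
  rw [TPlus_eq_span] at ha
  induction ha using Submodule.span_induction with
  | zero => simp
  | add a b _ _ ha hb => simp only [mul_add, map_add, ha, hb]
  | smul c a _ ha => simp only [mul_smul_comm, map_smul, ha]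
  | mem a ha =>
    obtain ⟨n, y, rfl⟩ := ha
    rw [← tprod_cons, comulOnTensor_tprod, comulOnTensor_tprod, tprod_cons, map_mul, freeComul_ι,
      sum_restrict_contract_insert _ (freeComul_tprod_mem y)]

end Coproduct

/-! ### The bialgebra `T(T(B)⁺)` -/

/-- The operator touches only the first letter, so it reaches v only through the coefficient of the
empty word in u. -/
lemma headMap_mul {k V : Type*} [Field k] [AddCommGroup V] [Module k V]
    (f : V →ₗ[k] TensorAlgebra k V) (u v : TensorAlgebra k V) :
    headMap f (u * v) = headMap f u * v + TensorAlgebra.algebraMapInv (R := k) u • headMap f v := by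
  induction u using tensorAlgebra_induction_left with
  | one => simp
  | add a b ha hb => simp only [add_mul, map_add, ha, hb, add_smul]; abel
  | smul c a ha => simp only [smul_mul_assoc, map_smul, ha, smul_add, smul_assoc]
  | ι_mul w a _ => simp [mul_assoc]

section

variable {k B : Type*} [Field k] [AddCommGroup B] [Module k B]

lemma consLetter_mul (b : B) {u : TT k B} (hu : u ∈ TPlus k (TPlus k B)) (v : TT k B) :
    consLetter b (u * v) = consLetter b u * v := by
  have h := headMap_mul
    (gen k B ∘ₗ LinearMap.mulLeft k (TensorAlgebra.ι k b) ∘ₗ (TPlus k B).subtype) u v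
  rw [mem_TPlus_iff.1 hu, zero_smul, add_zero] at h
  exact h

lemma gen_mem (a : TensorAlgebra k B) : gen k B a ∈ TPlus k (TPlus k B) := ι_mem_TPlus k _

lemma consLetter_mem (b : B) (u : TT k B) : consLetter b u ∈ TPlus k (TPlus k B) := by
  induction u using tensorAlgebra_induction_left with
  | one => simp
  | add a b ha hb => rw [map_add]; exact add_mem ha hb
  | smul c a ha => rw [map_smul]; exact Submodule.smul_mem _ _ ha
  | ι_mul v u _ => rw [← gen_coe, consLetter_gen_mul _ v.2]; exact ι_mul_mem_TPlus _ _

lemma consBlock_mem (b : B) (u : TT k B) : consBlock b u ∈ TPlus k (TPlus k B) :=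
  ι_mul_mem_TPlus _ _

/-- `ιInv` reads off the B-component in the square-zero extension k ⊕ B, where two elements without
scalar part have product zero. -/
lemma ιInv_mul_eq_zero {x : B} {a : TensorAlgebra k B} (ha : a ∈ TPlus k B) :
    TensorAlgebra.ιInv (TensorAlgebra.ι k x * a) = 0 := by
  let : Module kᵐᵒᵖ B := Module.compHom _ ((RingHom.id k).fromOpposite mul_comm)
  have : IsCentralScalar k B := ⟨fun r m => rfl⟩
  have h : (TensorAlgebra.toTrivSqZeroExt a : TrivSqZeroExt k B).fst =
      TensorAlgebra.algebraMapInv a := by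
    suffices h : (TrivSqZeroExt.fstHom k k B).comp TensorAlgebra.toTrivSqZeroExt =
        TensorAlgebra.algebraMapInv from DFunLike.congr_fun h a
    ext x
    simp
  change (TensorAlgebra.toTrivSqZeroExt (TensorAlgebra.ι k x * a) : TrivSqZeroExt k B).snd = 0
  rw [map_mul, TrivSqZeroExt.snd_mul, h, mem_TPlus_iff.1 ha]
  simp

variable (k B) in
/-- The tensor square of the augmentation ideal of `T(T(B)⁺)`. -/
def augSquare : Submodule k (TT k B ⊗[k] TT k B) :=
  Submodule.span k {w | ∃ p ∈ TPlus k (TPlus k B), ∃ q ∈ TPlus k (TPlus k B), p ⊗ₜ q = w}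

end

section

variable {k B : Type*} [Field k] [NonUnitalRing B] [Module k B]
  [IsScalarTower k B B] [SMulCommClass k B B]

lemma mulLetter_mul (b : B) {u : TT k B} (hu : u ∈ TPlus k (TPlus k B)) (v : TT k B) :
    mulLetter b (u * v) = mulLetter b u * v := by
  have h := headMap_mul (gen k B ∘ₗ mulHead b ∘ₗ (TPlus k B).subtype) u v
  rw [mem_TPlus_iff.1 hu, zero_smul, add_zero] at h
  exact h

lemma mulLetter_mem (b : B) (u : TT k B) : mulLetter b u ∈ TPlus k (TPlus k B) := by
  induction u using tensorAlgebra_induction_left with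
  | one => simp
  | add a b ha hb => rw [map_add]; exact add_mem ha hb
  | smul c a ha => rw [map_smul]; exact Submodule.smul_mem _ _ ha
  | ι_mul v u _ => rw [← gen_coe, mulLetter_gen_mul]; exact ι_mul_mem_TPlus _ _

/-- On the augmentation square both tensor factors of w begin with a block, so an insertion at the
front never reaches z. -/
lemma insertOp_mul (s : B ⊗[k] B) {w : TT k B ⊗[k] TT k B} (hw : w ∈ augSquare k B)
    (z : TT k B ⊗[k] TT k B) : insertOp s (w * z) = insertOp s w * z := by
  induction hw using Submodule.span_induction with
  | zero => simp
  | add a b _ _ ha hb => simp only [add_mul, map_add, ha, hb]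
  | smul c a _ ha => simp only [smul_mul_assoc, map_smul, ha]
  | mem w hw =>
    obtain ⟨p, hp, q, hq, rfl⟩ := hw
    induction z with
    | zero => simp
    | add a b ha hb => simp only [mul_add, map_add, ha, hb]
    | tmul u v =>
      induction s with
      | zero => simp
      | add a b ha hb => simp only [map_add, LinearMap.add_apply, add_mul, ha, hb]
      | tmul b c =>
        simp only [insertOp, LinearMap.add_apply, twist_tmul, TensorProduct.map_tmul,
          Algebra.TensorProduct.tmul_mul_tmul, add_mul, consBlock_apply, mul_assoc,
          consLetter_mul _ hp, consLetter_mul _ hq, mulLetter_mul _ hq]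

lemma insertOp_mem (s : B ⊗[k] B) (w : TT k B ⊗[k] TT k B) : insertOp s w ∈ augSquare k B := by
  induction w with
  | zero => simp
  | add a b ha hb => rw [map_add]; exact add_mem ha hb
  | tmul u v =>
    induction s with
    | zero => simp
    | add a b ha hb => rw [map_add]; exact add_mem ha hb
    | tmul b c =>
      rw [insertOp, LinearMap.add_apply, LinearMap.add_apply, twist_tmul, twist_tmul]
      exact add_mem (Submodule.subset_span ⟨_, consBlock_mem _ _, _, consLetter_mem _ _, rfl⟩)
        (Submodule.subset_span ⟨_, consLetter_mem _ _, _, mulLetter_mem _ _, rfl⟩)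

lemma twist_mulLetter_consBlock (s t : B ⊗[k] B) (w : TT k B ⊗[k] TT k B) :
    twist mulLetter mulLetter s (twist consBlock consBlock t w) =
      twist consBlock consBlock (s * t) w := by
  induction s with
  | zero => simp
  | add a b ha hb => simp only [map_add, LinearMap.add_apply, add_mul, ha, hb]
  | tmul b c =>
    induction t with
    | zero => simp
    | add a b ha hb => simp only [map_add, LinearMap.add_apply, mul_add, ha, hb]
    | tmul b' c' =>
      induction w with
      | zero => simp
      | add a b ha hb => simp only [map_add, ha, hb]
      | tmul u v => simp [mulLetter_consBlock]

lemma twist_mulLetter_insertOp (s t : B ⊗[k] B) (w : TT k B ⊗[k] TT k B) :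
    twist mulLetter mulLetter s (insertOp t w) = insertOp (s * t) w := by
  induction s with
  | zero => simp
  | add a b ha hb => simp only [map_add, LinearMap.add_apply, add_mul, ha, hb]
  | tmul b c =>
    induction t with
    | zero => simp
    | add a b ha hb => simp only [map_add, LinearMap.add_apply, mul_add, ha, hb]
    | tmul b' c' =>
      induction w with
      | zero => simp
      | add a b ha hb => simp only [map_add, ha, hb]
      | tmul u v =>
        simp [insertOp, mulLetter_consBlock, mulLetter_consLetter, mulLetter_mulLetter]

end

/-! ### The recursion for Δ and ε on T(T(B)⁺), and the bialgebra axioms. -/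

section Coproduct

variable {k B : Type*} [Field k] [NonUnitalRing B] [Module k B]
  [IsScalarTower k B B] [SMulCommClass k B B] [NonUnitalBialgebra k B]

lemma comulOnTensor_mem {a : TensorAlgebra k B} (ha : a ∈ TPlus k B) :
    comulOnTensor k B a ∈ augSquare k B := by
  refine TPlus_induction (P := fun a => comulOnTensor k B a ∈ augSquare k B) (fun x => ?_)
    (fun a b ha hb => ?_) (fun c a ha => ?_) (fun x a ha _ => ?_) ha
  · rw [comulOnTensor_ι]
    generalize (Coalgebra.comul x : B ⊗[k] B) = s
    induction s with
    | zero => simp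
    | add a b ha hb => rw [map_add]; exact add_mem ha hb
    | tmul b c => exact Submodule.subset_span ⟨_, gen_mem _, _, gen_mem _, rfl⟩
  · rw [map_add]; exact add_mem ha hb
  · rw [map_smul]; exact Submodule.smul_mem _ _ ha
  · rw [comulOnTensor_ι_mul x ha]; exact insertOp_mem _ _

lemma renormComul_gen {a : TensorAlgebra k B} (ha : a ∈ TPlus k B) :
    renormComul k B (gen k B a) = comulOnTensor k B a := by
  rw [gen_of_mem ha]; simp [renormComul]

lemma renormComul_consBlock (x : B) (u : TT k B) :
    renormComul k B (consBlock x u) =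
      twist consBlock consBlock (Coalgebra.comul x) (renormComul k B u) := by
  rw [consBlock_apply, map_mul, renormComul_gen (ι_mem_TPlus k x), comulOnTensor_ι]
  generalize (Coalgebra.comul x : B ⊗[k] B) = s
  generalize renormComul k B u = w
  induction s with
  | zero => simp
  | add a b ha hb => simp only [map_add, LinearMap.add_apply, add_mul, ha, hb]
  | tmul b c =>
    induction w with
    | zero => simp
    | add a b ha hb => simp only [map_add, mul_add, ha, hb]
    | tmul u v => simp [consBlock_apply]

/-- The coproduct of the first word lies in the augmentation square, so by `insertOp_mul` the
recursion for one word extends to products. For u = 1 both sides vanish, since `consLetter` kills 1.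
-/
lemma renormComul_consLetter (x : B) (u : TT k B) :
    renormComul k B (consLetter x u) = insertOp (Coalgebra.comul x) (renormComul k B u) := by
  induction u using tensorAlgebra_induction_left with
  | one =>
    rw [consLetter_one, map_zero, map_one, Algebra.TensorProduct.one_def]
    generalize (Coalgebra.comul x : B ⊗[k] B) = s
    induction s with
    | zero => simp
    | add a b ha hb => rw [map_add, LinearMap.add_apply, ← ha, ← hb, add_zero]
    | tmul b c => simp [insertOp]
  | add a b ha hb => simp only [map_add, ha, hb]
  | smul c a ha => simp only [map_smul, ha]
  | ι_mul v u hu =>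
    rw [← gen_coe, consLetter_gen_mul _ v.2, map_mul (renormComul k B), map_mul (renormComul k B),
      renormComul_gen v.2,
      renormComul_gen (ι_mul_mem_TPlus _ _), comulOnTensor_ι_mul _ v.2,
      insertOp_mul _ (comulOnTensor_mem v.2)]

/-- Multiplication is absorbed by the letter inserted last, as in `mulLetter_consBlock` and
`mulLetter_consLetter`; the two sides then agree because δ is multiplicative on B. -/
lemma renormComul_mulLetter (x : B) (u : TT k B) :
    renormComul k B (mulLetter x u) =
      twist mulLetter mulLetter (Coalgebra.comul x) (renormComul k B u) := by
  suffices h : (renormComul k B).toLinearMap ∘ₗ mulLetter x =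
      twist mulLetter mulLetter (Coalgebra.comul x) ∘ₗ (renormComul k B).toLinearMap from
    LinearMap.congr_fun h u
  refine TT_linearMap_ext ?_ (fun b u _ => ?_) (fun b u _ => ?_)
  · simp only [LinearMap.comp_apply, mulLetter_one, map_zero, AlgHom.toLinearMap_apply, map_one,
      Algebra.TensorProduct.one_def]
    generalize (Coalgebra.comul x : B ⊗[k] B) = s
    induction s with
    | zero => simp
    | add a b ha hb => rw [map_add, LinearMap.add_apply, ← ha, ← hb, add_zero]
    | tmul b c => simp
  · simp only [LinearMap.comp_apply, AlgHom.toLinearMap_apply, mulLetter_consBlock,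
      renormComul_consBlock, NonUnitalBialgebra.comul_mul, twist_mulLetter_consBlock]
  · simp only [LinearMap.comp_apply, AlgHom.toLinearMap_apply, mulLetter_consLetter,
      renormComul_consLetter, NonUnitalBialgebra.comul_mul, twist_mulLetter_insertOp]

lemma renormCounit_gen {a : TensorAlgebra k B} (ha : a ∈ TPlus k B) :
    renormCounit k B (gen k B a) = Coalgebra.counit (TensorAlgebra.ιInv a) := by
  rw [gen_of_mem ha]; simp [renormCounit, counitOnPlus]

lemma renormCounit_consBlock (x : B) (u : TT k B) :
    renormCounit k B (consBlock x u) = Coalgebra.counit x * renormCounit k B u := by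
  rw [consBlock_apply, map_mul, renormCounit_gen (ι_mem_TPlus k x), TensorAlgebra.ι_leftInverse]

lemma renormCounit_consLetter (x : B) (u : TT k B) :
    renormCounit k B (consLetter x u) = 0 := by
  induction u using tensorAlgebra_induction_left with
  | one => simp
  | add a b ha hb => simp only [map_add, ha, hb, add_zero]
  | smul c a ha => simp only [map_smul, ha, smul_zero]
  | ι_mul v u hu =>
    rw [← gen_coe, consLetter_gen_mul _ v.2, map_mul, renormCounit_gen (ι_mul_mem_TPlus _ _),
      ιInv_mul_eq_zero v.2, map_zero, zero_mul]

/-- The augmentation is subtracted because `mulLetter` kills 1 while ε(1) = 1. -/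
lemma renormCounit_mulLetter (x : B) (u : TT k B) :
    renormCounit k B (mulLetter x u) =
      Coalgebra.counit x * (renormCounit k B u - TensorAlgebra.algebraMapInv u) := by
  suffices h : (renormCounit k B).toLinearMap ∘ₗ mulLetter x = (Coalgebra.counit x : k) •
      ((renormCounit k B).toLinearMap - TensorAlgebra.algebraMapInv.toLinearMap) from
    LinearMap.congr_fun h u
  refine TT_linearMap_ext (by simp) (fun b u _ => ?_) (fun b u _ => ?_)
  · have := mem_TPlus_iff.1 (consBlock_mem b u)
    simp [mulLetter_consBlock, renormCounit_consBlock, this, NonUnitalBialgebra.counit_mul,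
      mul_assoc]
  · have := mem_TPlus_iff.1 (consLetter_mem b u)
    simp [mulLetter_consLetter, renormCounit_consLetter, this]

lemma renormComul_coassoc (u : TT k B) :
    TensorProduct.assoc k _ _ _
      (TensorProduct.map (renormComul k B).toLinearMap .id (renormComul k B u)) =
    TensorProduct.map .id (renormComul k B).toLinearMap (renormComul k B u) := by
  have hB : ∀ x : B, TensorProduct.assoc k B B B
      (TensorProduct.map Coalgebra.comul .id (Coalgebra.comul x)) =
      TensorProduct.map .id Coalgebra.comul (Coalgebra.comul x) := Coalgebra.coassoc_apply
  have h0 : ∀ b u, (renormComul k B).toLinearMap (consBlock b u) =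
      twist consBlock consBlock (Coalgebra.comul b) ((renormComul k B).toLinearMap u) :=
    renormComul_consBlock
  have h1 : ∀ b u, (renormComul k B).toLinearMap (consLetter b u) =
      insertOp (Coalgebra.comul b) ((renormComul k B).toLinearMap u) := renormComul_consLetter
  have h2 : ∀ b u, (renormComul k B).toLinearMap (mulLetter b u) =
      twist mulLetter mulLetter (Coalgebra.comul b) ((renormComul k B).toLinearMap u) :=
    renormComul_mulLetter
  have hid : ∀ (F : B →ₗ[k] Module.End k (TT k B)) b u, LinearMap.id (R := k) (F b u) =
    F (LinearMap.id (R := k) b) (LinearMap.id (R := k) u) := fun _ _ _ => rfl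
  induction u using TT_induction with
  | one => simp [Algebra.TensorProduct.one_def]
  | add u v hu hv => simp only [map_add, hu, hv]
  | smul c u hu => simp only [map_smul, hu]
  | consBlock b u hu =>
    rw [renormComul_consBlock, map_twist _ _ _ _ h0 (hid _), assoc_twist_twist, hu, hB,
      map_twist _ _ _ _ (hid _) h0]
  | consLetter b u hu =>
    exact coassoc_of_insert h0 h1 h2 (hB b) hu

/-- For `consLetter` the term `consLetter` ⊗ `mulLetter` dies under ε ⊗ id, and the counit of B
turns the other one into `consLetter b u`. -/
lemma renormCounit_left (u : TT k B) :
    TensorProduct.map (renormCounit k B).toLinearMap .id (renormComul k B u) = 1 ⊗ₜ u := by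
  have hB : ∀ x : B, TensorProduct.map Coalgebra.counit .id (Coalgebra.comul x) =
      (1 : k) ⊗ₜ[k] x := Coalgebra.rTensor_counit_comul
  have h0 : ∀ b u, (renormCounit k B).toLinearMap (consBlock b u) =
      LinearMap.mul k k (Coalgebra.counit b) ((renormCounit k B).toLinearMap u) :=
    renormCounit_consBlock
  have h1 : ∀ b u, (renormCounit k B).toLinearMap (consLetter b u) =
      (0 : B →ₗ[k] Module.End k k) (LinearMap.id (R := k) b) ((renormCounit k B).toLinearMap u) :=
    renormCounit_consLetter
  have hid : ∀ (F : B →ₗ[k] Module.End k (TT k B)) b u, LinearMap.id (R := k) (F b u) =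
    F (LinearMap.id (R := k) b) (LinearMap.id (R := k) u) := fun _ _ _ => rfl
  induction u using TT_induction with
  | one => simp [Algebra.TensorProduct.one_def]
  | add u v hu hv => simp only [map_add, hu, hv, TensorProduct.tmul_add]
  | smul c u hu => simp only [map_smul, hu, TensorProduct.tmul_smul]
  | consBlock b u hu =>
    rw [renormComul_consBlock, map_twist _ _ _ _ h0 (hid _), hu, hB]
    simp
  | consLetter b u hu =>
    rw [renormComul_consLetter, insertOp, LinearMap.add_apply, LinearMap.add_apply, map_add,
      map_twist _ _ _ _ h0 (hid _), map_twist _ _ _ _ h1 (hid _), hu, hB]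
    simp [twist]

/-- The coproduct maps the augmentation ideal into its tensor square, so only the multiple of 1 in u
survives. This controls the correction term in `renormCounit_mulLetter`. -/
lemma renormComul_algebraMapInv (u : TT k B) :
    TensorProduct.map .id (TensorAlgebra.algebraMapInv.toLinearMap : TT k B →ₗ[k] k)
      (renormComul k B u) = TensorAlgebra.algebraMapInv (R := k) u • (1 ⊗ₜ 1) := by
  have h : ∀ w ∈ augSquare k B, TensorProduct.map .id
      (TensorAlgebra.algebraMapInv.toLinearMap : TT k B →ₗ[k] k) w = 0 := by
    intro w hw
    induction hw using Submodule.span_induction with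
    | zero => simp
    | add a b _ _ ha hb => rw [map_add, ha, hb, add_zero]
    | smul c a _ ha => rw [map_smul, ha, smul_zero]
    | mem w hw =>
      obtain ⟨p, _, q, hq, rfl⟩ := hw
      simp [mem_TPlus_iff.1 hq]
  have h' : ∀ s w, twist consBlock consBlock s w ∈ augSquare k B := by
    intro s w
    induction w with
    | zero => simp
    | add a b ha hb => rw [map_add]; exact add_mem ha hb
    | tmul u v =>
      induction s with
      | zero => simp
      | add a b ha hb => rw [map_add]; exact add_mem ha hb
      | tmul b c => exact Submodule.subset_span ⟨_, consBlock_mem _ _, _, consBlock_mem _ _, rfl⟩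
  induction u using TT_induction with
  | one => simp [Algebra.TensorProduct.one_def]
  | add u v hu hv => simp only [map_add, hu, hv, add_smul]
  | smul c u hu => simp only [map_smul, hu, smul_assoc]
  | consBlock b u hu =>
    rw [renormComul_consBlock, h _ (h' _ _), mem_TPlus_iff.1 (consBlock_mem _ _), zero_smul]
  | consLetter b u hu =>
    rw [renormComul_consLetter, h _ (insertOp_mem _ _), mem_TPlus_iff.1 (consLetter_mem _ _),
      zero_smul]

/-- Now the term `consBlock` ⊗ `consLetter` dies. The correction coming from `mulLetter` is a
multiple of `consLetter` applied to 1, hence zero. -/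
lemma renormCounit_right (u : TT k B) :
    TensorProduct.map .id (renormCounit k B).toLinearMap (renormComul k B u) = u ⊗ₜ 1 := by
  have hB : ∀ x : B, TensorProduct.map .id Coalgebra.counit (Coalgebra.comul x) =
      x ⊗ₜ[k] (1 : k) := Coalgebra.lTensor_counit_comul
  have h0 : ∀ b u, (renormCounit k B).toLinearMap (consBlock b u) =
      LinearMap.mul k k (Coalgebra.counit b) ((renormCounit k B).toLinearMap u) :=
    renormCounit_consBlock
  have h1 : ∀ b u, (renormCounit k B).toLinearMap (consLetter b u) =
      (0 : B →ₗ[k] Module.End k k) (LinearMap.id (R := k) b) ((renormCounit k B).toLinearMap u) :=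
    renormCounit_consLetter
  have hid : ∀ (F : B →ₗ[k] Module.End k (TT k B)) b u, LinearMap.id (R := k) (F b u) =
    F (LinearMap.id (R := k) b) (LinearMap.id (R := k) u) := fun _ _ _ => rfl
  have h2 : ∀ (s : B ⊗[k] B) (w : TT k B ⊗[k] TT k B),
      TensorProduct.map .id (renormCounit k B).toLinearMap (twist consLetter mulLetter s w) =
      twist consLetter (LinearMap.mul k k) (TensorProduct.map .id Coalgebra.counit s)
        (TensorProduct.map .id (renormCounit k B).toLinearMap w -
          TensorProduct.map .id TensorAlgebra.algebraMapInv.toLinearMap w) := by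
    intro s w
    induction w with
    | zero => simp
    | add a b ha hb => simp only [map_add, ha, hb, map_sub]; abel
    | tmul u v =>
      induction s with
      | zero => simp
      | add a b ha hb => simp only [map_add, LinearMap.add_apply, ha, hb]
      | tmul b c =>
        simp [renormCounit_mulLetter, ← TensorProduct.tmul_sub, mul_sub]
  induction u using TT_induction with
  | one => simp [Algebra.TensorProduct.one_def]
  | add u v hu hv => simp only [map_add, hu, hv, TensorProduct.add_tmul]
  | smul c u hu => simp only [map_smul, hu, TensorProduct.smul_tmul']
  | consBlock b u hu =>
    rw [renormComul_consBlock, map_twist _ _ _ _ (hid _) h0, hu, hB]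
    simp
  | consLetter b u hu =>
    rw [renormComul_consLetter, insertOp, LinearMap.add_apply, LinearMap.add_apply, map_add,
      map_twist _ _ _ _ (hid _) h1, h2, hu, hB, renormComul_algebraMapInv]
    simp [twist]

variable (k B) in
lemma isBialgebra_TT : IsBialgebra (renormComul k B) (renormCounit k B) where
  coassoc := AlgHom.ext renormComul_coassoc
  counit_left := AlgHom.ext renormCounit_left
  counit_right := AlgHom.ext renormCounit_right

end Coproduct

/-! ### Biideals generated by the relations `(x) = ε(x)` -/

/-- Modulo I the element j x becomes the scalar ε(x), so (q ⊗ q)Δ(j x) is (ε ⊗ ε)δ(x) = ε(x). The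
kernels of ε and of (q ⊗ q)Δ are therefore two-sided ideals containing the generators. Stating
minimality as `hle` covers both J and J'. -/
lemma isCoideal_of_le {k A B : Type*} [Field k] [Ring A] [Bialgebra k A] [AddCommGroup B]
    [Module k B] [Coalgebra k B] (j : B →ₗ[k] A)
    (hcomul : ∀ x, (Coalgebra.comul (j x) : A ⊗[k] A) = TensorProduct.map j j (Coalgebra.comul x))
    (hcounit : ∀ x, (Coalgebra.counit (j x) : k) = Coalgebra.counit x)
    (I : Ideal A) [I.IsTwoSided]
    (hmem : ∀ x, j x - algebraMap k A (Coalgebra.counit x) ∈ I)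
    (hle : ∀ K : Ideal A, K.IsTwoSided →
      (∀ x, j x - algebraMap k A (Coalgebra.counit x) ∈ K) → I ≤ K) :
    (I.restrictScalars k).IsCoideal := by
  constructor
  · intro a ha
    refine hle (RingHom.ker (Bialgebra.counitAlgHom k A)) inferInstance (fun x => ?_) ha
    simp [RingHom.mem_ker, hcounit]
  · intro a ha
    let q := Ideal.Quotient.mkₐ k I
    refine hle (RingHom.ker ((Algebra.TensorProduct.map q q).comp (Bialgebra.comulAlgHom k A)))
      inferInstance (fun x => ?_) ha
    have hq : q.toLinearMap ∘ₗ j = Algebra.linearMap k (A ⧸ I) ∘ₗ Coalgebra.counit := by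
      ext x
      have := Ideal.Quotient.eq_zero_iff_mem.2 (hmem x)
      rw [map_sub, sub_eq_zero] at this
      exact this
    have h1 : TensorProduct.map q.toLinearMap q.toLinearMap
        (TensorProduct.map j j (Coalgebra.comul x)) =
        algebraMap k _ (Coalgebra.counit x) := by
      rw [← LinearMap.comp_apply, ← TensorProduct.map_comp, hq, TensorProduct.map_comp,
        LinearMap.comp_apply]
      have h2 : TensorProduct.map Coalgebra.counit Coalgebra.counit (Coalgebra.comul x) =
          (Coalgebra.counit x : k) ⊗ₜ[k] (1 : k) := by
        have h3 : TensorProduct.map (Coalgebra.counit (R := k) (A := B))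
            (Coalgebra.counit (R := k) (A := B)) =
            TensorProduct.map Coalgebra.counit .id ∘ₗ TensorProduct.map .id Coalgebra.counit := by
          rw [← TensorProduct.map_comp]; rfl
        have h4 : TensorProduct.map .id Coalgebra.counit (Coalgebra.comul x) =
          x ⊗ₜ[k] (1 : k) := Coalgebra.lTensor_counit_comul x
        rw [h3, LinearMap.comp_apply, h4]; rfl
      rw [h2]
      simp [Algebra.TensorProduct.algebraMap_apply]
    rw [RingHom.mem_ker, map_sub, AlgHom.commutes, sub_eq_zero, ← h1, ← hcomul]
    rfl

/-! ### Rescaling by the degree -/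

section Scale

variable {k B : Type*} [Field k] [AddCommGroup B] [Module k B]

lemma ι_mem_degTPlus {𝒜 : ℕ → Submodule k B} {d : ℕ} {x : B} (hx : x ∈ 𝒜 d) :
    (⟨TensorAlgebra.ι k x, ι_mem_TPlus k x⟩ : TPlus k B) ∈ degTPlus 𝒜 d :=
  Submodule.subset_span ⟨0, fun _ => x, fun _ => d, fun _ => hx, by simp,
    by simp [TensorAlgebra.tprod_apply]⟩

lemma lift_mem_TPlus (p : B →ₗ[k] B) {a : TensorAlgebra k B} (ha : a ∈ TPlus k B) :
    TensorAlgebra.lift k ((2 : k) • TensorAlgebra.ι k ∘ₗ p) a ∈ TPlus k B := by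
  have h : TensorAlgebra.algebraMapInv.comp (TensorAlgebra.lift k
      ((2 : k) • TensorAlgebra.ι k ∘ₗ p)) = TensorAlgebra.algebraMapInv := by
    ext x; simp
  rw [mem_TPlus_iff, ← AlgHom.comp_apply, h, mem_TPlus_iff.1 ha]

/-- The linear map `(x₁, …, xₙ) ↦ 2ⁿ⁻¹ (p x₁, …, p xₙ)` of `T(B)⁺`. -/
def scaleTPlus (p : B →ₗ[k] B) : Module.End k (TPlus k B) :=
  (2 : k)⁻¹ • LinearMap.restrict
    (TensorAlgebra.lift k ((2 : k) • TensorAlgebra.ι k ∘ₗ p)).toLinearMap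
    fun _ ha => lift_mem_TPlus p ha

lemma coe_scaleTPlus (p : B →ₗ[k] B) (a : TPlus k B) :
    (scaleTPlus p a : TensorAlgebra k B) =
      (2 : k)⁻¹ • TensorAlgebra.lift k ((2 : k) • TensorAlgebra.ι k ∘ₗ p) a := rfl

variable [CharZero k]

lemma scaleTPlus_ι (p : B →ₗ[k] B) (x : B) :
    scaleTPlus p ⟨TensorAlgebra.ι k x, ι_mem_TPlus k x⟩ =
      ⟨TensorAlgebra.ι k (p x), ι_mem_TPlus k (p x)⟩ := by
  ext; simp [coe_scaleTPlus]

lemma scaleTPlus_ι_mul (p : B →ₗ[k] B) (x : B) (a : TPlus k B) :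
    scaleTPlus p ⟨TensorAlgebra.ι k x * a, ι_mul_mem_TPlus x _⟩ =
      (2 : k) • ⟨TensorAlgebra.ι k (p x) * scaleTPlus p a, ι_mul_mem_TPlus _ _⟩ := by
  ext; simp [coe_scaleTPlus]

lemma coe_scaleTPlus_tprod (p : B →ₗ[k] B) {n : ℕ} (x : Fin (n + 1) → B) {a : TPlus k B}
    (ha : (a : TensorAlgebra k B) = TensorAlgebra.tprod k B (n + 1) x) :
    (scaleTPlus p a : TensorAlgebra k B) =
      (2 : k) ^ n • TensorAlgebra.tprod k B (n + 1) (fun i => p (x i)) := by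
  have h : TensorAlgebra.lift k ((2 : k) • TensorAlgebra.ι k ∘ₗ p)
      (TensorAlgebra.tprod k B (n + 1) x) =
      TensorAlgebra.tprod k B (n + 1) (fun i => (2 : k) • p (x i)) := by
    rw [TensorAlgebra.tprod_apply, TensorAlgebra.tprod_apply, map_list_prod, List.map_ofFn]
    congr 2
    ext i
    simp
  rw [coe_scaleTPlus, ha, h, MultilinearMap.map_smul_univ, Finset.prod_const, Finset.card_univ,
    Fintype.card_fin, smul_smul, pow_succ', inv_mul_cancel_left₀ two_ne_zero]

lemma degTPlus_le_eigenspace {𝒜 : ℕ → Submodule k B} {p : B →ₗ[k] B}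
    (hp : ∀ d, ∀ x ∈ 𝒜 d, p x = (2 : k) ^ d • x) (d : ℕ) :
    degTPlus 𝒜 d ≤ Module.End.eigenspace (scaleTPlus p) (2 ^ d) := by
  refine Submodule.span_le.2 ?_
  rintro a ⟨n, x, e, hx, hd, ha⟩
  rw [SetLike.mem_coe, Module.End.mem_eigenspace_iff]
  ext
  rw [coe_scaleTPlus_tprod p x ha, Submodule.coe_smul, ha]
  have : (fun i => p (x i)) = fun i => (2 : k) ^ e i • x i := funext fun i => hp _ _ (hx i)
  rw [this, MultilinearMap.map_smul_univ, smul_smul, Finset.prod_pow_eq_pow_sum, ← pow_add,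
    add_comm, hd]

end Scale

/-! ### The degree on algebras generated by `T(B)⁺` -/

section Degree

variable {k B : Type*} [Field k] [AddCommGroup B] [Module k B] {𝒜 : ℕ → Submodule k B}

lemma ι_mul_mem_degTPlus {d e : ℕ} {x : B} (hx : x ∈ 𝒜 e) {a : TPlus k B} (ha : a ∈ degTPlus 𝒜 d) :
    (⟨TensorAlgebra.ι k x * a, ι_mul_mem_TPlus x _⟩ : TPlus k B) ∈ degTPlus 𝒜 (e + d + 1) := by
  induction ha using Submodule.span_induction with
  | zero => convert zero_mem (degTPlus 𝒜 (e + d + 1)); simp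
  | add a b _ _ ha hb => convert add_mem ha hb; simp [mul_add]
  | smul c a _ ha => convert Submodule.smul_mem _ c ha; simp
  | mem a ha =>
    obtain ⟨n, y, f, hy, hd, ha⟩ := ha
    refine Submodule.subset_span ⟨n + 1, Fin.cons x y, Fin.cons e f, fun i => ?_, ?_, ?_⟩
    · refine Fin.cases ?_ (fun i => ?_) i
      · simpa using hx
      · simpa using hy i
    · rw [Fin.sum_cons]; omega
    · rw [tprod_cons, ha]

lemma iSup_degTPlus (h𝒜 : ⨆ d, 𝒜 d = ⊤) : ⨆ d, degTPlus 𝒜 d = ⊤ := by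
  have htop : ∀ x : B, x ∈ ⨆ d, 𝒜 d := fun x => h𝒜 ▸ Submodule.mem_top
  have key : ∀ a ∈ TPlus k B, a ∈ (⨆ d, degTPlus 𝒜 d).map (TPlus k B).subtype := by
    intro a ha
    refine TPlus_induction (P := fun a => a ∈ (⨆ d, degTPlus 𝒜 d).map (TPlus k B).subtype)
      (fun x => ?_) (fun a b ha hb => add_mem ha hb) (fun c a ha => Submodule.smul_mem _ _ ha)
      (fun x a hmem ha => ?_) ha
    · induction htop x using Submodule.iSup_induction' with
      | zero => simp
      | add x y _ _ hx hy => rw [map_add]; exact add_mem hx hy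
      | mem d x hx => exact ⟨_, Submodule.mem_iSup_of_mem d (ι_mem_degTPlus hx), rfl⟩
    · clear hmem
      obtain ⟨a, ha, rfl⟩ := ha
      induction htop x using Submodule.iSup_induction' with
      | zero => simp
      | add x y _ _ hx hy => rw [map_add, add_mul]; exact add_mem hx hy
      | mem e x hx =>
        induction ha using Submodule.iSup_induction' with
        | zero => simp
        | add a b _ _ ha hb => rw [map_add, mul_add]; exact add_mem ha hb
        | mem d a ha => exact ⟨_, Submodule.mem_iSup_of_mem _ (ι_mul_mem_degTPlus hx ha), rfl⟩
  rw [eq_top_iff]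
  rintro ⟨a, ha⟩ -
  obtain ⟨b, hb, hab⟩ := key a ha
  obtain rfl : b = ⟨a, ha⟩ := Subtype.ext hab
  exact hb

/-- A word of length n + 1 has degree at least n, so only single letters remain in degree 0.
Counting n - 1 in the degree is what makes the quotients connected. -/
lemma mem_degTPlus_zero {a : TPlus k B} (ha : a ∈ degTPlus 𝒜 0) :
    ∃ x : B, a = ⟨TensorAlgebra.ι k x, ι_mem_TPlus k x⟩ := by
  induction ha using Submodule.span_induction with
  | zero => exact ⟨0, by ext; simp⟩
  | add a b _ _ ha hb =>
    obtain ⟨x, rfl⟩ := ha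
    obtain ⟨y, rfl⟩ := hb
    exact ⟨x + y, by ext; simp⟩
  | smul c a _ ha =>
    obtain ⟨x, rfl⟩ := ha
    exact ⟨c • x, by ext; simp⟩
  | mem a ha =>
    obtain ⟨n, x, e, -, hn, ha⟩ := ha
    obtain rfl : n = 0 := by omega
    exact ⟨x 0, by ext; simp [ha, TensorAlgebra.tprod_apply]⟩

variable {A : Type*} [Ring A] [Algebra k A] (j : TPlus k B →ₗ[k] A)

lemma one_mem_degAlg : (1 : A) ∈ degAlg 𝒜 j 0 :=
  Submodule.subset_span ⟨0, Fin.elim0, Fin.elim0, fun i => i.elim0, by simp, by simp⟩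

lemma mem_degAlg {d : ℕ} {a : TPlus k B} (ha : a ∈ degTPlus 𝒜 d) : j a ∈ degAlg 𝒜 j d :=
  Submodule.subset_span ⟨1, fun _ => a, fun _ => d, fun _ => ha, by simp, by simp⟩

lemma mul_mem_degAlg {d e : ℕ} {u v : A} (hu : u ∈ degAlg 𝒜 j d) (hv : v ∈ degAlg 𝒜 j e) :
    u * v ∈ degAlg 𝒜 j (d + e) := by
  have h : degAlg 𝒜 j d * degAlg 𝒜 j e ≤ degAlg 𝒜 j (d + e) := by
    rw [degAlg, degAlg, Submodule.span_mul_span]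
    refine Submodule.span_le.2 ?_
    rintro _ ⟨_, ⟨m, a, f, ha, rfl, rfl⟩, _, ⟨n, b, g, hb, rfl, rfl⟩, rfl⟩
    refine Submodule.subset_span ⟨m + n, Fin.append a b, Fin.append f g, fun i => ?_, ?_, ?_⟩
    · refine Fin.addCases (fun i => ?_) (fun i => ?_) i
      · simpa using ha i
      · simpa using hb i
    · simp [Fin.sum_univ_add]
    · have : (fun i => j (Fin.append a b i)) = Fin.append (fun i => j (a i)) (fun i => j (b i)) := by
        ext i
        refine Fin.addCases (fun i => ?_) (fun i => ?_) i <;> simp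
      rw [this, List.ofFn_fin_append, List.prod_append]
  exact h (Submodule.mul_mem_mul hu hv)

lemma iSup_degAlg (h𝒜 : ⨆ d, 𝒜 d = ⊤) (hj : Algebra.adjoin k (Set.range j) = ⊤) :
    ⨆ d, degAlg 𝒜 j d = ⊤ := by
  refine Submodule.eq_top_iff'.2 fun u => ?_
  have hu : u ∈ Algebra.adjoin k (Set.range j) := hj ▸ Algebra.mem_top
  induction hu using Algebra.adjoin_induction with
  | algebraMap r =>
    rw [Algebra.algebraMap_eq_smul_one]
    exact Submodule.smul_mem _ _ (Submodule.mem_iSup_of_mem 0 (one_mem_degAlg j))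
  | add u v _ _ hu hv => exact add_mem hu hv
  | mem u hu =>
    obtain ⟨a, rfl⟩ := hu
    have ha : a ∈ ⨆ d, degTPlus 𝒜 d := iSup_degTPlus h𝒜 ▸ Submodule.mem_top
    induction ha using Submodule.iSup_induction' with
    | zero => simp
    | add a b _ _ ha hb => rw [map_add]; exact add_mem ha hb
    | mem d a ha => exact Submodule.mem_iSup_of_mem d (mem_degAlg j ha)
  | mul u v hu' hv' hu hv =>
    clear hu' hv'
    induction hu using Submodule.iSup_induction' with
    | zero => simp
    | add a b _ _ ha hb => rw [add_mul]; exact add_mem ha hb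
    | mem d u hu =>
      induction hv using Submodule.iSup_induction' with
      | zero => simp
      | add a b _ _ ha hb => rw [mul_add]; exact add_mem ha hb
      | mem e v hv => exact Submodule.mem_iSup_of_mem _ (mul_mem_degAlg j hu hv)

/-- A product of degree 0 has all its factors in degree 0; these are letters, which q sends to
scalars. -/
lemma map_degAlg_zero_le {A' : Type*} [Ring A'] [Algebra k A'] (q : A →ₐ[k] A')
    (hq : ∀ x : B, q (j ⟨TensorAlgebra.ι k x, ι_mem_TPlus k x⟩) ∈ (⊥ : Subalgebra k A')) :
    (degAlg 𝒜 j 0).map q.toLinearMap ≤ Submodule.span k {(1 : A')} := by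
  rw [← Submodule.one_eq_span, ← Algebra.toSubmodule_bot, degAlg, Submodule.map_span,
    Submodule.span_le]
  rintro _ ⟨_, ⟨m, a, e, ha, he, rfl⟩, rfl⟩
  rw [SetLike.mem_coe, Subalgebra.mem_toSubmodule, AlgHom.toLinearMap_apply, map_list_prod]
  refine Subalgebra.list_prod_mem _ fun y hy => ?_
  rw [List.map_ofFn, List.mem_ofFn] at hy
  obtain ⟨i, rfl⟩ := hy
  have hi : e i = 0 := by simpa using Finset.sum_eq_zero_iff.1 he i (Finset.mem_univ i)
  obtain ⟨x, hx⟩ := mem_degTPlus_zero (hi ▸ ha i)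
  rw [Function.comp_apply, hx]
  exact hq x

lemma degAlg_le_eigenspace [CharZero k] {p : B →ₗ[k] B}
    (hp : ∀ d, ∀ x ∈ 𝒜 d, p x = (2 : k) ^ d • x) (φ : A →ₐ[k] A)
    (hφ : ∀ a, φ (j a) = j (scaleTPlus p a)) (d : ℕ) :
    degAlg 𝒜 j d ≤ Module.End.eigenspace φ.toLinearMap (2 ^ d) := by
  refine Submodule.span_le.2 ?_
  rintro _ ⟨m, a, e, ha, rfl, rfl⟩
  rw [SetLike.mem_coe, Module.End.mem_eigenspace_iff, AlgHom.toLinearMap_apply]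
  have h1 : φ (List.ofFn fun i => j (a i)).prod =
      MultilinearMap.mkPiAlgebraFin k m A (fun i => (2 : k) ^ e i • j (a i)) := by
    rw [map_list_prod, List.map_ofFn, MultilinearMap.mkPiAlgebraFin_apply]
    congr 2
    ext i
    have := Module.End.mem_eigenspace_iff.1 (degTPlus_le_eigenspace hp _ (ha i))
    rw [Function.comp_apply, hφ, this, map_smul]
  rw [h1, MultilinearMap.map_smul_univ, MultilinearMap.mkPiAlgebraFin_apply,
    Finset.prod_pow_eq_pow_sum]

end Degree

/-- Common to both cases, with j the inclusion of generators into T(T(B)⁺) or into S(S(B)⁺). The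
rescaling φ preserves I, so it descends to the quotient and acts there as 2^d in degree d. -/
lemma isConnectedGradedBialgebra_degQuotient {k A B : Type*} [Field k] [CharZero k]
    [AddCommGroup B] [Module k B] {𝒜 : ℕ → Submodule k B} (h𝒜 : ⨆ d, 𝒜 d = ⊤)
    {p : B →ₗ[k] B} (hp : ∀ d, ∀ x ∈ 𝒜 d, p x = (2 : k) ^ d • x)
    [Ring A] [Bialgebra k A] (j : TPlus k B →ₗ[k] A) (hj : Algebra.adjoin k (Set.range j) = ⊤)
    (φ : A →ₐ[k] A) (hφ : ∀ a, φ (j a) = j (scaleTPlus p a))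
    (hcounit : ∀ a, (Coalgebra.counit (φ a) : k) = Coalgebra.counit a)
    (hcomul : ∀ a, (Coalgebra.comul (φ a) : A ⊗[k] A) =
      TensorProduct.map φ.toLinearMap φ.toLinearMap (Coalgebra.comul a))
    (I : Ideal A) [I.IsTwoSided] [(I.restrictScalars k).IsCoideal] (hI : ∀ a ∈ I, φ a ∈ I)
    (hι : ∀ x : B, ∃ c : k,
      j ⟨TensorAlgebra.ι k x, ι_mem_TPlus k x⟩ - algebraMap k A c ∈ I) :
    IsConnectedGradedBialgebra (degQuotient (degAlg 𝒜 j) I) := by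
  have hmk : ∀ a ∈ I, ((Ideal.Quotient.mkₐ k I).comp φ) a = 0 := fun a ha =>
    Ideal.Quotient.eq_zero_iff_mem.2 (hI a ha)
  let φ' : (A ⧸ I) →ₐ[k] A ⧸ I := Ideal.Quotient.liftₐ I ((Ideal.Quotient.mkₐ k I).comp φ) hmk
  have hφ' : ∀ a, φ' (Ideal.Quotient.mk I a) = Ideal.Quotient.mk I (φ a) := fun a => rfl
  refine isConnectedGradedBialgebra_of_le_eigenspace φ' (fun a => ?_) (fun a => ?_)
    (fun d => ?_) ?_ (map_degAlg_zero_le j _ fun x => ?_)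
  · obtain ⟨a, rfl⟩ := Ideal.Quotient.mk_surjective a
    rw [hφ', Bialgebra.Quotient.counit_mk, Bialgebra.Quotient.counit_mk, hcounit]
  · obtain ⟨a, rfl⟩ := Ideal.Quotient.mk_surjective a
    rw [hφ', Bialgebra.Quotient.comul_mk, Bialgebra.Quotient.comul_mk, hcomul]
    generalize (Coalgebra.comul a : A ⊗[k] A) = w
    induction w with
    | zero => simp
    | add a b ha hb => simp only [map_add, ha, hb]
    | tmul a b => rfl
  · rintro _ ⟨a, ha, rfl⟩
    have := Module.End.mem_eigenspace_iff.1 (degAlg_le_eigenspace j hp φ hφ d ha)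
    rw [AlgHom.toLinearMap_apply] at this
    rw [Module.End.mem_eigenspace_iff]
    change φ' (Ideal.Quotient.mk I a) = _
    rw [hφ', this]
    exact map_smul (Ideal.Quotient.mkₐ k I) _ a
  · simp only [degQuotient]
    rw [← Submodule.map_iSup, iSup_degAlg j h𝒜 hj, Submodule.map_top, LinearMap.range_eq_top]
    exact Ideal.Quotient.mk_surjective
  · obtain ⟨c, hc⟩ := hι x
    refine Algebra.mem_bot.2 ⟨c, ?_⟩
    have := Ideal.Quotient.eq_zero_iff_mem.2 hc
    rw [map_sub, sub_eq_zero] at this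
    exact this.symm

/-! ### Gradings of `B` -/

section Grading

variable {k B : Type*} [Field k] [NonUnitalRing B] [Module k B]
    [IsScalarTower k B B] [SMulCommClass k B B] [NonUnitalBialgebra k B]

/-- The trivial grading. -/
def trivialGrading (k B : Type*) [Field k] [AddCommGroup B] [Module k B] (d : ℕ) :
    Submodule k B := if d = 0 then ⊤ else ⊥

/-- Needed for the antipode: the quotient is connected even with B in degree 0. The rescaling
operator here is the identity. -/
lemma isGraded_trivialGrading [CharZero k] : IsGradedNonUnitalBialgebra (trivialGrading k B) := by
  have htop : ⨆ d, trivialGrading k B d = ⊤ :=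
    eq_top_iff.2 (le_iSup_of_le 0 (by simp [trivialGrading]))
  have hle : ∀ d, trivialGrading k B d ≤
      Module.End.eigenspace (LinearMap.id : Module.End k B) (2 ^ d) := by
    intro d x hx
    rw [Module.End.mem_eigenspace_iff]
    rcases eq_or_ne d 0 with rfl | hd
    · simp
    · obtain rfl : x = 0 := by simpa [trivialGrading, hd] using hx
      simp
  refine ⟨⟨isInternal_of_le_eigenspace LinearMap.id hle htop, fun n x hx => ?_,
    fun n hn x hx => ?_⟩, fun i j x hx y hy => ?_⟩
  · rw [eq_eigenspace_of_le_eigenspace _ (range_map_subtype_le_eigenspace _ hle)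
      (iSup_range_map_subtype_eq_top htop) n, Module.End.mem_eigenspace_iff, TensorProduct.map_id]
    rw [LinearMap.id_apply, ← map_smul]
    exact congrArg _ (Module.End.mem_eigenspace_iff.1 (hle n hx))
  · obtain rfl : x = 0 := by simpa [trivialGrading, hn] using hx
    simp
  · rcases eq_or_ne i 0 with rfl | hi
    · rcases eq_or_ne j 0 with rfl | hj
      · simp [trivialGrading]
      · obtain rfl : y = 0 := by simpa [trivialGrading, hj] using hy
        simp
    · obtain rfl : x = 0 := by simpa [trivialGrading, hi] using hx
      simp

/-- For a grading of `B` there is a bialgebra endomorphism acting on degree `d` as `2 ^ d`. -/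
lemma exists_scale {𝒜 : ℕ → Submodule k B} (h : IsGradedNonUnitalBialgebra 𝒜) :
    ∃ p : B →ₗ[k] B, (∀ d, ∀ x ∈ 𝒜 d, p x = (2 : k) ^ d • x) ∧
      (∀ x y, p (x * y) = p x * p y) ∧
      (∀ x, (Coalgebra.counit (p x) : k) = Coalgebra.counit x) ∧
      (∀ x, (Coalgebra.comul (p x) : B ⊗[k] B) = TensorProduct.map p p (Coalgebra.comul x)) := by
  let e := LinearEquiv.ofBijective (DirectSum.coeLinearMap 𝒜) h.isInternal
  let p : B →ₗ[k] B :=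
    DirectSum.toModule k ℕ B (fun n => (2 : k) ^ n • (𝒜 n).subtype) ∘ₗ e.symm.toLinearMap
  have hp : ∀ d, ∀ x ∈ 𝒜 d, p x = (2 : k) ^ d • x := by
    intro n x hx
    have : e.symm x = DirectSum.lof k ℕ (fun n => 𝒜 n) n ⟨x, hx⟩ := by
      rw [LinearEquiv.symm_apply_eq]
      exact (DirectSum.coeLinearMap_lof 𝒜 n ⟨x, hx⟩).symm
    simp only [p, LinearMap.comp_apply, LinearEquiv.coe_coe, this, DirectSum.toModule_lof]
    rfl
  have htop : ∀ x : B, x ∈ ⨆ d, 𝒜 d := fun x =>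
    h.isInternal.submodule_iSup_eq_top ▸ Submodule.mem_top
  have hle : ∀ d, 𝒜 d ≤ Module.End.eigenspace p (2 ^ d) := fun d x hx =>
    Module.End.mem_eigenspace_iff.2 (hp d x hx)
  refine ⟨p, hp, fun x y => ?_, fun x => ?_, fun x => ?_⟩
  · induction htop x using Submodule.iSup_induction' with
    | zero => simp
    | add a b _ _ ha hb => simp only [add_mul, map_add, ha, hb]
    | mem i x hx =>
      induction htop y using Submodule.iSup_induction' with
      | zero => simp
      | add a b _ _ ha hb => simp only [mul_add, map_add, ha, hb]
      | mem j y hy =>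
        rw [hp _ _ hx, hp _ _ hy, hp _ _ (h.mul_mem i j x hx y hy), smul_mul_smul_comm, pow_add]
  · induction htop x using Submodule.iSup_induction' with
    | zero => simp
    | add a b _ _ ha hb => simp only [map_add, ha, hb]
    | mem i x hx =>
      rw [hp _ _ hx]
      rcases eq_or_ne i 0 with rfl | hi
      · simp
      · rw [map_smul, h.counit_eq_zero i hi x hx, smul_zero]
  · induction htop x using Submodule.iSup_induction' with
    | zero => simp
    | add a b _ _ ha hb => simp only [map_add, ha, hb]
    | mem i x hx =>
      have := Module.End.mem_eigenspace_iff.1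
        (range_map_subtype_le_eigenspace p hle i (h.comul_mem i x hx))
      rw [hp _ _ hx, map_smul, this]

end Grading

/-! ### The rescaling of `T(T(B)⁺)` -/

section ScaleTT

variable {k B : Type*} [Field k] [AddCommGroup B] [Module k B]

/-- The algebra endomorphism of `T(T(B)⁺)` extending `scaleTPlus p`. -/
def scaleTT (p : B →ₗ[k] B) : TT k B →ₐ[k] TT k B :=
  TensorAlgebra.lift k (TensorAlgebra.ι k ∘ₗ scaleTPlus p)

lemma scaleTT_ι (p : B →ₗ[k] B) (a : TPlus k B) :
    scaleTT p (TensorAlgebra.ι k a) = TensorAlgebra.ι k (scaleTPlus p a) := by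
  simp [scaleTT]

variable [CharZero k]

lemma scaleTT_gen_ι (p : B →ₗ[k] B) (b : B) :
    scaleTT p (gen k B (TensorAlgebra.ι k b)) = gen k B (TensorAlgebra.ι k (p b)) := by
  rw [gen_of_mem (ι_mem_TPlus k b), scaleTT_ι, scaleTPlus_ι, gen_of_mem (ι_mem_TPlus k _)]

lemma scaleTT_consBlock (p : B →ₗ[k] B) (b : B) (u : TT k B) :
    scaleTT p (consBlock b u) = consBlock (p b) (scaleTT p u) := by
  rw [consBlock_apply, map_mul (scaleTT p), scaleTT_gen_ι, consBlock_apply]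

/-- The extra factor 2 records the degree gained when a block becomes one letter longer. -/
lemma scaleTT_consLetter (p : B →ₗ[k] B) (b : B) (u : TT k B) :
    scaleTT p (consLetter b u) = consLetter ((2 : k) • p b) (scaleTT p u) := by
  induction u using tensorAlgebra_induction_left with
  | one => simp
  | add a b ha hb => simp only [map_add, ha, hb]
  | smul c a ha => simp only [map_smul, ha]
  | ι_mul v u hu =>
    rw [← gen_coe, consLetter_gen_mul _ v.2, map_mul (scaleTT p), map_mul (scaleTT p),
      gen_of_mem (ι_mul_mem_TPlus _ _), scaleTT_ι, scaleTPlus_ι_mul, gen_coe, scaleTT_ι, ← gen_coe,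
      ← gen_coe, consLetter_gen_mul _ (scaleTPlus p v).2]
    simp

end ScaleTT

section

variable {k B : Type*} [Field k] [CharZero k] [NonUnitalRing B] [Module k B]
  [IsScalarTower k B B] [SMulCommClass k B B] {p : B →ₗ[k] B}

lemma scaleTT_mulLetter (hmul : ∀ x y, p (x * y) = p x * p y) (b : B) (u : TT k B) :
    scaleTT p (mulLetter b u) = mulLetter (p b) (scaleTT p u) := by
  suffices h : (scaleTT p).toLinearMap ∘ₗ mulLetter b =
      mulLetter (p b) ∘ₗ (scaleTT p).toLinearMap from LinearMap.congr_fun h u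
  refine TT_linearMap_ext (by simp) (fun c u _ => ?_) (fun c u _ => ?_)
  · simp only [LinearMap.comp_apply, AlgHom.toLinearMap_apply, mulLetter_consBlock,
      scaleTT_consBlock, hmul]
  · simp only [LinearMap.comp_apply, AlgHom.toLinearMap_apply, mulLetter_consLetter,
      scaleTT_consLetter, hmul, mul_smul_comm]

variable [NonUnitalBialgebra k B]

lemma renormCounit_scaleTT (hcounit : ∀ x, (Coalgebra.counit (p x) : k) = Coalgebra.counit x)
    (u : TT k B) : renormCounit k B (scaleTT p u) = renormCounit k B u := by
  induction u using TT_induction with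
  | one => simp
  | add u v hu hv => simp only [map_add, hu, hv]
  | smul c u hu => simp only [map_smul, hu]
  | consBlock b u hu =>
    rw [scaleTT_consBlock, renormCounit_consBlock, renormCounit_consBlock, hu, hcounit]
  | consLetter b u hu =>
    rw [scaleTT_consLetter, renormCounit_consLetter, renormCounit_consLetter]

/-- The rescaling commutes with all three insertion operators, up to the factor 2 on `consLetter`,
which occurs once in each term of `insertOp`; so both sides obey the same recursion. -/
lemma renormComul_scaleTT (hmul : ∀ x y, p (x * y) = p x * p y)
    (hcomul : ∀ x, (Coalgebra.comul (p x) : B ⊗[k] B) =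
      TensorProduct.map p p (Coalgebra.comul x)) (u : TT k B) :
    renormComul k B (scaleTT p u) =
      TensorProduct.map (scaleTT p).toLinearMap (scaleTT p).toLinearMap (renormComul k B u) := by
  have h0 : ∀ b u, (scaleTT p).toLinearMap (consBlock b u) =
      consBlock (p b) ((scaleTT p).toLinearMap u) := scaleTT_consBlock p
  have h1 : ∀ b u, (scaleTT p).toLinearMap (consLetter b u) =
      consLetter ((2 : k) • p b) ((scaleTT p).toLinearMap u) := scaleTT_consLetter p
  have h2 : ∀ b u, (scaleTT p).toLinearMap (mulLetter b u) =
      mulLetter (p b) ((scaleTT p).toLinearMap u) := scaleTT_mulLetter hmul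
  induction u using TT_induction with
  | one => simp [Algebra.TensorProduct.one_def]
  | add u v hu hv => simp only [map_add, hu, hv]
  | smul c u hu => simp only [map_smul, hu]
  | consBlock b u hu =>
    rw [scaleTT_consBlock, renormComul_consBlock, renormComul_consBlock, hu, hcomul,
      map_twist p p _ _ h0 h0]
  | consLetter b u hu =>
    rw [scaleTT_consLetter, renormComul_consLetter, renormComul_consLetter, hu, map_smul, hcomul]
    exact (map_insert h0 h1 h2 _ _).symm

end

/-! ### The Hopf algebra `T(T(B)⁺) / J` -/

section Quotient

variable {k B : Type*} [Field k] [NonUnitalRing B] [Module k B]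
  [IsScalarTower k B B] [SMulCommClass k B B] [NonUnitalBialgebra k B]

lemma pinterIdeal_le {K : Ideal (TT k B)} (hK : K.IsTwoSided)
    (h : ∀ x : B, gen k B (TensorAlgebra.ι k x) - algebraMap k (TT k B) (Coalgebra.counit x) ∈ K) :
    pinterIdeal k B ≤ K := by
  intro a ha
  have : TwoSidedIdeal.span (Set.range fun x : B =>
      gen k B (TensorAlgebra.ι k x) - algebraMap k (TT k B) (Coalgebra.counit x)) ≤
      K.toTwoSided := by
    rw [TwoSidedIdeal.span_le]
    rintro _ ⟨x, rfl⟩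
    simpa using h x
  simpa using this (TwoSidedIdeal.mem_asIdeal.1 ha)

lemma sub_mem_pinterIdeal (x : B) :
    gen k B (TensorAlgebra.ι k x) - algebraMap k (TT k B) (Coalgebra.counit x) ∈
      pinterIdeal k B :=
  TwoSidedIdeal.mem_asIdeal.2 (TwoSidedIdeal.subset_span ⟨x, rfl⟩)

lemma isCoideal_pinterIdeal :
    letI : Bialgebra k (TT k B) := (isBialgebra_TT k B).toBialgebra
    ((pinterIdeal k B).restrictScalars k).IsCoideal := by
  let : Bialgebra k (TT k B) := (isBialgebra_TT k B).toBialgebra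
  refine isCoideal_of_le (gen k B ∘ₗ TensorAlgebra.ι k) (fun x => ?_) (fun x => ?_) _
    sub_mem_pinterIdeal fun K hK h => pinterIdeal_le hK h
  · rw [← comulOnTensor_ι]
    exact renormComul_gen (ι_mem_TPlus k x)
  · exact (renormCounit_gen (ι_mem_TPlus k x)).trans (by rw [TensorAlgebra.ι_leftInverse])

lemma isConnectedGradedBialgebra_TT [CharZero k] {𝒜 : ℕ → Submodule k B}
    (h : IsGradedNonUnitalBialgebra 𝒜) :
    letI : Bialgebra k (TT k B) := (isBialgebra_TT k B).toBialgebra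
    letI := isCoideal_pinterIdeal (k := k) (B := B)
    IsConnectedGradedBialgebra (degQuotient (degTT 𝒜) (pinterIdeal k B)) := by
  let : Bialgebra k (TT k B) := (isBialgebra_TT k B).toBialgebra
  have := isCoideal_pinterIdeal (k := k) (B := B)
  obtain ⟨p, hp, hmul, hcounit, hcomul⟩ := exists_scale h
  refine isConnectedGradedBialgebra_degQuotient h.isInternal.submodule_iSup_eq_top hp
    (TensorAlgebra.ι k) (TensorAlgebra.adjoin_range_ι) (scaleTT p) (scaleTT_ι p)
    (renormCounit_scaleTT hcounit) (renormComul_scaleTT hmul hcomul) _ (fun a ha => ?_)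
    fun x => ⟨_, gen_of_mem (ι_mem_TPlus k x) ▸ sub_mem_pinterIdeal x⟩
  refine pinterIdeal_le (K := (pinterIdeal k B).comap (scaleTT p)) inferInstance (fun x => ?_) ha
  -- As ε(x) = ε(p x), the rescaled relation for x is the relation for p x.
  rw [Ideal.mem_comap, map_sub, AlgHom.commutes, scaleTT_gen_ι, ← hcounit]
  exact sub_mem_pinterIdeal _

end Quotient

/-! ### Symmetric tensors -/

section Symm

variable {k B : Type*} [Field k] [AddCommGroup B] [Module k B]

lemma symmetrize_tprod {n : ℕ} (x : Fin n → B) :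
    symmetrize k B (TensorAlgebra.tprod k B n x) =
      ∑ σ : Equiv.Perm (Fin n), TensorAlgebra.tprod k B n (x ∘ σ) := by
  rw [symmetrize, liftComponents_tprod, PiTensorProduct.lift.tprod, sum_apply]
  rfl

lemma symmetrize_pow (x : B) (n : ℕ) :
    symmetrize k B (TensorAlgebra.ι k x ^ n) = n.factorial • TensorAlgebra.ι k x ^ n := by
  have h : TensorAlgebra.ι k x ^ n = TensorAlgebra.tprod k B n (fun _ => x) := by
    simp [TensorAlgebra.tprod_apply]
  rw [h, symmetrize_tprod]
  simp [Function.comp_def, Fintype.card_perm]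

lemma symmetrize_mem_TPlus {a : TensorAlgebra k B} (ha : a ∈ TPlus k B) :
    symmetrize k B a ∈ TPlus k B := by
  rw [TPlus_eq_span] at ha
  induction ha using Submodule.span_induction with
  | zero => simp
  | add a b _ _ ha hb => rw [map_add]; exact add_mem ha hb
  | smul c a _ ha => rw [map_smul]; exact Submodule.smul_mem _ _ ha
  | mem a ha =>
    obtain ⟨n, x, rfl⟩ := ha
    rw [symmetrize_tprod]
    exact Submodule.sum_mem _ fun σ _ => tprod_mem_TPlus n.succ_ne_zero _

variable (k B) in
/-- The symmetrizing operator of `T(B)⁺`. -/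
def symmetrizeTPlus : Module.End k (TPlus k B) :=
  (symmetrize k B).restrict fun _ => symmetrize_mem_TPlus

lemma coe_symmetrizeTPlus (a : TPlus k B) :
    (symmetrizeTPlus k B a : TensorAlgebra k B) = symmetrize k B a := rfl

lemma range_symmetrizeTPlus : LinearMap.range (symmetrizeTPlus k B) = SPlus k B := by
  ext a
  constructor
  · rintro ⟨b, rfl⟩
    exact ⟨b, b.2, rfl⟩
  · rintro ⟨b, hb, h⟩
    exact ⟨⟨b, hb⟩, Subtype.ext h⟩

lemma projPlus_symmetrize (a : TensorAlgebra k B) :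
    projPlus k B (symmetrize k B a) = symmetrizeTPlus k B (projPlus k B a) := by
  induction a using tensorAlgebra_induction_left with
  | one =>
    have : symmetrize k B 1 = 1 := by simpa using symmetrize_pow (k := k) (0 : B) 0
    simp [this]
  | add a b ha hb => simp only [map_add, ha, hb]
  | smul c a ha => simp only [map_smul, ha]
  | ι_mul x a _ =>
    have h := ι_mul_mem_TPlus x a
    rw [projPlus_of_mem h, projPlus_of_mem (symmetrize_mem_TPlus h)]
    rfl

/-- Inclusion-exclusion: the product over j of 1 + c_j, with c_j = 0 on the range of r and -1 off
it, is expanded over subsets S. A term survives only if S contains the range, and the product is 0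
as soon as some j is missed. -/
lemma sum_neg_one_pow_of_range_subset {n : ℕ} (r : Fin n → Fin n) :
    (∑ S : Finset (Fin n), if ∀ i, r i ∈ S then (-1 : k) ^ (Sᶜ).card else 0) =
      if Function.Surjective r then 1 else 0 := by
  classical
  have h := Finset.prod_add (fun _ => (1 : k))
    (fun j => if j ∈ Set.range r then (0 : k) else -1) (Finset.univ : Finset (Fin n))
  rw [Finset.powerset_univ] at h
  have h1 : ∏ j : Fin n, ((1 : k) + if j ∈ Set.range r then 0 else -1) =
      if Function.Surjective r then 1 else 0 := by
    split_ifs with hr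
    · exact Finset.prod_eq_one fun j _ => by simp [hr j]
    · obtain ⟨j, hj⟩ := not_forall.1 hr
      exact Finset.prod_eq_zero (Finset.mem_univ j) (by simp [show ¬ ∃ y, r y = j from hj])
  rw [← h1, h]
  refine Finset.sum_congr rfl fun S _ => ?_
  rw [Finset.prod_const_one, one_mul, ← Finset.compl_eq_univ_sdiff]
  split_ifs with hS
  · rw [Finset.prod_congr rfl (g := fun _ => (-1 : k)), Finset.prod_const]
    intro j hj
    rw [if_neg]
    rintro ⟨i, rfl⟩
    exact Finset.mem_compl.1 hj (hS i)
  · obtain ⟨i, hi⟩ := not_forall.1 hS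
    exact (Finset.prod_eq_zero (Finset.mem_compl.2 hi) (by simp)).symm

/-- Polarization: the symmetrization of `(x₁, …, xₙ)` as a combination of `n`-th powers. -/
lemma symmetrize_tprod_eq_sum_pow {n : ℕ} (x : Fin n → B) :
    symmetrize k B (TensorAlgebra.tprod k B n x) =
      ∑ S : Finset (Fin n), (-1 : k) ^ (Sᶜ).card • TensorAlgebra.ι k (∑ i ∈ S, x i) ^ n := by
  classical
  have h1 : ∀ S : Finset (Fin n), TensorAlgebra.ι k (∑ i ∈ S, x i) ^ n =
      ∑ r : Fin n → Fin n, if ∀ i, r i ∈ S then TensorAlgebra.tprod k B n (x ∘ r) else 0 := by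
    intro S
    have := (TensorAlgebra.tprod k B n).map_sum_finset (fun _ i => x i) (fun _ => S)
    rw [← Finset.sum_filter]
    convert this using 1
    · simp [TensorAlgebra.tprod_apply]
    · refine Finset.sum_congr ?_ fun _ _ => rfl
      ext r; simp
  simp only [h1, Finset.smul_sum, smul_ite, smul_zero]
  rw [Finset.sum_comm, symmetrize_tprod]
  -- After exchanging the sums, only surjective r survive, and these are the permutations.
  have h2 : ∀ r : Fin n → Fin n, (∑ S : Finset (Fin n), if ∀ i, r i ∈ S then
      (-1 : k) ^ (Sᶜ).card • TensorAlgebra.tprod k B n (x ∘ r) else 0) =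
      if Function.Surjective r then TensorAlgebra.tprod k B n (x ∘ r) else 0 := by
    intro r
    have := congrArg (· • TensorAlgebra.tprod k B n (x ∘ r))
      (sum_neg_one_pow_of_range_subset (k := k) r)
    simpa only [Finset.sum_smul, ite_smul, one_smul, zero_smul] using this
  simp only [h2]
  rw [← Finset.sum_filter]
  refine Finset.sum_bij (fun σ _ => σ) (fun σ _ => by simp [σ.surjective])
    (fun σ _ τ _ h => DFunLike.coe_injective h) (fun r hr => ?_) fun _ _ => rfl
  exact ⟨Equiv.ofBijective r (Finite.surjective_iff_bijective.1 (Finset.mem_filter.1 hr).2),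
    Finset.mem_univ _, rfl⟩

/-- Polarization reduces the stability of S(S(B)⁺) under Δ to powers of one letter, whose coproducts
have an explicit recursion. -/
lemma SPlus_le_span_pow : SPlus k B ≤ Submodule.span k
    {a : TPlus k B | ∃ (x : B) (n : ℕ), (a : TensorAlgebra k B) = TensorAlgebra.ι k x ^ (n + 1)} := by
  have key : ∀ a ∈ TPlus k B, symmetrize k B a ∈ (Submodule.span k {a : TPlus k B |
      ∃ (x : B) (n : ℕ), (a : TensorAlgebra k B) = TensorAlgebra.ι k x ^ (n + 1)}).map
        (TPlus k B).subtype := by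
    intro a ha
    rw [TPlus_eq_span] at ha
    induction ha using Submodule.span_induction with
    | zero => simp
    | add a b _ _ ha hb => rw [map_add]; exact add_mem ha hb
    | smul c a _ ha => rw [map_smul]; exact Submodule.smul_mem _ _ ha
    | mem a ha =>
      obtain ⟨n, x, rfl⟩ := ha
      rw [symmetrize_tprod_eq_sum_pow]
      refine Submodule.sum_mem _ fun S _ => Submodule.smul_mem _ _ ?_
      exact ⟨⟨TensorAlgebra.ι k (∑ i ∈ S, x i) ^ (n + 1),
        by rw [pow_succ']; exact ι_mul_mem_TPlus _ _⟩, Submodule.subset_span ⟨_, n, rfl⟩, rfl⟩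
  rintro ⟨a, ha⟩ ⟨b, hb, h⟩
  obtain ⟨c, hc, hc'⟩ := key b hb
  obtain rfl : c = ⟨a, ha⟩ := Subtype.ext (hc'.trans h)
  exact hc

/-- Symmetrization of a product of elements of `C ⊗ B` in `C ⊗ T(B)`, for commutative `C`. -/
lemma map_symmetrize_prod {C : Type*} [CommRing C] [Algebra k C] {l : ℕ} (γ : Fin l → C ⊗[k] B) :
    TensorProduct.map .id (symmetrize k B)
      (List.ofFn fun i => TensorProduct.map .id (TensorAlgebra.ι k) (γ i)).prod =
    ∑ σ : Equiv.Perm (Fin l),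
      (List.ofFn fun i => TensorProduct.map .id (TensorAlgebra.ι k) (γ (σ i))).prod := by
  let j : C ⊗[k] B →ₗ[k] C ⊗[k] TensorAlgebra k B := TensorProduct.map .id (TensorAlgebra.ι k)
  let P : MultilinearMap k (fun _ : Fin l => C ⊗[k] B) (C ⊗[k] TensorAlgebra k B) :=
    (MultilinearMap.mkPiAlgebraFin k l _).compLinearMap fun _ => j
  have hP : ∀ γ, P γ = (List.ofFn fun i => j (γ i)).prod := fun γ => by
    simp [P, MultilinearMap.mkPiAlgebraFin_apply]
  -- Commutativity of C gathers the coefficients into one product, which no permutation changes.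
  have hpure : ∀ (c : Fin l → C) (b : Fin l → B), P (fun i => c i ⊗ₜ b i) =
      (∏ i, c i) ⊗ₜ TensorAlgebra.tprod k B l b := by
    intro c b
    rw [hP, TensorAlgebra.tprod_apply, ← List.prod_ofFn]
    clear hP P
    induction l with
    | zero => simp [Algebra.TensorProduct.one_def]
    | succ l ih =>
      rw [List.ofFn_succ, List.prod_cons, ih (fun i => γ i.succ) (fun i => c i.succ)
        (fun i => b i.succ)]
      simp [j]
  have hgoal : ∀ (c : Fin l → C) (b : Fin l → B),
      ((TensorProduct.map .id (symmetrize k B)).compMultilinearMap P) (fun i => c i ⊗ₜ b i) =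
      (∑ σ : Equiv.Perm (Fin l), P.domDomCongr σ) (fun i => c i ⊗ₜ b i) := by
    intro c b
    rw [LinearMap.compMultilinearMap_apply, hpure, TensorProduct.map_tmul, symmetrize_tprod,
      TensorProduct.tmul_sum, sum_apply]
    refine Finset.sum_congr rfl fun σ _ => ?_
    rw [MultilinearMap.domDomCongr_apply, hpure (fun i => c (σ i)) (fun i => b (σ i)),
      Equiv.prod_comp]
    rfl
  suffices h : (TensorProduct.map .id (symmetrize k B)).compMultilinearMap P =
      ∑ σ : Equiv.Perm (Fin l), P.domDomCongr σ by
    have := congrArg (fun f => f γ) h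
    simpa [hP, sum_apply] using this
  -- Multilinearity reduces the identity to a tensor product basis, whose members are pure tensors.
  refine Module.Basis.ext_multilinear (fun _ => (Module.Basis.ofVectorSpace k C).tensorProduct
    (Module.Basis.ofVectorSpace k B)) fun v => ?_
  simp only [Module.Basis.tensorProduct_apply']
  exact hgoal (fun i => Module.Basis.ofVectorSpace k C (v i).1)
    (fun i => Module.Basis.ofVectorSpace k B (v i).2)

end Symm

/-! ### The coproduct of a power, for commutative `B` -/

lemma sum_antidiagonalTuple_succ {A : Type*} [Semiring A] (β : ℕ → A) (l n : ℕ) :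
    ∑ w ∈ Finset.Nat.antidiagonalTuple (l + 1) n, (List.ofFn fun i => β (w i)).prod =
      ∑ p ∈ Finset.HasAntidiagonal.antidiagonal n, β p.1 *
        ∑ w ∈ Finset.Nat.antidiagonalTuple l p.2, (List.ofFn fun i => β (w i)).prod := by
  simp only [Finset.mul_sum]
  rw [Finset.sum_sigma']
  refine Finset.sum_nbij' (fun w => ⟨(w 0, ∑ i : Fin l, w i.succ), fun i => w i.succ⟩)
    (fun p => Fin.cons p.1.1 p.2) ?_ ?_ ?_ ?_ ?_
  · intro w hw
    rw [Finset.Nat.mem_antidiagonalTuple, Fin.sum_univ_succ] at hw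
    simpa [Finset.Nat.mem_antidiagonalTuple] using hw
  · rintro ⟨⟨i, j⟩, w⟩ hw
    simp only [Finset.mem_sigma, Finset.HasAntidiagonal.mem_antidiagonal, Finset.Nat.mem_antidiagonalTuple] at hw
    simp [Finset.Nat.mem_antidiagonalTuple, Fin.sum_univ_succ, hw.1, hw.2]
  · intro w _
    exact Fin.cons_self_tail w
  · rintro ⟨⟨i, j⟩, w⟩ hw
    simp only [Finset.mem_sigma, Finset.HasAntidiagonal.mem_antidiagonal, Finset.Nat.mem_antidiagonalTuple] at hw
    obtain ⟨_, rfl⟩ := hw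
    simp
  · intro w _
    rw [List.ofFn_succ, List.prod_cons]

/-- The recursion says z = 1 + β z for generating series, so z is the geometric series in β. Since β
0 = 0, tuples longer than n contribute nothing, and any cutoff L > n gives the same sum. -/
lemma eq_sum_antidiagonalTuple {A : Type*} [Semiring A] {β z : ℕ → A} (hβ : β 0 = 0)
    (hz : z 0 = 1)
    (hsucc : ∀ n, z (n + 1) = ∑ p ∈ Finset.HasAntidiagonal.antidiagonal (n + 1), β p.1 * z p.2)
    (n L : ℕ)
    (hL : n < L) :
    z n = ∑ l ∈ Finset.range L,
      ∑ w ∈ Finset.Nat.antidiagonalTuple l n, (List.ofFn fun i => β (w i)).prod := by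
  induction n using Nat.strong_induction_on generalizing L with
  | _ n ih =>
    obtain ⟨L, rfl⟩ : ∃ L', L = L' + 1 := ⟨L - 1, by omega⟩
    rw [Finset.sum_range_succ']
    simp only [sum_antidiagonalTuple_succ]
    rw [Finset.sum_comm]
    simp only [← Finset.mul_sum]
    have key : ∀ p ∈ Finset.HasAntidiagonal.antidiagonal n, n ≠ 0 → β p.1 * z p.2 =
        β p.1 * ∑ l ∈ Finset.range L, ∑ w ∈ Finset.Nat.antidiagonalTuple l p.2,
          (List.ofFn fun i => β (w i)).prod := by
      rintro ⟨i, j⟩ hp hn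
      rw [Finset.HasAntidiagonal.mem_antidiagonal] at hp
      rcases Nat.eq_zero_or_pos i with rfl | hi
      · simp [hβ]
      · rw [← ih j (by simp at hp; omega) L (by simp at hp; omega)]
    rcases n with _ | n
    · simp [hz, hβ]
    · rw [← Finset.sum_congr rfl fun p hp => key p hp n.succ_ne_zero, hsucc]
      simp

section Power

variable {k B : Type*} [Field k]

section Module

variable [AddCommGroup B] [Module k B]

/-- Insertion of a letter at the beginning of a word of `T(B)⁺`. -/
def consTPlus : B →ₗ[k] Module.End k (TPlus k B) :=
  LinearMap.mk₂ k (fun b a => ⟨TensorAlgebra.ι k b * a, ι_mul_mem_TPlus b _⟩)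
    (fun _ _ _ => by ext; simp [add_mul]) (fun _ _ _ => by ext; simp)
    (fun _ _ _ => by ext; simp [mul_add]) (fun _ _ _ => by ext; simp)

@[simp] lemma coe_consTPlus (b : B) (a : TPlus k B) :
    (consTPlus b a : TensorAlgebra k B) = TensorAlgebra.ι k b * a := rfl

lemma consLetter_ι_mul (b : B) (a : TPlus k B) (u : TT k B) :
    consLetter b (TensorAlgebra.ι k a * u) = TensorAlgebra.ι k (consTPlus b a) * u := by
  rw [← gen_coe, ← gen_coe, consLetter_gen_mul _ a.2, coe_consTPlus]

/-- A letter as an element of `T(B)⁺`. -/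
def ιTPlus : B →ₗ[k] TPlus k B :=
  (TensorAlgebra.ι k).codRestrict _ (ι_mem_TPlus k)

@[simp] lemma coe_ιTPlus (b : B) : (ιTPlus b : TPlus k B) = TensorAlgebra.ι k b := rfl

lemma consBlock_eq (b : B) (u : TT k B) : consBlock b u = TensorAlgebra.ι k (ιTPlus b) * u := by
  rw [← gen_coe]; rfl

end Module

variable [NonUnitalRing B] [Module k B] [IsScalarTower k B B] [SMulCommClass k B B]

/-- The operator `insertOp` with values in `T(T(B)⁺) ⊗ T(B)`. -/
def insertWord : B ⊗[k] B →ₗ[k] Module.End k (TT k B ⊗[k] TensorAlgebra k B) :=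
  twist consBlock (LinearMap.mul k (TensorAlgebra k B) ∘ₗ TensorAlgebra.ι k) +
    twist consLetter mulHead

lemma insertWord_tmul (b c : B) (u : TT k B) (a : TensorAlgebra k B) :
    insertWord (b ⊗ₜ c) (u ⊗ₜ a) =
      consBlock b u ⊗ₜ (TensorAlgebra.ι k c * a) + consLetter b u ⊗ₜ mulHead c a := rfl

/-- Iterated insertion, starting from the empty word. -/
def insertPow (s : B ⊗[k] B) : ℕ → TT k B ⊗[k] TensorAlgebra k B
  | 0 => 1
  | n + 1 => insertWord s (insertPow s n)

/-- The element of `T(B)⁺ ⊗ B` obtained from the `(n + 1)`-st power of `s ∈ B ⊗ B`. -/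
def blockPow (s : B ⊗[k] B) : ℕ → TPlus k B ⊗[k] B
  | 0 => TensorProduct.map ιTPlus .id s
  | n + 1 => twist consTPlus (LinearMap.mul k B) s (blockPow s n)

lemma insertWord_one (s : B ⊗[k] B) : insertWord s (1 : TT k B ⊗[k] TensorAlgebra k B) =
    TensorProduct.map (TensorAlgebra.ι k) (TensorAlgebra.ι k)
      (TensorProduct.map ιTPlus .id s) := by
  induction s with
  | zero => simp
  | add a b ha hb => simp only [map_add, LinearMap.add_apply, ha, hb]
  | tmul b c =>
    rw [Algebra.TensorProduct.one_def, insertWord_tmul]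
    simp [consBlock_eq]

/-- With t as the first block of the product, the new letter either forms a block by itself or is
absorbed into t. -/
lemma insertWord_mul (s : B ⊗[k] B) (t : TPlus k B ⊗[k] B) (w : TT k B ⊗[k] TensorAlgebra k B) :
    insertWord s (TensorProduct.map (TensorAlgebra.ι k) (TensorAlgebra.ι k) t * w) =
      TensorProduct.map (TensorAlgebra.ι k) (TensorAlgebra.ι k)
        (TensorProduct.map ιTPlus .id s) *
          (TensorProduct.map (TensorAlgebra.ι k) (TensorAlgebra.ι k) t * w) +
      TensorProduct.map (TensorAlgebra.ι k) (TensorAlgebra.ι k)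
        (twist consTPlus (LinearMap.mul k B) s t) * w := by
  induction s with
  | zero => simp
  | add a b ha hb => simp only [map_add, LinearMap.add_apply, ha, hb, add_mul]; abel
  | tmul b c =>
    induction t with
    | zero => simp
    | add a b ha hb => simp only [map_add, ha, hb, add_mul, mul_add]; abel
    | tmul t m =>
      induction w with
      | zero => simp
      | add a b ha hb => simp only [map_add, ha, hb, mul_add]; abel
      | tmul u a =>
        simp only [TensorProduct.map_tmul, Algebra.TensorProduct.tmul_mul_tmul, insertWord_tmul,
          consLetter_ι_mul, consBlock_eq, mulHead_ι_mul, twist_tmul, LinearMap.mul_apply',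
          LinearMap.id_apply]

/-- The i-th summand collects the compositions whose first block has length i + 1. A further
insertion opens a block, giving the new summand i = 0, or lengthens the first one, moving i to i +
1. -/
lemma insertPow_succ (s : B ⊗[k] B) (n : ℕ) :
    insertPow s (n + 1) = ∑ i ∈ Finset.range (n + 1),
      TensorProduct.map (TensorAlgebra.ι k) (TensorAlgebra.ι k) (blockPow s i) *
        insertPow s (n - i) := by
  induction n with
  | zero => simp [insertPow, blockPow, insertWord_one]
  | succ n ih =>
    rw [insertPow, ih, map_sum, Finset.sum_range_succ' _ (n + 1)]
    simp only [insertWord_mul, Finset.sum_add_distrib]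
    rw [← Finset.mul_sum, ← ih, add_comm]
    simp [blockPow]

/-- The second tensor factor must avoid the empty word: `gen` sends it to 0, but a letter inserted
into it beforehand would survive. By `insertWord_mem` this holds after one insertion. -/
lemma map_gen_insertWord (s : B ⊗[k] B) {z : TT k B ⊗[k] TensorAlgebra k B}
    (hz : z ∈ Submodule.span k {w | ∃ u, ∃ a ∈ TPlus k B, u ⊗ₜ a = w}) :
    TensorProduct.map .id (gen k B) (insertWord s z) =
      insertOp s (TensorProduct.map .id (gen k B) z) := by
  induction hz using Submodule.span_induction with
  | zero => simp
  | add a b _ _ ha hb => simp only [map_add, ha, hb]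
  | smul c a _ ha => simp only [map_smul, ha]
  | mem z hz =>
    obtain ⟨u, a, ha, rfl⟩ := hz
    induction s with
    | zero => simp
    | add a b ha hb => simp only [map_add, LinearMap.add_apply, ha, hb]
    | tmul b c =>
      rw [insertWord_tmul, insertOp_apply]
      simp [consLetter_gen _ ha, mulLetter_gen]

lemma insertWord_mem (s : B ⊗[k] B) (z : TT k B ⊗[k] TensorAlgebra k B) :
    insertWord s z ∈ Submodule.span k {w | ∃ u, ∃ a ∈ TPlus k B, u ⊗ₜ a = w} := by
  induction z with
  | zero => simp
  | add a b ha hb => rw [map_add]; exact add_mem ha hb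
  | tmul u a =>
    induction s with
    | zero => simp
    | add a b ha hb => rw [map_add]; exact add_mem ha hb
    | tmul b c =>
      rw [insertWord_tmul]
      exact add_mem (Submodule.subset_span ⟨_, _, ι_mul_mem_TPlus _ _, rfl⟩)
        (Submodule.subset_span ⟨_, _, mulHead_mem_TPlus _ _, rfl⟩)

lemma comulOnTensor_pow [NonUnitalBialgebra k B] (x : B) (n : ℕ) :
    comulOnTensor k B (TensorAlgebra.ι k x ^ (n + 1)) =
      TensorProduct.map .id (gen k B) (insertPow (Coalgebra.comul x) (n + 1)) := by
  induction n with
  | zero =>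
    rw [zero_add, pow_one, comulOnTensor_ι, insertPow, insertPow, insertWord_one]
    generalize (Coalgebra.comul x : B ⊗[k] B) = s
    induction s with
    | zero => simp
    | add a b ha hb => simp only [map_add, ha, hb]
    | tmul b c => simp [← gen_coe]
  | succ n ih =>
    rw [pow_succ', comulOnTensor_ι_mul x (by rw [pow_succ']; exact ι_mul_mem_TPlus _ _), ih,
      insertPow, ← map_gen_insertWord _ (insertWord_mem _ _), ← insertPow, ← insertPow]

/-- The blocks of the coproduct of a power are symmetric. -/
lemma map_symmetrizeTPlus_blockPow (hcomm : ∀ x y : B, x * y = y * x) (s : B ⊗[k] B) (n : ℕ) :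
    TensorProduct.map (symmetrizeTPlus k B) .id (blockPow s n) =
      (n + 1).factorial • blockPow s n := by
  -- The unitization provides commutative coefficients with a unit, as required by
  -- `map_symmetrize_prod`.
  let : CommRing (Unitization k B) :=
    { (inferInstance : Ring (Unitization k B)) with
      mul_comm := fun a b => by
        ext
        · simp [mul_comm]
        · simp [hcomm, add_comm] }
  -- Under this embedding the recursively defined block becomes the (n+1)-st power of γ, the flip of
  -- s, and a power is visibly invariant under permutation of its factors.
  let Ψ : TPlus k B ⊗[k] B →ₗ[k] Unitization k B ⊗[k] TensorAlgebra k B :=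
    (TensorProduct.comm k _ _).toLinearMap ∘ₗ
      TensorProduct.map (TPlus k B).subtype (Unitization.inrHom k k B)
  have hΨ : Function.Injective Ψ := by
    refine (TensorProduct.comm k _ _).injective.comp ?_
    exact TensorProduct.map_injective_of_flat_flat _ _ Subtype.val_injective
      Unitization.inr_injective
  let γ : Unitization k B ⊗[k] B :=
    TensorProduct.comm k _ _ (TensorProduct.map .id (Unitization.inrHom k k B) s)
  have hpow : ∀ n, Ψ (blockPow s n) =
      TensorProduct.map .id (TensorAlgebra.ι k) γ ^ (n + 1) := by
    intro n
    induction n with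
    | zero =>
      rw [zero_add, pow_one, blockPow]
      simp only [Ψ, γ]
      induction s with
      | zero => simp
      | add a b ha hb => simp only [map_add, ha, hb]
      | tmul b c => simp
    | succ n ih =>
      rw [pow_succ', ← ih, blockPow]
      generalize blockPow s n = t
      simp only [Ψ, γ]
      clear ih
      induction s with
      | zero => simp
      | add a b ha hb => simp only [map_add, LinearMap.add_apply, ha, hb, add_mul]
      | tmul b c =>
        induction t with
        | zero => simp
        | add a b ha hb => simp only [map_add, ha, hb, mul_add]
        | tmul t m => simp
  have hsym : ∀ t, Ψ (TensorProduct.map (symmetrizeTPlus k B) .id t) =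
      TensorProduct.map .id (symmetrize k B) (Ψ t) := by
    intro t
    induction t with
    | zero => simp
    | add a b ha hb => simp only [map_add, ha, hb]
    | tmul t m => simp [Ψ, coe_symmetrizeTPlus]
  apply hΨ
  have h := map_symmetrize_prod (fun _ : Fin (n + 1) => γ)
  rw [List.ofFn_const, List.prod_replicate, ← hpow, ← hsym, Finset.sum_const, Finset.card_univ,
    Fintype.card_perm, Fintype.card_fin] at h
  rw [h, map_nsmul]

end Power

/-! ### The coproduct of `S(T(B)⁺)` preserves `S(S(B)⁺)` -/

section SS

variable {k B : Type*} [Field k] [AddCommGroup B] [Module k B]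

lemma ι_symmetrizeTPlus_mem (a : TPlus k B) :
    SymmetricAlgebra.ι k (TPlus k B) (symmetrizeTPlus k B a) ∈ SS k B :=
  Algebra.subset_adjoin ⟨_, range_symmetrizeTPlus (k := k) (B := B) ▸ ⟨a, rfl⟩, rfl⟩

variable (k B) in
/-- The generators of `S(S(B)⁺)`: the linear map `T(B)⁺ → S(S(B)⁺)` induced by symmetrization. -/
def ιSS : TPlus k B →ₗ[k] SS k B :=
  (SymmetricAlgebra.ι k (TPlus k B) ∘ₗ symmetrizeTPlus k B).codRestrict
    (Subalgebra.toSubmodule (SS k B)) ι_symmetrizeTPlus_mem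

@[simp] lemma coe_ιSS (a : TPlus k B) :
    (ιSS k B a : ST k B) = SymmetricAlgebra.ι k (TPlus k B) (symmetrizeTPlus k B a) := rfl

lemma adjoin_range_ιSS : Algebra.adjoin k (Set.range (ιSS k B)) = ⊤ := by
  refine Subalgebra.map_injective (f := (SS k B).val) Subtype.val_injective ?_
  rw [AlgHom.map_adjoin, Algebra.map_top, Subalgebra.range_val]
  change _ = Algebra.adjoin k _
  congr 1
  rw [← Set.range_comp, ← range_symmetrizeTPlus, LinearMap.coe_range, ← Set.range_comp]
  rfl

lemma map_symmetrize_mem_range {q : TensorAlgebra k B →ₗ[k] ST k B}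
    (hq : ∀ a, q a = SymmetricAlgebra.ι k (TPlus k B) (projPlus k B a))
    {w : ST k B ⊗[k] TensorAlgebra k B}
    (hw : w ∈ (Algebra.TensorProduct.map (SS k B).val (.id k (TensorAlgebra k B))).range) :
    TensorProduct.map .id (q ∘ₗ symmetrize k B) w ∈
      (Algebra.TensorProduct.map (SS k B).val (SS k B).val).range := by
  obtain ⟨v, rfl⟩ := hw
  change TensorProduct.map .id _ (Algebra.TensorProduct.map (SS k B).val (.id k _) v) ∈ _
  induction v with
  | zero => simp
  | add a b ha hb => rw [map_add, map_add]; exact add_mem ha hb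
  | tmul s a =>
    refine ⟨s ⊗ₜ ιSS k B (projPlus k B a), ?_⟩
    simp [hq, projPlus_symmetrize]

/-- In characteristic zero t is m⁻¹ times its own symmetrization, whose first tensor factor lies in
S(B)⁺. -/
lemma map_ι_mem_range [CharZero k] {t : TPlus k B ⊗[k] B} {m : ℕ} (hm : m ≠ 0)
    (ht : TensorProduct.map (symmetrizeTPlus k B) .id t = m • t) :
    TensorProduct.map (SymmetricAlgebra.ι k (TPlus k B)) (TensorAlgebra.ι k) t ∈
      (Algebra.TensorProduct.map (SS k B).val (.id k (TensorAlgebra k B))).range := by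
  have h : ∀ t : TPlus k B ⊗[k] B,
      TensorProduct.map (SymmetricAlgebra.ι k (TPlus k B)) (TensorAlgebra.ι k)
        (TensorProduct.map (symmetrizeTPlus k B) .id t) ∈
      (Algebra.TensorProduct.map (SS k B).val (.id k (TensorAlgebra k B))).range := by
    intro t
    induction t with
    | zero => simp
    | add a b ha hb => rw [map_add, map_add]; exact add_mem ha hb
    | tmul a b => exact ⟨ιSS k B a ⊗ₜ TensorAlgebra.ι k b, by simp⟩
  have hm' : (m : k) ≠ 0 := Nat.cast_ne_zero.2 hm
  have h' := Subalgebra.smul_mem _ (h t) (m : k)⁻¹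
  rwa [ht, ← Nat.cast_smul_eq_nsmul k, map_smul, inv_smul_smul₀ hm'] at h'

/-- A symmetric sum of products of elements of `C ⊗ B` is fixed by symmetrization, up to `l!`. -/
lemma map_symmetrize_sum_antidiagonalTuple {C : Type*} [CommRing C] [Algebra k C]
    (γ : ℕ → C ⊗[k] B) (l n : ℕ) :
    TensorProduct.map .id (symmetrize k B) (∑ w ∈ Finset.Nat.antidiagonalTuple l n,
      (List.ofFn fun i => TensorProduct.map .id (TensorAlgebra.ι k) (γ (w i))).prod) =
    l.factorial • ∑ w ∈ Finset.Nat.antidiagonalTuple l n,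
      (List.ofFn fun i => TensorProduct.map .id (TensorAlgebra.ι k) (γ (w i))).prod := by
  rw [map_sum]
  simp only [fun w : Fin l → ℕ => map_symmetrize_prod fun i => γ (w i)]
  rw [Finset.sum_comm]
  have : ∀ σ ∈ (Finset.univ : Finset (Equiv.Perm (Fin l))),
      ∑ w ∈ Finset.Nat.antidiagonalTuple l n,
        (List.ofFn fun i => TensorProduct.map .id (TensorAlgebra.ι k) (γ (w (σ i)))).prod =
      ∑ w ∈ Finset.Nat.antidiagonalTuple l n,
        (List.ofFn fun i => TensorProduct.map .id (TensorAlgebra.ι k) (γ (w i))).prod := by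
    intro σ _
    -- Permuting the entries of a tuple preserves their sum, so every permutation merely reindexes
    -- the sum.
    refine Finset.sum_equiv (σ.symm.arrowCongr (Equiv.refl ℕ)) (fun w => ?_) fun w _ => rfl
    simp only [Finset.Nat.mem_antidiagonalTuple, Equiv.arrowCongr_apply, Equiv.symm_symm,
      Equiv.coe_refl, Function.comp_apply, id_eq]
    rw [Equiv.sum_comp σ w]
  rw [Finset.sum_congr rfl this, Finset.sum_const, Finset.card_univ, Fintype.card_perm,
    Fintype.card_fin]

end SS

section Projection

variable {k B : Type*} [Field k] [NonUnitalRing B] [Module k B]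

lemma toST_ι (a : TPlus k B) :
    toST k B (TensorAlgebra.ι k a) = SymmetricAlgebra.ι k (TPlus k B) a := by
  simp [toST]

lemma toST_surjective : Function.Surjective (toST k B) := by
  intro v
  induction v using SymmetricAlgebra.induction with
  | algebraMap r => exact ⟨algebraMap k _ r, AlgHom.commutes _ r⟩
  | ι a => exact ⟨_, toST_ι a⟩
  | mul a b ha hb =>
    obtain ⟨a, rfl⟩ := ha
    obtain ⟨b, rfl⟩ := hb
    exact ⟨a * b, map_mul _ a b⟩
  | add a b ha hb =>
    obtain ⟨a, rfl⟩ := ha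
    obtain ⟨b, rfl⟩ := hb
    exact ⟨a + b, map_add _ a b⟩

end Projection

/-! ### Stability of S(S(B)⁺) under the coproduct. -/

section Comul

variable {k B : Type*} [Field k] [NonUnitalRing B] [Module k B]
  [IsScalarTower k B B] [SMulCommClass k B B] [NonUnitalBialgebra k B]

/-- In S(T(B)⁺) ⊗ T(B) the coproduct is a sum of products of blocks β. Each block is symmetric in
its first factor, so the first factors lie in S(S(B)⁺). For fixed l the sum over tuples is 1/l!
times its symmetrization, so the second factors lie in S(B)⁺ after applying q. -/
lemma comulST_pow_mem [CharZero k] (hcomm : ∀ x y : B, x * y = y * x) (x : B) (n : ℕ) :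
    TensorProduct.map (toST k B).toLinearMap (toST k B).toLinearMap
      (comulOnTensor k B (TensorAlgebra.ι k x ^ (n + 1))) ∈
      (Algebra.TensorProduct.map (SS k B).val (SS k B).val).range := by
  set s : B ⊗[k] B := Coalgebra.comul x with hs
  let F : TT k B ⊗[k] TensorAlgebra k B →ₐ[k] ST k B ⊗[k] TensorAlgebra k B :=
    Algebra.TensorProduct.map (toST k B) (.id k _)
  let q : TensorAlgebra k B →ₗ[k] ST k B := (toST k B).toLinearMap ∘ₗ gen k B
  have hq : ∀ a, q a = SymmetricAlgebra.ι k (TPlus k B) (projPlus k B a) := fun a =>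
    toST_ι (projPlus k B a)
  -- Indexed by the length of the block: there is none of length 0, and `blockPow s r` has r + 1
  -- letters.
  let γ : ℕ → ST k B ⊗[k] B := fun r =>
    match r with
    | 0 => 0
    | r + 1 => TensorProduct.map (SymmetricAlgebra.ι k (TPlus k B)) .id (blockPow s r)
  let β : ℕ → ST k B ⊗[k] TensorAlgebra k B := fun r =>
    TensorProduct.map .id (TensorAlgebra.ι k) (γ r)
  have hβ : ∀ r, β (r + 1) =
      TensorProduct.map (SymmetricAlgebra.ι k (TPlus k B)) (TensorAlgebra.ι k) (blockPow s r) := by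
    intro r
    simp only [β, γ]
    rw [← LinearMap.comp_apply, ← TensorProduct.map_comp]
    rfl
  have hFβ : ∀ r, F (TensorProduct.map (TensorAlgebra.ι k) (TensorAlgebra.ι k) (blockPow s r)) =
      β (r + 1) := by
    intro r
    rw [hβ]
    generalize blockPow s r = t
    induction t with
    | zero => simp
    | add a b ha hb => simp only [map_add, ha, hb]
    | tmul a b => simp [F, toST_ι]
  have hz := eq_sum_antidiagonalTuple (β := β) (z := fun n => F (insertPow s n))
    (by simp [β, γ]) (by simp [insertPow]) (fun n => by
      rw [Finset.Nat.antidiagonal_succ, Finset.sum_cons, Finset.sum_map]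
      simp only [insertPow_succ, map_sum, map_mul, hFβ]
      rw [Finset.Nat.sum_antidiagonal_eq_sum_range_succ_mk]
      simp [β, γ]) (n + 1) (n + 2) (Nat.lt_succ_self _)
  have h1 : TensorProduct.map (toST k B).toLinearMap (toST k B).toLinearMap
      (comulOnTensor k B (TensorAlgebra.ι k x ^ (n + 1))) =
      TensorProduct.map .id q (F (insertPow s (n + 1))) := by
    rw [comulOnTensor_pow]
    generalize insertPow s (n + 1) = t
    induction t with
    | zero => simp
    | add a b ha hb => simp only [map_add, ha, hb]
    | tmul a b => simp [F, q]
  rw [h1, hz, map_sum]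
  refine Subalgebra.sum_mem _ fun l _ => ?_
  have hmem : ∑ w ∈ Finset.Nat.antidiagonalTuple l (n + 1), (List.ofFn fun i => β (w i)).prod ∈
      (Algebra.TensorProduct.map (SS k B).val (.id k (TensorAlgebra k B))).range := by
    refine Subalgebra.sum_mem _ fun w _ => Subalgebra.list_prod_mem _ fun y hy => ?_
    rw [List.mem_ofFn] at hy
    obtain ⟨i, rfl⟩ := hy
    rcases w i with _ | r
    · simp [β, γ]
    · rw [hβ]
      exact map_ι_mem_range (Nat.factorial_ne_zero (r + 1)) (map_symmetrizeTPlus_blockPow hcomm s r)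
  have hsymm := map_symmetrize_sum_antidiagonalTuple γ l (n + 1)
  have h2 := map_symmetrize_mem_range hq hmem
  rw [← LinearMap.id_comp (LinearMap.id : ST k B →ₗ[k] ST k B), TensorProduct.map_comp,
    LinearMap.comp_apply] at h2
  have h3 := Subalgebra.smul_mem _ h2 (l.factorial : k)⁻¹
  rw [← map_smul, hsymm, ← Nat.cast_smul_eq_nsmul k,
    inv_smul_smul₀ (Nat.cast_ne_zero.2 l.factorial_ne_zero)] at h3
  exact h3

lemma comulST_toST (u : TT k B) : comulST k B (toST k B u) =
    TensorProduct.map (toST k B).toLinearMap (toST k B).toLinearMap (renormComul k B u) := by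
  have : (comulST k B).comp (toST k B) =
      (Algebra.TensorProduct.map (toST k B) (toST k B)).comp (renormComul k B) := by
    ext a
    simp [comulST, toST, renormComul]
  exact DFunLike.congr_fun this u

lemma counitST_toST (u : TT k B) : counitST k B (toST k B u) = renormCounit k B u := by
  have : (counitST k B).comp (toST k B) = renormCounit k B := by
    ext a
    simp [counitST, toST, renormCounit]
  exact DFunLike.congr_fun this u

lemma comulST_mem [CharZero k] (hcomm : ∀ x y : B, x * y = y * x) {v : ST k B} (hv : v ∈ SS k B) :
    comulST k B v ∈ (Algebra.TensorProduct.map (SS k B).val (SS k B).val).range := by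
  suffices h : SS k B ≤
      ((Algebra.TensorProduct.map (SS k B).val (SS k B).val).range).comap (comulST k B) from h hv
  refine Algebra.adjoin_le ?_
  rintro _ ⟨a, ha, rfl⟩
  rw [SetLike.mem_coe, Subalgebra.mem_comap, ← toST_ι, comulST_toST, ← gen_coe,
    renormComul_gen a.2]
  have ha' := SPlus_le_span_pow ha
  clear ha
  induction ha' using Submodule.span_induction with
  | zero => simp
  | add a b _ _ ha hb => rw [Submodule.coe_add, map_add, map_add]; exact add_mem ha hb
  | smul c a _ ha =>
    rw [Submodule.coe_smul, map_smul, map_smul]; exact Subalgebra.smul_mem _ ha c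
  | mem a ha =>
    obtain ⟨x, n, ha⟩ := ha
    rw [ha]
    exact comulST_pow_mem hcomm x n

end Comul

/-! ### Transfer of bialgebra structures along algebra maps -/

section Transfer

variable {k A A' : Type*} [Field k] [Ring A] [Ring A'] [Algebra k A] [Algebra k A']
  {Δ : A →ₐ[k] A ⊗[k] A} {ε : A →ₐ[k] k} {Δ' : A' →ₐ[k] A' ⊗[k] A'} {ε' : A' →ₐ[k] k}
  {q : A →ₐ[k] A'}

/-- This and the next three lemmas transport each side of the bialgebra axioms along q. Cancelling a
surjective q on the right, or an injective tensor power of q on the left, then transfers the axioms.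
-/
lemma coassoc_left_comp (hΔ : Δ'.comp q = (Algebra.TensorProduct.map q q).comp Δ) :
    ((Algebra.TensorProduct.assoc k k k A' A' A').toAlgHom.comp
      ((Algebra.TensorProduct.map Δ' (.id k A')).comp Δ')).comp q =
    (Algebra.TensorProduct.map q (Algebra.TensorProduct.map q q)).comp
      ((Algebra.TensorProduct.assoc k k k A A A).toAlgHom.comp
        ((Algebra.TensorProduct.map Δ (.id k A)).comp Δ)) := by
  have hΔ' := fun a => DFunLike.congr_fun hΔ a
  simp only [AlgHom.comp_apply] at hΔ'
  ext a
  simp only [AlgHom.comp_apply, hΔ']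
  induction Δ a with
  | zero => simp
  | add s t hs ht => simp only [map_add, hs, ht]
  | tmul a b =>
    simp only [Algebra.TensorProduct.map_tmul, hΔ']
    induction Δ a with
    | zero => simp
    | add s t hs ht => simp only [map_add, TensorProduct.add_tmul, hs, ht]
    | tmul a c => rfl

lemma coassoc_right_comp (hΔ : Δ'.comp q = (Algebra.TensorProduct.map q q).comp Δ) :
    ((Algebra.TensorProduct.map (.id k A') Δ').comp Δ').comp q =
    (Algebra.TensorProduct.map q (Algebra.TensorProduct.map q q)).comp
      ((Algebra.TensorProduct.map (.id k A) Δ).comp Δ) := by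
  have hΔ' := fun a => DFunLike.congr_fun hΔ a
  simp only [AlgHom.comp_apply] at hΔ'
  ext a
  simp only [AlgHom.comp_apply, hΔ']
  induction Δ a with
  | zero => simp
  | add s t hs ht => simp only [map_add, hs, ht]
  | tmul a b => simp only [Algebra.TensorProduct.map_tmul, hΔ', AlgHom.id_apply]

lemma counit_left_comp (hΔ : Δ'.comp q = (Algebra.TensorProduct.map q q).comp Δ)
    (hε : ε'.comp q = ε) :
    ((Algebra.TensorProduct.map ε' (.id k A')).comp Δ').comp q =
    (Algebra.TensorProduct.map (.id k k) q).comp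
      ((Algebra.TensorProduct.map ε (.id k A)).comp Δ) := by
  rw [AlgHom.comp_assoc, hΔ, ← AlgHom.comp_assoc, ← AlgHom.comp_assoc,
    ← Algebra.TensorProduct.map_comp, ← Algebra.TensorProduct.map_comp, hε]
  rfl

lemma counit_right_comp (hΔ : Δ'.comp q = (Algebra.TensorProduct.map q q).comp Δ)
    (hε : ε'.comp q = ε) :
    ((Algebra.TensorProduct.map (.id k A') ε').comp Δ').comp q =
    (Algebra.TensorProduct.map q (.id k k)).comp
      ((Algebra.TensorProduct.map (.id k A) ε).comp Δ) := by
  rw [AlgHom.comp_assoc, hΔ, ← AlgHom.comp_assoc, ← AlgHom.comp_assoc,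
    ← Algebra.TensorProduct.map_comp, ← Algebra.TensorProduct.map_comp, hε]
  rfl

lemma IsBialgebra.of_surjective (h : IsBialgebra Δ ε) (hq : Function.Surjective q)
    (hΔ : Δ'.comp q = (Algebra.TensorProduct.map q q).comp Δ) (hε : ε'.comp q = ε) :
    IsBialgebra Δ' ε' := by
  refine ⟨?_, ?_, ?_⟩
  · rw [← AlgHom.cancel_right hq, coassoc_left_comp hΔ, coassoc_right_comp hΔ, h.coassoc]
  · rw [← AlgHom.cancel_right hq, counit_left_comp hΔ hε, h.counit_left]
    ext a
    simp
  · rw [← AlgHom.cancel_right hq, counit_right_comp hΔ hε, h.counit_right]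
    ext a
    simp

lemma IsBialgebra.of_injective (h : IsBialgebra Δ' ε') (hq : Function.Injective q)
    (hΔ : Δ'.comp q = (Algebra.TensorProduct.map q q).comp Δ) (hε : ε'.comp q = ε) :
    IsBialgebra Δ ε := by
  have hq' : Function.Injective q.toLinearMap := hq
  have hid : Function.Injective (LinearMap.id : k →ₗ[k] k) := Function.injective_id
  refine ⟨?_, ?_, ?_⟩
  · have hinj : Function.Injective (Algebra.TensorProduct.map q (Algebra.TensorProduct.map q q)) :=
      TensorProduct.map_injective_of_flat_flat q.toLinearMap
        (TensorProduct.map q.toLinearMap q.toLinearMap) hq'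
        (TensorProduct.map_injective_of_flat_flat _ _ hq' hq')
    rw [← AlgHom.cancel_left hinj, ← coassoc_left_comp hΔ, ← coassoc_right_comp hΔ, h.coassoc]
  · have hinj : Function.Injective (Algebra.TensorProduct.map (.id k k) q) :=
      TensorProduct.map_injective_of_flat_flat _ _ hid hq'
    rw [← AlgHom.cancel_left hinj, ← counit_left_comp hΔ hε, h.counit_left]
    ext a
    simp
  · have hinj : Function.Injective (Algebra.TensorProduct.map q (.id k k)) :=
      TensorProduct.map_injective_of_flat_flat _ _ hq' hid
    rw [← AlgHom.cancel_left hinj, ← counit_right_comp hΔ hε, h.counit_right]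
    ext a
    simp

end Transfer

/-! ### The bialgebras `S(T(B)⁺)` and `S(S(B)⁺)` -/

lemma map_val_injective {k A : Type*} [Field k] [Ring A] [Algebra k A] (S : Subalgebra k A) :
    Function.Injective (Algebra.TensorProduct.map S.val S.val) :=
  TensorProduct.map_injective_of_flat_flat S.val.toLinearMap S.val.toLinearMap
    Subtype.val_injective Subtype.val_injective

section Bialgebra

variable {k B : Type*} [Field k] [NonUnitalRing B] [Module k B]

lemma coe_single (x : B) :
    (single k x : ST k B) = toST k B (gen k B (TensorAlgebra.ι k x)) := by
  rw [gen_of_mem (ι_mem_TPlus k x), toST_ι]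
  rfl

variable [IsScalarTower k B B] [SMulCommClass k B B] [NonUnitalBialgebra k B]

lemma isBialgebra_ST : IsBialgebra (comulST k B) (counitST k B) :=
  (isBialgebra_TT k B).of_surjective (q := toST k B) toST_surjective
    (AlgHom.ext comulST_toST) (AlgHom.ext counitST_toST)

/-- Over a field S(S(B)⁺) ⊗ S(S(B)⁺) embeds into S(T(B)⁺) ⊗ S(T(B)⁺), and `comulST_mem` places the
coproducts in its image. -/
lemma exists_comulSS [CharZero k] (hcomm : ∀ x y : B, x * y = y * x) :
    ∃ Δ : SS k B →ₐ[k] SS k B ⊗[k] SS k B,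
      (Algebra.TensorProduct.map (SS k B).val (SS k B).val).comp Δ =
        (comulST k B).comp (SS k B).val := by
  let V := Algebra.TensorProduct.map (SS k B).val (SS k B).val
  let e := AlgEquiv.ofInjective V (map_val_injective _)
  refine ⟨e.symm.toAlgHom.comp (AlgHom.codRestrict ((comulST k B).comp (SS k B).val) V.range
    fun v => comulST_mem hcomm v.2), AlgHom.ext fun v => ?_⟩
  exact congrArg Subtype.val (e.apply_symm_apply _)

variable {Δ : SS k B →ₐ[k] SS k B ⊗[k] SS k B}

lemma isBialgebra_SS (hΔ : (Algebra.TensorProduct.map (SS k B).val (SS k B).val).comp Δ =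
      (comulST k B).comp (SS k B).val) :
    IsBialgebra Δ ((counitST k B).comp (SS k B).val) :=
  isBialgebra_ST.of_injective (q := (SS k B).val) Subtype.val_injective hΔ.symm rfl

variable (k B) in
/-- The linear map `x ↦ {x}`. -/
def singleₗ : B →ₗ[k] SS k B where
  toFun := single k
  map_add' x y := by
    ext
    rw [Subalgebra.coe_add]
    change SymmetricAlgebra.ι k _ _ = SymmetricAlgebra.ι k _ _ + SymmetricAlgebra.ι k _ _
    rw [← map_add]
    congr 1
    ext
    simp
  map_smul' c x := by
    ext
    change SymmetricAlgebra.ι k _ _ = c • SymmetricAlgebra.ι k _ _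
    rw [← map_smul]
    congr 1
    ext
    simp

lemma comul_single (hΔ : (Algebra.TensorProduct.map (SS k B).val (SS k B).val).comp Δ =
      (comulST k B).comp (SS k B).val) (x : B) :
    Δ (single k x) = TensorProduct.map (singleₗ k B) (singleₗ k B) (Coalgebra.comul x) := by
  apply map_val_injective
  refine (DFunLike.congr_fun hΔ _).trans ?_
  rw [AlgHom.comp_apply, Subalgebra.coe_val, coe_single, comulST_toST,
    renormComul_gen (ι_mem_TPlus k x), comulOnTensor_ι]
  generalize (Coalgebra.comul x : B ⊗[k] B) = t
  induction t with
  | zero => simp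
  | add a b ha hb => simp only [map_add, ha, hb]
  | tmul a b => simp [singleₗ, coe_single]

lemma counit_single (x : B) :
    ((counitST k B).comp (SS k B).val) (single k x) = Coalgebra.counit x := by
  rw [AlgHom.comp_apply, Subalgebra.coe_val, coe_single, counitST_toST,
    renormCounit_gen (ι_mem_TPlus k x), TensorAlgebra.ι_leftInverse]

lemma sub_mem_commPinterIdeal (x : B) :
    single k x - algebraMap k (SS k B) (Coalgebra.counit x) ∈ commPinterIdeal k B :=
  Ideal.subset_span ⟨x, rfl⟩

lemma isCoideal_commPinterIdeal
    (hΔ : (Algebra.TensorProduct.map (SS k B).val (SS k B).val).comp Δ =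
      (comulST k B).comp (SS k B).val) :
    letI : Bialgebra k (SS k B) := (isBialgebra_SS hΔ).toBialgebra
    ((commPinterIdeal k B).restrictScalars k).IsCoideal := by
  let : Bialgebra k (SS k B) := (isBialgebra_SS hΔ).toBialgebra
  refine isCoideal_of_le (singleₗ k B) (comul_single hΔ) counit_single _
    sub_mem_commPinterIdeal fun K _ h => Ideal.span_le.2 ?_
  rintro _ ⟨x, rfl⟩
  exact h x

end Bialgebra

/-! ### The rescaling of `S(S(B)⁺)` -/

section ScaleSS

variable {k B : Type*} [Field k] [AddCommGroup B] [Module k B]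

/-- On words of a fixed length the rescaling treats all positions alike, so it commutes with
permutations. -/
lemma symmetrizeTPlus_scaleTPlus (p : B →ₗ[k] B) (a : TPlus k B) :
    symmetrizeTPlus k B (scaleTPlus p a) = scaleTPlus p (symmetrizeTPlus k B a) := by
  have h : ∀ {n : ℕ} (x : Fin n → B), TensorAlgebra.lift k ((2 : k) • TensorAlgebra.ι k ∘ₗ p)
      (TensorAlgebra.tprod k B n x) = TensorAlgebra.tprod k B n (fun i => (2 : k) • p (x i)) := by
    intro n x
    rw [TensorAlgebra.tprod_apply, TensorAlgebra.tprod_apply, map_list_prod, List.map_ofFn]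
    congr 2
    ext i
    simp
  have key : ∀ a ∈ TPlus k B,
      symmetrize k B (TensorAlgebra.lift k ((2 : k) • TensorAlgebra.ι k ∘ₗ p) a) =
        TensorAlgebra.lift k ((2 : k) • TensorAlgebra.ι k ∘ₗ p) (symmetrize k B a) := by
    intro a ha
    rw [TPlus_eq_span] at ha
    induction ha using Submodule.span_induction with
    | zero => simp
    | add a b _ _ ha hb => simp only [map_add, ha, hb]
    | smul c a _ ha => simp only [map_smul, ha]
    | mem a ha =>
      obtain ⟨n, x, rfl⟩ := ha
      rw [h, symmetrize_tprod, symmetrize_tprod, map_sum]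
      exact Finset.sum_congr rfl fun σ _ => (h _).symm
  ext
  rw [coe_symmetrizeTPlus, coe_scaleTPlus, coe_scaleTPlus, coe_symmetrizeTPlus, map_smul,
    key a a.2]

/-- The algebra endomorphism of `S(T(B)⁺)` extending `scaleTPlus p`. -/
def scaleST (p : B →ₗ[k] B) : ST k B →ₐ[k] ST k B :=
  SymmetricAlgebra.lift (SymmetricAlgebra.ι k (TPlus k B) ∘ₗ scaleTPlus p)

lemma scaleST_ι (p : B →ₗ[k] B) (a : TPlus k B) :
    scaleST p (SymmetricAlgebra.ι k (TPlus k B) a) =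
      SymmetricAlgebra.ι k (TPlus k B) (scaleTPlus p a) := by
  simp [scaleST]

lemma scaleST_mem (p : B →ₗ[k] B) {v : ST k B} (hv : v ∈ SS k B) : scaleST p v ∈ SS k B := by
  suffices h : SS k B ≤ (SS k B).comap (scaleST p) from h hv
  refine Algebra.adjoin_le ?_
  rintro _ ⟨_, ha, rfl⟩
  rw [SetLike.mem_coe, ← range_symmetrizeTPlus] at ha
  obtain ⟨a, rfl⟩ := ha
  rw [SetLike.mem_coe, Subalgebra.mem_comap, scaleST_ι, ← symmetrizeTPlus_scaleTPlus]
  exact ι_symmetrizeTPlus_mem _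

/-- The restriction of `scaleST p` to `S(S(B)⁺)`. -/
def scaleSS (p : B →ₗ[k] B) : SS k B →ₐ[k] SS k B :=
  ((scaleST p).comp (SS k B).val).codRestrict (SS k B) fun v => scaleST_mem p v.2

lemma coe_scaleSS (p : B →ₗ[k] B) (v : SS k B) : (scaleSS p v : ST k B) = scaleST p v := rfl

lemma scaleSS_ιSS (p : B →ₗ[k] B) (a : TPlus k B) :
    scaleSS p (ιSS k B a) = ιSS k B (scaleTPlus p a) := by
  ext
  rw [coe_scaleSS, coe_ιSS, scaleST_ι, coe_ιSS, symmetrizeTPlus_scaleTPlus]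

lemma adjoin_range_ι_eq_top :
    Algebra.adjoin k (Set.range (SymmetricAlgebra.ι k (TPlus k B))) = ⊤ := by
  refine Algebra.eq_top_iff.2 fun v => ?_
  induction v using SymmetricAlgebra.induction with
  | algebraMap r => exact Subalgebra.algebraMap_mem _ r
  | ι a => exact Algebra.subset_adjoin ⟨a, rfl⟩
  | mul a b ha hb => exact mul_mem ha hb
  | add a b ha hb => exact add_mem ha hb

lemma ιSS_ι (x : B) : ιSS k B ⟨TensorAlgebra.ι k x, ι_mem_TPlus k x⟩ = single k x := by
  ext
  rw [coe_ιSS]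
  change _ = SymmetricAlgebra.ι k _ _
  congr 1
  ext
  exact symmetrize_ι k x

variable [CharZero k]

lemma scaleSS_single (p : B →ₗ[k] B) (x : B) : scaleSS p (single k x) = single k (p x) := by
  rw [← ιSS_ι, scaleSS_ιSS, scaleTPlus_ι, ιSS_ι]

/-- The degree restricted from S(T(B)⁺) and the one spanned by products of symmetrized homogeneous
generators are defined differently. Both are the 2^d-eigenspace of the rescaling on S(S(B)⁺). -/
lemma degSS_eq_degAlg {𝒜 : ℕ → Submodule k B} (h𝒜 : ⨆ d, 𝒜 d = ⊤) {p : B →ₗ[k] B}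
    (hp : ∀ d, ∀ x ∈ 𝒜 d, p x = (2 : k) ^ d • x) : degSS 𝒜 = degAlg 𝒜 (ιSS k B) := by
  ext d v
  rw [eq_eigenspace_of_le_eigenspace (scaleSS p).toLinearMap
      (degAlg_le_eigenspace (ιSS k B) hp (scaleSS p) (scaleSS_ιSS p))
      (iSup_degAlg _ h𝒜 adjoin_range_ιSS) d, degSS, Submodule.mem_comap,
    eq_eigenspace_of_le_eigenspace (scaleST p).toLinearMap
      (degAlg_le_eigenspace _ hp (scaleST p) (scaleST_ι p))
      (iSup_degAlg _ h𝒜 adjoin_range_ι_eq_top) d,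
    Module.End.mem_eigenspace_iff, Module.End.mem_eigenspace_iff]
  exact (Subtype.val_injective (p := (· ∈ SS k B))).eq_iff
    (a := scaleSS p v) (b := (2 : k) ^ d • v)

end ScaleSS

section ScaleBialgebra

variable {k B : Type*} [Field k] [NonUnitalRing B] [Module k B]

lemma scaleST_toST (p : B →ₗ[k] B) (u : TT k B) :
    scaleST p (toST k B u) = toST k B (scaleTT p u) := by
  have : (scaleST p).comp (toST k B) = (toST k B).comp (scaleTT p) := by
    ext a
    simp [toST_ι, scaleST_ι, scaleTT_ι]
  exact DFunLike.congr_fun this u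

variable [CharZero k] [IsScalarTower k B B] [SMulCommClass k B B] [NonUnitalBialgebra k B] {p : B →ₗ[k] B}

lemma counitST_scaleST (hcounit : ∀ x, (Coalgebra.counit (p x) : k) = Coalgebra.counit x)
    (v : ST k B) : counitST k B (scaleST p v) = counitST k B v := by
  obtain ⟨u, rfl⟩ := toST_surjective v
  rw [scaleST_toST, counitST_toST, counitST_toST, renormCounit_scaleTT hcounit]

lemma comulST_scaleST (hmul : ∀ x y, p (x * y) = p x * p y)
    (hcomul : ∀ x, (Coalgebra.comul (p x) : B ⊗[k] B) =
      TensorProduct.map p p (Coalgebra.comul x)) (v : ST k B) :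
    comulST k B (scaleST p v) =
      TensorProduct.map (scaleST p).toLinearMap (scaleST p).toLinearMap (comulST k B v) := by
  obtain ⟨u, rfl⟩ := toST_surjective v
  rw [scaleST_toST, comulST_toST, comulST_toST, renormComul_scaleTT hmul hcomul]
  generalize renormComul k B u = t
  induction t with
  | zero => simp
  | add a b ha hb => simp only [map_add, ha, hb]
  | tmul a b => simp [scaleST_toST]

variable {Δ : SS k B →ₐ[k] SS k B ⊗[k] SS k B}

lemma comul_scaleSS (hΔ : (Algebra.TensorProduct.map (SS k B).val (SS k B).val).comp Δ =
      (comulST k B).comp (SS k B).val)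
    (hmul : ∀ x y, p (x * y) = p x * p y)
    (hcomul : ∀ x, (Coalgebra.comul (p x) : B ⊗[k] B) =
      TensorProduct.map p p (Coalgebra.comul x)) (v : SS k B) :
    Δ (scaleSS p v) =
      TensorProduct.map (scaleSS p).toLinearMap (scaleSS p).toLinearMap (Δ v) := by
  apply map_val_injective
  have h := fun v => DFunLike.congr_fun hΔ v
  simp only [AlgHom.comp_apply, Subalgebra.coe_val] at h
  rw [h, coe_scaleSS, comulST_scaleST hmul hcomul, ← h]
  generalize Δ v = t
  induction t with
  | zero => simp
  | add a b ha hb => simp only [map_add, ha, hb]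
  | tmul a b => simp [coe_scaleSS]

/-! ### The Hopf algebra `S(S(B)⁺) / J'` -/

lemma isConnectedGradedBialgebra_SS
    (hΔ : (Algebra.TensorProduct.map (SS k B).val (SS k B).val).comp Δ =
      (comulST k B).comp (SS k B).val) {𝒜 : ℕ → Submodule k B}
    (h : IsGradedNonUnitalBialgebra 𝒜) :
    letI : Bialgebra k (SS k B) := (isBialgebra_SS hΔ).toBialgebra
    letI := isCoideal_commPinterIdeal hΔ
    IsConnectedGradedBialgebra (degQuotient (degSS 𝒜) (commPinterIdeal k B)) := by
  let : Bialgebra k (SS k B) := (isBialgebra_SS hΔ).toBialgebra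
  have := isCoideal_commPinterIdeal hΔ
  obtain ⟨p, hp, hmul, hcounit, hcomul⟩ := exists_scale h
  have htop := h.isInternal.submodule_iSup_eq_top
  rw [degSS_eq_degAlg htop hp]
  refine isConnectedGradedBialgebra_degQuotient htop hp (ιSS k B) adjoin_range_ιSS (scaleSS p)
    (scaleSS_ιSS p) (fun v => counitST_scaleST hcounit v) (comul_scaleSS hΔ hmul hcomul) _
    (fun v hv => ?_) fun x => ⟨_, ιSS_ι (k := k) x ▸ sub_mem_commPinterIdeal x⟩
  suffices hle : commPinterIdeal k B ≤ (commPinterIdeal k B).comap (scaleSS p) from hle hv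
  refine Ideal.span_le.2 ?_
  rintro _ ⟨x, rfl⟩
  rw [SetLike.mem_coe, Ideal.mem_comap, map_sub, AlgHom.commutes, scaleSS_single, ← hcounit]
  exact sub_mem_commPinterIdeal _

end ScaleBialgebra

end

end Pinter

theorem mainTheorem5 {k : Type*} [Field k] [CharZero k]
    {B : Type*} [NonUnitalRing B] [Module k B] [IsScalarTower k B B] [SMulCommClass k B B]
    [NonUnitalBialgebra k B] :
    (∃ h : Pinter.IsBialgebra (Pinter.renormComul k B) (Pinter.renormCounit k B),
      letI : Bialgebra k (Pinter.TT k B) := h.toBialgebra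
      ∃ _ : ((Pinter.pinterIdeal k B).restrictScalars k).IsCoideal,
        Pinter.IsHopf k (Pinter.TT k B ⧸ Pinter.pinterIdeal k B) ∧
        ∀ 𝒜 : ℕ → Submodule k B, Pinter.IsGradedNonUnitalBialgebra 𝒜 →
          Pinter.IsConnectedGradedBialgebra
            (Pinter.degQuotient (Pinter.degTT 𝒜) (Pinter.pinterIdeal k B))) ∧
    ((∀ x y : B, x * y = y * x) →
      ∃ (Δ : Pinter.SS k B →ₐ[k] Pinter.SS k B ⊗[k] Pinter.SS k B) (ε : Pinter.SS k B →ₐ[k] k),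
        (Algebra.TensorProduct.map (Pinter.SS k B).val (Pinter.SS k B).val).comp Δ =
          (Pinter.comulST k B).comp (Pinter.SS k B).val ∧
        ε = (Pinter.counitST k B).comp (Pinter.SS k B).val ∧
        ∃ h : Pinter.IsBialgebra Δ ε,
          letI : Bialgebra k (Pinter.SS k B) := h.toBialgebra
          ∃ _ : ((Pinter.commPinterIdeal k B).restrictScalars k).IsCoideal,
            Pinter.IsHopf k (Pinter.SS k B ⧸ Pinter.commPinterIdeal k B) ∧
            ∀ 𝒜 : ℕ → Submodule k B, Pinter.IsGradedNonUnitalBialgebra 𝒜 →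
              Pinter.IsConnectedGradedBialgebra
                (Pinter.degQuotient (Pinter.degSS 𝒜) (Pinter.commPinterIdeal k B))) := by
  refine ⟨⟨Pinter.isBialgebra_TT k B, ?_⟩, fun hcomm => ?_⟩
  · let : Bialgebra k (Pinter.TT k B) := (Pinter.isBialgebra_TT k B).toBialgebra
    have := Pinter.isCoideal_pinterIdeal (k := k) (B := B)
    -- Existence of an antipode does not involve a grading of B, so the trivial one is used.
    exact ⟨this, (Pinter.isConnectedGradedBialgebra_TT Pinter.isGraded_trivialGrading).isHopf,
      fun _ h => Pinter.isConnectedGradedBialgebra_TT h⟩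
  · obtain ⟨Δ, hΔ⟩ := Pinter.exists_comulSS (k := k) hcomm
    refine ⟨Δ, _, hΔ, rfl, Pinter.isBialgebra_SS hΔ, ?_⟩
    let : Bialgebra k (Pinter.SS k B) := (Pinter.isBialgebra_SS hΔ).toBialgebra
    have := Pinter.isCoideal_commPinterIdeal hΔ
    exact ⟨this, (Pinter.isConnectedGradedBialgebra_SS hΔ Pinter.isGraded_trivialGrading).isHopf,
      fun _ h => Pinter.isConnectedGradedBialgebra_SS hΔ h⟩
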